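/- Let $N\ge 1$, let $\Omega\subset\mathbb R^N$ be open and bounded, $M>0$, $m\ge 2$, $\kappa\ge 0$, $Q=\Omega\times(0,M)$, $m'=m/(m-1)$. Assume: (H1) $v_0,u_0\in L^\infty(\Omega)$; (H2) $\alpha:\mathbb R\to\mathbb R$ is Lipschitz continuous and increasing, $\alpha(0)=0$, and there is $\lambda>0$ with $\alpha'(s)\ge\lambda$ for almost every $s\in\mathbb R$; (H3) $f:\mathbb R\to\mathbb R$ is Lipschitz continuous and there is $\sigma>0$ with $f(s)\ge\sigma$ for all $s\in\mathbb R$; (H4) there is $L_2>0$ with $|f(a)-f(b)|\le L_2|\alpha(a)-\alpha(b)|$ for all $a,b\in\mathbb R$. Consider the problem $$ (P)\qquad \partial_s\alpha(v)-\operatorname{div}\big(|\nabla v|^{m-2}\nabla v\big)=\kappa\,\frac{f(v)}{\big(\int_\Omega f(v)\,dx\big)^2}\ \text{ in } Q,\qquad v=0\ \text{ on }\partial\Omega\times(0,M),\qquad \alpha(v(\cdot,0))=\alpha(v_0)\ \text{ in }\Omega . $$ A bounded weak solution of $(P)$ with initial datum $v_0$ is a function $v\in L^\infty(Q)\cap L^m(0,M;W^{1,m}_0(\Omega))$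 that belongs to $L^\infty(t,M;W^{1,m}_0(\Omega))$ for every $t\in(0,M)$ and for which there is an element $\partial_s\alpha(v)$ of $L^{m'}(0,M;W^{-1,m'}(\Omega))$, where $W^{-1,m'}(\Omega)$ is the dual of $W^{1,m}_0(\Omega)$, such that $$ \int_0^M\Big\langle \partial_s\alpha(v),w\Big\rangle\,ds+\int_Q|\nabla v|^{m-2}\nabla v\cdot\nabla w=\kappa\int_Q\frac{f(v)}{\big(\int_\Omega f(v)\,dx\big)^2}\,w $$ for all $w\in L^m(0,M;W^{1,m}_0(\Omega))\cap L^\infty(Q)$, and $$ \int_0^M\Big\langle \partial_s\alpha(v),w\Big\rangle\,ds=-\int_0^M\!\!\int_\Omega[\alpha(v)-\alpha(v_0)]\,\partial_s w $$ for all $w\in W^{1,1}(0,M;L^1(\Omega))\cap L^m(0,M;W^{1,m}_0(\Omega))$ with $w(\cdot,M)=0$. Let $v$ and $u$ be bounded weak solutions of $(P)$ with initial data $v_0$ and $u_0$, respectively, where $v_0=u_0$ a.e. in $\Omega$. Then $v=u$ a.e. in $Q$. -/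

import Mathlib

open MeasureTheory Filter Topology Set
open scoped ENNReal NNReal ContDiff

namespace Thermistor

/-- Lebesgue measure on the space-time cylinder `Q`, points being written `(t, x)` with
`0 < t < M` and `x ∈ Ω`. -/
noncomputable def cylMeasure {N : ℕ} (Ω : Set (EuclideanSpace ℝ (Fin N))) (M : ℝ) :
    Measure (ℝ × EuclideanSpace ℝ (Fin N)) :=
  (volume.restrict (Ioo 0 M)).prod (volume.restrict Ω)

/-- `w ∈ W₀^{1,m}(Ω)` with weak gradient `G`: the pair `(w, G)` is a limit in
`L^m(Ω) × L^m(Ω)^N` of pairs `(φ, ∇φ)` with `φ ∈ C_c^∞(Ω)`. -/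
structure IsW0 {N : ℕ} (Ω : Set (EuclideanSpace ℝ (Fin N))) (m : ℝ)
    (w : EuclideanSpace ℝ (Fin N) → ℝ)
    (G : EuclideanSpace ℝ (Fin N) → EuclideanSpace ℝ (Fin N)) : Prop where
  memLp : MemLp w (ENNReal.ofReal m) (volume.restrict Ω)
  memLp_grad : MemLp G (ENNReal.ofReal m) (volume.restrict Ω)
  approx : ∃ φ : ℕ → EuclideanSpace ℝ (Fin N) → ℝ,
    (∀ n, ContDiff ℝ ∞ (φ n) ∧ HasCompactSupport (φ n) ∧ tsupport (φ n) ⊆ Ω) ∧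
    Tendsto (fun n => eLpNorm (fun x => φ n x - w x) (ENNReal.ofReal m) (volume.restrict Ω))
      atTop (𝓝 0) ∧
    Tendsto
      (fun n => eLpNorm (fun x => gradient (φ n) x - G x) (ENNReal.ofReal m) (volume.restrict Ω))
      atTop (𝓝 0)

/-- `u ∈ L^m(0, M; W₀^{1,m}(Ω))` with weak spatial gradient `Du`. -/
structure IsLmW0 {N : ℕ} (Ω : Set (EuclideanSpace ℝ (Fin N))) (M m : ℝ)
    (u : ℝ × EuclideanSpace ℝ (Fin N) → ℝ)
    (Du : ℝ × EuclideanSpace ℝ (Fin N) → EuclideanSpace ℝ (Fin N)) : Prop where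
  memLp : MemLp u (ENNReal.ofReal m) (cylMeasure Ω M)
  memLp_grad : MemLp Du (ENNReal.ofReal m) (cylMeasure Ω M)
  slice : ∀ᵐ t ∂(volume.restrict (Ioo 0 M)), IsW0 Ω m (fun x => u (t, x)) (fun x => Du (t, x))

/-- The `L^∞(t, M; W^{1,m}(Ω))` bound, for every `t ∈ (0, M)`. -/
def IsLocBddW {N : ℕ} (Ω : Set (EuclideanSpace ℝ (Fin N))) (M m : ℝ)
    (u : ℝ × EuclideanSpace ℝ (Fin N) → ℝ)
    (Du : ℝ × EuclideanSpace ℝ (Fin N) → EuclideanSpace ℝ (Fin N)) : Prop :=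
  ∀ t ∈ Ioo 0 M, ∃ C : ℝ≥0, ∀ᵐ s ∂(volume.restrict (Ioo t M)),
    eLpNorm (fun x => u (s, x)) (ENNReal.ofReal m) (volume.restrict Ω) +
      eLpNorm (fun x => Du (s, x)) (ENNReal.ofReal m) (volume.restrict Ω) ≤ C

/-- `u ∈ W^{1,1}(0, M; L^1(Ω))` with time derivative `∂ₛu = g` and `u(·, M) = 0`. -/
structure IsW11EndZero {N : ℕ} (Ω : Set (EuclideanSpace ℝ (Fin N))) (M : ℝ)
    (u g : ℝ × EuclideanSpace ℝ (Fin N) → ℝ) : Prop where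
  integrable : Integrable u (cylMeasure Ω M)
  integrable_deriv : Integrable g (cylMeasure Ω M)
  primitive : ∀ᵐ z ∂(cylMeasure Ω M), u z = -∫ s in z.1..M, g (s, z.2)

/-- An element of `L^{m'}(0, M; W^{-1,m'}(Ω))`, `m' = m / (m - 1)`. Elements of `W^{-1,m'}(Ω)`,
the dual of `W₀^{1,m}(Ω)`, are the distributions `a - div b` with `a ∈ L^{m'}(Ω)` and
`b ∈ L^{m'}(Ω)^N`. -/
structure NegSobolev {N : ℕ} (Ω : Set (EuclideanSpace ℝ (Fin N))) (M m : ℝ) where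
  a : ℝ × EuclideanSpace ℝ (Fin N) → ℝ
  b : ℝ × EuclideanSpace ℝ (Fin N) → EuclideanSpace ℝ (Fin N)
  memLp_a : MemLp a (ENNReal.ofReal (m / (m - 1))) (cylMeasure Ω M)
  memLp_b : MemLp b (ENNReal.ofReal (m / (m - 1))) (cylMeasure Ω M)

/-- The pairing `∫₀^M ⟨ζ(s), u(s)⟩ ds` between `W^{-1,m'}(Ω)` and `W₀^{1,m}(Ω)`, for `u` with
spatial gradient `Du`. -/
noncomputable def NegSobolev.pair {N : ℕ} {Ω : Set (EuclideanSpace ℝ (Fin N))} {M m : ℝ}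
    (ζ : NegSobolev Ω M m) (u : ℝ × EuclideanSpace ℝ (Fin N) → ℝ)
    (Du : ℝ × EuclideanSpace ℝ (Fin N) → EuclideanSpace ℝ (Fin N)) : ℝ :=
  ∫ z, (ζ.a z * u z + inner ℝ (ζ.b z) (Du z)) ∂(cylMeasure Ω M)

/-- The nonlocal term `f(v) / (∫_Ω f(v) dx)²`. -/
noncomputable def nonlocalTerm {N : ℕ} (Ω : Set (EuclideanSpace ℝ (Fin N))) (f : ℝ → ℝ)
    (v : ℝ × EuclideanSpace ℝ (Fin N) → ℝ) (z : ℝ × EuclideanSpace ℝ (Fin N)) : ℝ :=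
  f (v z) / (∫ y in Ω, f (v (z.1, y))) ^ 2

/-- `v` is a bounded weak solution on `Q = Ω × (0, M)` of
`∂ₛ α(v) - div(|∇v|^{m-2} ∇v) = κ f(v) / (∫_Ω f(v) dx)²`, `v = 0` on `∂Ω × (0, M)`,
`α(v(·, 0)) = α(v₀)`. Here `ζ` is `∂ₛ α(v)`. -/
def IsBoundedWeakSolution {N : ℕ} (Ω : Set (EuclideanSpace ℝ (Fin N))) (M m κ : ℝ)
    (α f : ℝ → ℝ) (v₀ : EuclideanSpace ℝ (Fin N) → ℝ)
    (v : ℝ × EuclideanSpace ℝ (Fin N) → ℝ) : Prop :=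
  MemLp v ∞ (cylMeasure Ω M) ∧
  ∃ Dv : ℝ × EuclideanSpace ℝ (Fin N) → EuclideanSpace ℝ (Fin N),
    IsLmW0 Ω M m v Dv ∧ IsLocBddW Ω M m v Dv ∧
    ∃ ζ : NegSobolev Ω M m,
      (∀ u Du, IsLmW0 Ω M m u Du → MemLp u ∞ (cylMeasure Ω M) →
        ζ.pair u Du + ∫ z, inner ℝ (‖Dv z‖ ^ (m - 2) • Dv z) (Du z) ∂(cylMeasure Ω M) =
          κ * ∫ z, nonlocalTerm Ω f v z * u z ∂(cylMeasure Ω M)) ∧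
      (∀ u Du g, IsLmW0 Ω M m u Du → IsW11EndZero Ω M u g →
        ζ.pair u Du = -∫ z, (α (v z) - α (v₀ z.2)) * g z ∂(cylMeasure Ω M))

end Thermistor

/-! Uniqueness is an `L^1` contraction for `α(v) - α(u)`. Formally, subtract the two equations and
test with `sign(v - u)`. Since `α` is increasing, the time term becomes `d/dt ∫ |α(v) - α(u)|`. The
diffusion term has a sign because `ξ ↦ |ξ|^(m-2) ξ` is monotone. The source difference is at most `c
∫ |α(v) - α(u)|`, because `f` is Lipschitz along `α` and `∫ f ≥ σ|Ω|`. Gronwall and equal initial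
data give `α(v) = α(u)`, hence `v = u`.

The obstruction is that the time derivatives lie only in a dual space: a chain rule can be justified
for one solution compared with a time-independent function, but not directly for the difference of
two solutions. The cure is Kruzhkov's doubling, in time only: compare `v(t, ·)` with the frozen
slice `u(s, ·)`, and `u(s, ·)` with the frozen slice `v(t, ·)`. Space need not be doubled, since a
smooth sign of `v(t, ·) - u(s, ·)` already lies in `W₀^{1,m}(Ω)`.

Four ingredients carry this. Test functions `θ(t) w(x)` remove the abstract time derivative and give
a balance over `(0, s)`, valid for almost every `s` and all `w` at once (`ae_forall_integral_eq`);
the single null set allows `w` to depend on `s`. The convexity inequality `entropy_sub_le` is a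
discrete chain rule: with backward differences in time it yields `IsEvolution.entropy_inequality`
relative to any bounded `z` in `W₀^{1,m}`. The same inequality, with smooth `z` close to `v₀`, shows
that the datum is attained in `L^1` on average (`IsEvolution.initial_continuity`).

Finally, both entropy inequalities are integrated against `φ(t) ρ(t - s)`, with `ρ` supported in
`(0, δ)`. As the smooth sign sharpens, both entropies tend to `|α(v) - α(u)|` and the terms with
`ρ'` cancel (`IsEvolution.kato`). The one-sided support leaves a single initial term, comparing `v`
near time 0 with `u₀`. Letting `δ → 0` with a weight `φ` that absorbs the source constant replaces
Gronwall (`IsEvolution.ae_eq`). -/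

namespace Thermistor

/-! ### Bounded multipliers in `L^p`. -/

section Lp

variable {X F : Type*} [MeasurableSpace X] {μ : Measure X} [NormedAddCommGroup F]
  [NormedSpace ℝ F]

/-- Dominated convergence in `L^p` for a bounded multiplier converging to zero. -/
lemma tendsto_eLpNorm_smul_zero {p : ℝ} (hp : 0 < p) {c : ℕ → X → ℝ} {C : ℝ}
    (hc : ∀ n, AEStronglyMeasurable (c n) μ) (hb : ∀ n, ∀ᵐ x ∂μ, ‖c n x‖ ≤ C)
    (hlim : ∀ᵐ x ∂μ, Tendsto (fun n => c n x) atTop (𝓝 0))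
    {G : X → F} (hG : MemLp G (ENNReal.ofReal p) μ) :
    Tendsto (fun n => eLpNorm (fun x => c n x • G x) (ENNReal.ofReal p) μ) atTop (𝓝 0) := by
  have h0 : ENNReal.ofReal p ≠ 0 := by simpa using hp
  have key : Tendsto (fun n => ∫⁻ x, ‖c n x • G x‖ₑ ^ p ∂μ) atTop (𝓝 (∫⁻ _, 0 ∂μ)) := by
    refine tendsto_lintegral_of_dominated_convergence' (fun x => (‖C‖ₑ * ‖G x‖ₑ) ^ p)
      (fun n => (((hc n).smul hG.1).enorm.pow_const p)) (fun n => ?_) ?_ ?_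
    · filter_upwards [hb n] with x hx
      rw [enorm_smul]
      gcongr
      rw [enorm_le_iff_norm_le]
      exact hx.trans (le_abs_self C)
    · have := hG.eLpNorm_lt_top
      rw [eLpNorm_lt_top_iff_lintegral_rpow_enorm_lt_top h0 ENNReal.ofReal_ne_top] at this
      simp only [ENNReal.toReal_ofReal hp.le] at this
      simp_rw [ENNReal.mul_rpow_of_nonneg _ _ hp.le]
      rw [lintegral_const_mul' _ _ (ENNReal.rpow_ne_top_of_nonneg hp.le enorm_ne_top)]
      exact (ENNReal.mul_lt_top (ENNReal.rpow_lt_top_of_nonneg hp.le enorm_ne_top) this).ne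
    · filter_upwards [hlim] with x hx
      have h1 : Tendsto (fun n => ‖c n x • G x‖ₑ) atTop (𝓝 0) := by
        have := (hx.smul_const (G x)).enorm
        simpa using this
      have := (ENNReal.continuous_rpow_const (y := p)).tendsto 0 |>.comp h1
      simpa [ENNReal.zero_rpow_of_pos hp, Function.comp_def] using this
  have h2 := (ENNReal.continuous_rpow_const (y := 1 / p)).tendsto 0 |>.comp
    (by simpa using key : Tendsto (fun n => ∫⁻ x, ‖c n x • G x‖ₑ ^ p ∂μ) atTop (𝓝 0))
  simp only [eLpNorm_eq_lintegral_rpow_enorm_toReal h0 ENNReal.ofReal_ne_top,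
    ENNReal.toReal_ofReal hp.le]
  have h3 : (0 : ℝ≥0∞) ^ (1 / p) = 0 := ENNReal.zero_rpow_of_pos (by positivity)
  rw [h3] at h2
  exact h2

/-- A function in `L^∞` of a finite measure space times a function in `L^p`. -/
lemma memLp_smul_of_bound {p : ℝ≥0∞} {c : X → ℝ} {C : ℝ} (hc : AEStronglyMeasurable c μ)
    (hb : ∀ᵐ x ∂μ, ‖c x‖ ≤ C) {G : X → F} (hG : MemLp G p μ) :
    MemLp (fun x => c x • G x) p μ := by
  refine MemLp.of_le_mul hG (hc.smul hG.1) (c := C) ?_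
  filter_upwards [hb] with x hx
  rw [norm_smul]
  gcongr

end Lp

/-! ### Calculus in `W₀^{1,m}`. -/

section W0

variable {N : ℕ} {Ω : Set (EuclideanSpace ℝ (Fin N))} {m : ℝ}
  {w w' : EuclideanSpace ℝ (Fin N) → ℝ}
  {G G' : EuclideanSpace ℝ (Fin N) → EuclideanSpace ℝ (Fin N)}

lemma gradient_sub_apply {φ ψ : EuclideanSpace ℝ (Fin N) → ℝ} {x : EuclideanSpace ℝ (Fin N)}
    (hφ : DifferentiableAt ℝ φ x) (hψ : DifferentiableAt ℝ ψ x) :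
    gradient (fun y => φ y - ψ y) x = gradient φ x - gradient ψ x := by
  simp [gradient, fderiv_fun_sub hφ hψ]

lemma gradient_comp_apply {S : ℝ → ℝ} {φ : EuclideanSpace ℝ (Fin N) → ℝ}
    {x : EuclideanSpace ℝ (Fin N)} (hS : DifferentiableAt ℝ S (φ x))
    (hφ : DifferentiableAt ℝ φ x) :
    gradient (fun y => S (φ y)) x = deriv S (φ x) • gradient φ x := by
  have := (hS.hasDerivAt.comp_hasFDerivAt x hφ.hasFDerivAt).fderiv
  simp only [gradient]
  rw [show (fun y => S (φ y)) = S ∘ φ from rfl, this]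
  simp

lemma continuous_gradient {φ : EuclideanSpace ℝ (Fin N) → ℝ} (hφ : ContDiff ℝ ∞ φ) :
    Continuous (gradient φ) :=
  (LinearIsometryEquiv.continuous _).comp (hφ.continuous_fderiv (by simp))

lemma IsW0.congr_ae (h : IsW0 Ω m w G) (hw : w =ᵐ[volume.restrict Ω] w')
    (hG : G =ᵐ[volume.restrict Ω] G') : IsW0 Ω m w' G' := by
  refine ⟨h.memLp.ae_eq hw, h.memLp_grad.ae_eq hG, ?_⟩
  obtain ⟨φ, h1, h2, h3⟩ := h.approx
  refine ⟨φ, h1, h2.congr fun n => eLpNorm_congr_ae ?_, h3.congr fun n => eLpNorm_congr_ae ?_⟩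
  · filter_upwards [hw] with x hx using by rw [hx]
  · filter_upwards [hG] with x hx using by rw [hx]

lemma IsW0.sub (hm : 1 ≤ m) (h : IsW0 Ω m w G) (h' : IsW0 Ω m w' G') :
    IsW0 Ω m (fun x => w x - w' x) (fun x => G x - G' x) := by
  have hp : 1 ≤ ENNReal.ofReal m := by simpa using hm
  refine ⟨h.memLp.sub h'.memLp, h.memLp_grad.sub h'.memLp_grad, ?_⟩
  obtain ⟨φ, h1, h2, h3⟩ := h.approx
  obtain ⟨φ', h1', h2', h3'⟩ := h'.approx
  refine ⟨fun n x => φ n x - φ' n x, fun n => ⟨(h1 n).1.sub (h1' n).1, (h1 n).2.1.sub (h1' n).2.1,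
    (tsupport_sub (φ n) (φ' n)).trans (union_subset (h1 n).2.2 (h1' n).2.2)⟩, ?_, ?_⟩
  · refine tendsto_of_tendsto_of_tendsto_of_le_of_le tendsto_const_nhds
      (by simpa using h2.add h2') (fun n => zero_le) (fun n => ?_)
    refine le_trans (le_of_eq (eLpNorm_congr_ae (ae_of_all _ fun x => ?_)))
      (eLpNorm_sub_le (f := fun x => φ n x - w x) (g := fun x => φ' n x - w' x)
        ((h1 n).1.continuous.aestronglyMeasurable.sub h.memLp.1)
        ((h1' n).1.continuous.aestronglyMeasurable.sub h'.memLp.1) hp)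
    simp only [Pi.sub_apply]; ring
  · refine tendsto_of_tendsto_of_tendsto_of_le_of_le tendsto_const_nhds
      (by simpa using h3.add h3') (fun n => zero_le) (fun n => ?_)
    refine le_trans (le_of_eq (eLpNorm_congr_ae (ae_of_all _ fun x => ?_)))
      (eLpNorm_sub_le (f := fun x => gradient (φ n) x - G x)
        (g := fun x => gradient (φ' n) x - G' x)
        ((continuous_gradient (h1 n).1).aestronglyMeasurable.sub h.memLp_grad.1)
        ((continuous_gradient (h1' n).1).aestronglyMeasurable.sub h'.memLp_grad.1) hp)
    simp only [Pi.sub_apply]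
    rw [gradient_sub_apply ((h1 n).1.differentiable (by simp) x)
      ((h1' n).1.differentiable (by simp) x)]
    abel

/-- The chain rule in `W₀^{1,m}`. -/
lemma IsW0.comp (hm : 1 ≤ m) (h : IsW0 Ω m w G) {S : ℝ → ℝ} (hS : ContDiff ℝ ∞ S)
    (hS0 : S 0 = 0) {L : ℝ≥0} (hL : ∀ r, ‖deriv S r‖ ≤ L) :
    IsW0 Ω m (fun x => S (w x)) (fun x => deriv S (w x) • G x) := by
  have hp : 1 ≤ ENNReal.ofReal m := by simpa using hm
  have hlip : LipschitzWith L S :=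
    lipschitzWith_of_nnnorm_deriv_le (hS.differentiable (by simp)) fun r => hL r
  have hSd : Continuous (deriv S) := hS.continuous_deriv (by simp)
  have hmG : MemLp (fun x => deriv S (w x) • G x) (ENNReal.ofReal m) (volume.restrict Ω) :=
    memLp_smul_of_bound (hSd.comp_aestronglyMeasurable h.memLp.1) (ae_of_all _ fun x => hL (w x))
      h.memLp_grad
  refine ⟨?_, hmG, ?_⟩
  · refine h.memLp.of_le_mul (hS.continuous.comp_aestronglyMeasurable h.memLp.1) (c := L)
      (ae_of_all _ fun x => ?_)
    simpa [hS0] using hlip.norm_sub_le (w x) 0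
  obtain ⟨φ₀, h1₀, h2₀, h3₀⟩ := h.approx
  have hmeas : TendstoInMeasure (volume.restrict Ω) φ₀ atTop w :=
    -- The gradients of `S ∘ φ n` involve `deriv S (φ n x)`, which converges only where `φ n x`
    -- does; hence the passage to an almost everywhere convergent subsequence.
    tendstoInMeasure_of_tendsto_eLpNorm (by positivity)
      (fun n => (h1₀ n).1.continuous.aestronglyMeasurable) h.memLp.1 h2₀
  obtain ⟨ns, hns, hae⟩ := hmeas.exists_seq_tendsto_ae
  set φ := fun n => φ₀ (ns n) with hφ
  have h1 := fun n => h1₀ (ns n)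
  have h2 := h2₀.comp hns.tendsto_atTop
  have h3 := h3₀.comp hns.tendsto_atTop
  refine ⟨fun n x => S (φ n x), fun n => ⟨hS.comp (h1 n).1, (h1 n).2.1.comp_left hS0,
    (closure_mono ?_).trans (h1 n).2.2⟩, ?_, ?_⟩
  · intro x hx hx0
    exact hx (by simp [φ, hx0, hS0])
  · have : Tendsto (fun n => (L : ℝ≥0∞) *
        eLpNorm (fun x => φ n x - w x) (ENNReal.ofReal m) (volume.restrict Ω)) atTop (𝓝 0) := by
      simpa using ENNReal.Tendsto.const_mul h2 (Or.inr ENNReal.coe_ne_top)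
    refine tendsto_of_tendsto_of_tendsto_of_le_of_le tendsto_const_nhds this
      (fun n => zero_le) (fun n => ?_)
    exact eLpNorm_le_nnreal_smul_eLpNorm_of_ae_le_mul (ae_of_all _ fun x =>
      hlip.norm_sub_le (φ n x) (w x)) _
  · have e1 : Tendsto (fun n => (L : ℝ≥0∞) *
        eLpNorm (fun x => gradient (φ n) x - G x) (ENNReal.ofReal m) (volume.restrict Ω))
        atTop (𝓝 0) := by
      simpa using ENNReal.Tendsto.const_mul h3 (Or.inr ENNReal.coe_ne_top)
    -- The gradient error is `S'(φ n)(∇φ n - G) + (S'(φ n) - S'(w)) G`. The first summand is bounded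
    -- by `L` times the approximation error, the second is a bounded multiplier tending to zero.
    have e2 := tendsto_eLpNorm_smul_zero (μ := volume.restrict Ω) (p := m) (by linarith)
      (c := fun n x => deriv S (φ n x) - deriv S (w x)) (C := L + L)
      (fun n => (hSd.comp_aestronglyMeasurable (h1 n).1.continuous.aestronglyMeasurable).sub
        (hSd.comp_aestronglyMeasurable h.memLp.1))
      (fun n => ae_of_all _ fun x => (norm_sub_le _ _).trans (add_le_add (hL _) (hL _)))
      (by
        filter_upwards [hae] with x hx
        have := ((hSd.tendsto (w x)).comp hx).sub_const (deriv S (w x))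
        simpa [Function.comp_def] using this) h.memLp_grad
    refine tendsto_of_tendsto_of_tendsto_of_le_of_le tendsto_const_nhds
      (by simpa using e1.add e2) (fun n => zero_le) (fun n => ?_)
    have hmS : ∀ n, AEStronglyMeasurable (fun x => deriv S (φ n x)) (volume.restrict Ω) := fun n =>
      hSd.comp_aestronglyMeasurable (h1 n).1.continuous.aestronglyMeasurable
    have hmg := (continuous_gradient (h1 n).1).aestronglyMeasurable (μ := volume.restrict Ω)
    refine le_trans (le_of_eq (eLpNorm_congr_ae (ae_of_all _ fun x => ?_)))
      ((eLpNorm_add_le (f := fun x => deriv S (φ n x) • (gradient (φ n) x - G x))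
        (g := fun x => (deriv S (φ n x) - deriv S (w x)) • G x)
        ((hmS n).smul (hmg.sub h.memLp_grad.1))
        (((hmS n).sub (hSd.comp_aestronglyMeasurable h.memLp.1)).smul h.memLp_grad.1) hp).trans
        (add_le_add ?_ le_rfl))
    · simp only [Pi.add_apply]
      rw [gradient_comp_apply (hS.differentiable (by simp) _)
        ((h1 n).1.differentiable (by simp) x), smul_sub, sub_smul]
      abel
    · refine eLpNorm_le_nnreal_smul_eLpNorm_of_ae_le_mul (ae_of_all _ fun x => ?_) _
      rw [nnnorm_smul]
      exact mul_le_mul_left (show ‖deriv S (φ n x)‖₊ ≤ L from hL _) _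

lemma IsW0.const_smul (h : IsW0 Ω m w G) (c : ℝ) :
    IsW0 Ω m (fun x => c * w x) (fun x => c • G x) := by
  refine ⟨h.memLp.const_mul c, h.memLp_grad.const_smul c, ?_⟩
  obtain ⟨φ, h1, h2, h3⟩ := h.approx
  refine ⟨fun n x => c * φ n x, fun n => ⟨contDiff_const.mul (h1 n).1, (h1 n).2.1.mul_left,
    (closure_mono ?_).trans (h1 n).2.2⟩, ?_, ?_⟩
  · intro x hx hx0
    exact hx (by simp [hx0])
  · have : Tendsto (fun n => ‖c‖ₑ *
        eLpNorm (fun x => φ n x - w x) (ENNReal.ofReal m) (volume.restrict Ω)) atTop (𝓝 0) := by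
      simpa using ENNReal.Tendsto.const_mul h2 (Or.inr enorm_ne_top)
    refine this.congr fun n => ?_
    rw [← eLpNorm_const_smul]
    refine eLpNorm_congr_ae (ae_of_all _ fun x => ?_)
    simp [mul_sub]
  · have : Tendsto (fun n => ‖c‖ₑ *
        eLpNorm (fun x => gradient (φ n) x - G x) (ENNReal.ofReal m) (volume.restrict Ω))
        atTop (𝓝 0) := by
      simpa using ENNReal.Tendsto.const_mul h3 (Or.inr enorm_ne_top)
    refine this.congr fun n => ?_
    rw [← eLpNorm_const_smul]
    refine eLpNorm_congr_ae (ae_of_all _ fun x => ?_)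
    simp only [Pi.smul_apply, smul_sub]
    congr 1
    simp [gradient, fderiv_const_mul ((h1 n).1.differentiable (by simp) x)]

lemma IsW0.of_contDiff {φ : EuclideanSpace ℝ (Fin N) → ℝ} (hφ : ContDiff ℝ ∞ φ)
    (hc : HasCompactSupport φ) (hs : tsupport φ ⊆ Ω) : IsW0 Ω m φ (gradient φ) := by
  have hc' : HasCompactSupport (gradient φ) :=
    HasCompactSupport.comp_left (g := (InnerProductSpace.toDual ℝ _).symm)
      (hc.fderiv ℝ) (map_zero _)
  refine ⟨(hφ.continuous.memLp_of_hasCompactSupport hc).restrict _,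
    ((continuous_gradient hφ).memLp_of_hasCompactSupport hc').restrict _,
    fun _ => φ, fun _ => ⟨hφ, hc, hs⟩, ?_, ?_⟩ <;> simp

end W0

/-! ### Smooth approximations of the sign. -/

section SignLike

/-- Smooth, odd, nondecreasing functions with values in `[-1, 1]` and bounded derivative. -/
structure SignLike (S : ℝ → ℝ) : Prop where
  contDiff : ContDiff ℝ ∞ S
  odd : ∀ r, S (-r) = -S r
  abs_le : ∀ r, |S r| ≤ 1
  deriv_nonneg : ∀ r, 0 ≤ deriv S r
  deriv_le : ∃ L : ℝ≥0, ∀ r, ‖deriv S r‖ ≤ L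

variable {S : ℝ → ℝ}

lemma SignLike.zero (hS : SignLike S) : S 0 = 0 := by
  have := hS.odd 0
  simp at this
  linarith

lemma SignLike.continuous_deriv (hS : SignLike S) : Continuous (deriv S) :=
  hS.contDiff.continuous_deriv (by simp)

lemma SignLike.hasDerivAt (hS : SignLike S) (r : ℝ) : HasDerivAt S (deriv S r) r :=
  (hS.contDiff.differentiable (by simp) r).hasDerivAt

lemma SignLike.deriv_even (hS : SignLike S) (r : ℝ) : deriv S (-r) = deriv S r := by
  have h1 := ((hS.hasDerivAt (-r)).comp r (hasDerivAt_neg r)).neg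
  have h2 : (-(S ∘ Neg.neg)) = S := by
    ext y; simp [hS.odd]
  rw [h2] at h1
  simpa using h1.deriv.symm

lemma SignLike.integral_deriv (hS : SignLike S) (d : ℝ) : ∫ y in (0 : ℝ)..d, deriv S y = S d := by
  rw [intervalIntegral.integral_eq_sub_of_hasDerivAt (fun x _ => hS.hasDerivAt x)
    (hS.continuous_deriv.intervalIntegrable _ _), hS.zero, sub_zero]

/-- A smooth approximation of the sign function as `ε → 0`. -/
noncomputable def softSign (ε r : ℝ) : ℝ := r / √(r ^ 2 + ε ^ 2)

variable {ε : ℝ}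

lemma hasDerivAt_sqrt_sq_add (hε : 0 < ε) (r : ℝ) :
    HasDerivAt (fun r => √(r ^ 2 + ε ^ 2)) (r / √(r ^ 2 + ε ^ 2)) r := by
  have h1 : HasDerivAt (fun r : ℝ => r ^ 2 + ε ^ 2) (2 * r) r := by
    simpa using (hasDerivAt_pow 2 r).add_const (ε ^ 2)
  have := h1.sqrt (by positivity)
  convert this using 1
  field_simp

lemma hasDerivAt_softSign (hε : 0 < ε) (r : ℝ) :
    HasDerivAt (softSign ε) (ε ^ 2 / √(r ^ 2 + ε ^ 2) ^ 3) r := by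
  have hpos : 0 < √(r ^ 2 + ε ^ 2) := by positivity
  have hs : √(r ^ 2 + ε ^ 2) ^ 2 = r ^ 2 + ε ^ 2 := Real.sq_sqrt (by positivity)
  have := (hasDerivAt_id r).div (hasDerivAt_sqrt_sq_add hε r) hpos.ne'
  refine this.congr_deriv ?_
  simp only [id]
  field_simp
  rw [hs]; ring

lemma deriv_softSign (hε : 0 < ε) (r : ℝ) :
    deriv (softSign ε) r = ε ^ 2 / √(r ^ 2 + ε ^ 2) ^ 3 := (hasDerivAt_softSign hε r).deriv

lemma le_sqrt_sq_add (ε r : ℝ) : ε ≤ √(r ^ 2 + ε ^ 2) :=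
  Real.le_sqrt_of_sq_le (by nlinarith [sq_nonneg r])

lemma abs_le_sqrt_sq_add (ε r : ℝ) : |r| ≤ √(r ^ 2 + ε ^ 2) :=
  Real.abs_le_sqrt (by nlinarith [sq_nonneg ε])

lemma signLike_softSign (hε : 0 < ε) : SignLike (softSign ε) where
  contDiff := by
    refine contDiff_id.div (ContDiff.sqrt (by fun_prop) fun r => ?_) fun r => ?_ <;> positivity
  odd r := by simp [softSign, neg_div]
  abs_le r := by
    rw [softSign, abs_div, abs_of_nonneg (Real.sqrt_nonneg _)]
    exact div_le_one_of_le₀ (abs_le_sqrt_sq_add ε r) (Real.sqrt_nonneg _)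
  deriv_nonneg r := by rw [deriv_softSign hε]; positivity
  deriv_le := by
    refine ⟨⟨ε ^ 2 / ε ^ 3, by positivity⟩, fun r => ?_⟩
    rw [deriv_softSign hε, Real.norm_of_nonneg (by positivity)]
    change _ ≤ ε ^ 2 / ε ^ 3
    gcongr
    exact le_sqrt_sq_add ε r

/-- Where `d` is small the factor `d` helps, and where it is large `softSign` is close to 1; `√(d² +
ε²) ≤ d + ε` covers both. With the next lemma this makes the entropy error uniform in its arguments.
-/
lemma mul_one_sub_softSign_le (hε : 0 < ε) {d : ℝ} (hd : 0 ≤ d) :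
    d * (1 - softSign ε d) ≤ ε := by
  have hpos : 0 < √(d ^ 2 + ε ^ 2) := by positivity
  have hs : √(d ^ 2 + ε ^ 2) ^ 2 = d ^ 2 + ε ^ 2 := Real.sq_sqrt (by positivity)
  have h1 := abs_le_sqrt_sq_add ε d
  rw [abs_of_nonneg hd] at h1
  have h2 := le_sqrt_sq_add ε d
  have h3 : √(d ^ 2 + ε ^ 2) ≤ d + ε := by
    rw [Real.sqrt_le_left (by positivity)]; nlinarith
  rw [softSign, one_sub_div hpos.ne', mul_div_assoc', div_le_iff₀ hpos]
  nlinarith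

lemma integral_mul_deriv_softSign_le (hε : 0 < ε) (d : ℝ) :
    ∫ y in (0 : ℝ)..d, y * deriv (softSign ε) y ≤ ε := by
  -- Explicit primitive of `y S'(y)`: it equals `-ε` at 0 and is nonpositive everywhere.
  have hF : ∀ y, HasDerivAt (fun y => y * softSign ε y - √(y ^ 2 + ε ^ 2))
      (y * deriv (softSign ε) y) y := fun y => by
    refine (((hasDerivAt_id y).mul ((signLike_softSign hε).hasDerivAt y)).sub
      (hasDerivAt_sqrt_sq_add hε y)).congr_deriv ?_
    simp [softSign]
  rw [intervalIntegral.integral_eq_sub_of_hasDerivAt (fun x _ => hF x)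
    ((continuous_id.mul (signLike_softSign hε).continuous_deriv).intervalIntegrable _ _)]
  have hs : √(d ^ 2 + ε ^ 2) ^ 2 = d ^ 2 + ε ^ 2 := Real.sq_sqrt (by positivity)
  have hpos : 0 < √(d ^ 2 + ε ^ 2) := by positivity
  have : d * softSign ε d ≤ √(d ^ 2 + ε ^ 2) := by
    rw [softSign, mul_div_assoc', div_le_iff₀ hpos]
    nlinarith [sq_nonneg ε]
  simp [Real.sqrt_sq hε.le]
  linarith

end SignLike

/-! ### The relative entropy. -/

section Entropy

variable {S α : ℝ → ℝ}

/-- The entropy `∫_b^a S(r - b) dα(r)`, integrated by parts. -/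
noncomputable def entropy (S α : ℝ → ℝ) (a b : ℝ) : ℝ :=
  ∫ y in (0 : ℝ)..(a - b), deriv S y * (α a - α (b + y))

lemma continuous_entropy (hS : SignLike S) (hα : Continuous α) :
    Continuous fun q : ℝ × ℝ => entropy S α q.1 q.2 := by
  have hS' := hS.continuous_deriv
  have h : Continuous
      (Function.uncurry fun (q : ℝ × ℝ) y => deriv S y * (α q.1 - α (q.2 + y))) := by
    simp only [Function.uncurry_def]
    fun_prop
  have := intervalIntegral.continuous_parametric_primitive_of_continuous (μ := volume)
    (a₀ := 0) h
  exact this.comp (g := fun p : (ℝ × ℝ) × ℝ =>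
    ∫ y in (0 : ℝ)..p.2, deriv S y * (α p.1.1 - α (p.1.2 + y)))
    (f := fun q : ℝ × ℝ => (q, q.1 - q.2)) (by fun_prop)

/-- Convexity of the entropy as a function of `α(a)`, with slope `S(a - b)`. Splitting the integral
for `a'` at `a - b`, the integrands on the common range differ by `S'(y)(α a - α a')`, which
integrates to the right-hand side; the leftover between `a - b` and `a' - b` has a sign since `α` is
monotone. This is a chain rule needing no derivative of `α`. -/
lemma entropy_sub_le (hS : SignLike S) (hα : Continuous α) (hmono : Monotone α) (a a' b : ℝ) :
    entropy S α a b - entropy S α a' b ≤ (α a - α a') * S (a - b) := by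
  have hS' := hS.continuous_deriv
  have hi : ∀ c s t, IntervalIntegrable (fun y => deriv S y * (c - α (b + y))) volume s t :=
    fun c s t => Continuous.intervalIntegrable (by fun_prop) _ _
  have h1 : entropy S α a' b = (∫ y in (0 : ℝ)..(a - b), deriv S y * (α a' - α (b + y))) +
      ∫ y in (a - b)..(a' - b), deriv S y * (α a' - α (b + y)) :=
    (intervalIntegral.integral_add_adjacent_intervals (hi _ _ _) (hi _ _ _)).symm
  have h2 : entropy S α a b - (∫ y in (0 : ℝ)..(a - b), deriv S y * (α a' - α (b + y))) =
      (α a - α a') * S (a - b) := by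
    rw [entropy, ← intervalIntegral.integral_sub (hi _ _ _) (hi _ _ _), ← hS.integral_deriv,
      ← intervalIntegral.integral_const_mul]
    refine intervalIntegral.integral_congr fun y _ => ?_
    ring
  have h3 : 0 ≤ ∫ y in (a - b)..(a' - b), deriv S y * (α a' - α (b + y)) := by
    rcases le_total a a' with h | h
    · refine intervalIntegral.integral_nonneg (by linarith) fun y hy => ?_
      exact mul_nonneg (hS.deriv_nonneg y) (sub_nonneg.2 (hmono (by linarith [hy.2])))
    · rw [intervalIntegral.integral_symm, ← intervalIntegral.integral_neg]
      refine intervalIntegral.integral_nonneg (by linarith) fun y hy => ?_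
      rw [← mul_neg]
      exact mul_nonneg (hS.deriv_nonneg y) (by
        rw [neg_sub]; exact sub_nonneg.2 (hmono (by linarith [hy.1])))
  linarith

lemma entropy_self (a : ℝ) : entropy S α a a = 0 := by simp [entropy]

/-- The substitution `y ↦ -y`, using that `S'` is even. Since `r ↦ -α(-r)` has the same monotonicity
and Lipschitz constant as `α`, estimates for `b ≤ a` carry over to `a ≤ b`. -/
lemma entropy_reflect (hS : SignLike S) (a b : ℝ) :
    entropy S α a b = entropy S (fun r => -α (-r)) (-a) (-b) := by
  have : ∀ d, ∫ y in (0 : ℝ)..d, deriv S y * (α a - α (b + y)) =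
      ∫ y in (0 : ℝ)..(-d), -(deriv S y * (α a - α (b + -y))) := fun d => by
    have := intervalIntegral.integral_comp_neg (a := 0) (b := -d)
      (fun y => deriv S y * (α a - α (b + y)))
    simp only [neg_neg, neg_zero, hS.deriv_even] at this
    rw [intervalIntegral.integral_neg, this, intervalIntegral.integral_symm]
  rw [entropy, this, entropy]
  rw [show -(a - b) = -a - -b by ring]
  refine intervalIntegral.integral_congr fun y _ => ?_
  simp only [neg_neg, neg_add]
  ring

lemma entropy_nonneg (hS : SignLike S) (hα : Continuous α) (hmono : Monotone α) (a b : ℝ) :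
    0 ≤ entropy S α a b := by
  have := entropy_sub_le hS hα hmono b a b
  simp [entropy_self, hS.zero] at this
  exact this

lemma entropy_le (hS : SignLike S) (hα : Continuous α) (hmono : Monotone α) (a b : ℝ) :
    entropy S α a b ≤ |α a - α b| := by
  have := entropy_sub_le hS hα hmono a b b
  simp only [entropy_self, sub_zero] at this
  refine this.trans ((le_abs_self _).trans ?_)
  rw [abs_mul]
  exact mul_le_of_le_one_right (abs_nonneg _) (hS.abs_le _)

/-- Two losses of size `K ε`: replacing `α(a) - α(b)` by its product with `S(a - b)`, and the defect
`∫ S'(y)(α(b + y) - α(b)) dy ≤ K ∫ y S'(y) dy`. Together with `entropy_le`, the entropy converges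
uniformly to `|α(a) - α(b)|`. -/
lemma le_entropy_softSign_of_le {ε : ℝ} (hε : 0 < ε) {K : ℝ≥0} (hα : LipschitzWith K α)
    {a b : ℝ} (hab : b ≤ a) :
    α a - α b - 2 * K * ε ≤ entropy (softSign ε) α a b := by
  have hS := signLike_softSign hε
  have hS' := hS.continuous_deriv
  have hαc := hα.continuous
  have h1 : (α a - α b) * softSign ε (a - b) - entropy (softSign ε) α a b =
      ∫ y in (0 : ℝ)..(a - b), deriv (softSign ε) y * (α (b + y) - α b) := by
    rw [entropy, ← hS.integral_deriv, ← intervalIntegral.integral_const_mul,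
      ← intervalIntegral.integral_sub (Continuous.intervalIntegrable (by fun_prop) _ _)
      (Continuous.intervalIntegrable (by fun_prop) _ _)]
    refine intervalIntegral.integral_congr fun y _ => ?_
    ring
  have hK : ∀ x y, x ≤ y → α y - α x ≤ K * (y - x) := fun x y hxy => by
    have := hα.dist_le_mul y x
    rw [Real.dist_eq, Real.dist_eq, abs_of_nonneg (by linarith : (0:ℝ) ≤ y - x)] at this
    exact (le_abs_self _).trans this
  have h2 : ∫ y in (0 : ℝ)..(a - b), deriv (softSign ε) y * (α (b + y) - α b) ≤
      ∫ y in (0 : ℝ)..(a - b), K * (y * deriv (softSign ε) y) := by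
    refine intervalIntegral.integral_mono_on (by linarith)
      (Continuous.intervalIntegrable (by fun_prop) _ _)
      (Continuous.intervalIntegrable (by fun_prop) _ _) fun y hy => ?_
    have := hK b (b + y) (by linarith [hy.1])
    have h := mul_le_mul_of_nonneg_left this (hS.deriv_nonneg y)
    linarith
  rw [intervalIntegral.integral_const_mul] at h2
  have h3 := mul_le_mul_of_nonneg_left (integral_mul_deriv_softSign_le hε (a - b)) K.2
  have h4 : (α a - α b) * (1 - softSign ε (a - b)) ≤ K * ε := by
    have h5 := mul_one_sub_softSign_le hε (sub_nonneg.2 hab)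
    have h6 : 0 ≤ 1 - softSign ε (a - b) := by linarith [(abs_le.1 (hS.abs_le (a - b))).2]
    calc _ ≤ K * (a - b) * (1 - softSign ε (a - b)) :=
          mul_le_mul_of_nonneg_right (hK b a hab) h6
      _ ≤ K * ε := by rw [mul_assoc]; exact mul_le_mul_of_nonneg_left h5 K.2
  simp only [NNReal.val_eq_coe] at h3
  linarith

lemma le_entropy_softSign {ε : ℝ} (hε : 0 < ε) {K : ℝ≥0} (hα : LipschitzWith K α)
    (hmono : Monotone α) (a b : ℝ) :
    |α a - α b| - 2 * K * ε ≤ entropy (softSign ε) α a b := by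
  rcases le_total b a with h | h
  · rw [abs_of_nonneg (sub_nonneg.2 (hmono h))]
    exact le_entropy_softSign_of_le hε hα h
  · rw [entropy_reflect (signLike_softSign hε), abs_of_nonpos (sub_nonpos.2 (hmono h))]
    have := le_entropy_softSign_of_le (α := fun r => -α (-r)) hε (K := K)
      (LipschitzWith.of_dist_le_mul fun x y => ?_) (neg_le_neg h)
    · simpa [neg_add_eq_sub] using this
    · have := hα.dist_le_mul (-x) (-y)
      simpa using this

end Entropy

/-! ### Monotonicity and integrability of the flux. -/

section Flux

variable {E : Type*} [NormedAddCommGroup E] [InnerProductSpace ℝ E]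

/-- Monotonicity of `ξ ↦ |ξ|^{m-2} ξ`. -/
lemma inner_flux_sub_nonneg {m : ℝ} (hm : 2 ≤ m) (ξ η : E) :
    0 ≤ inner ℝ (‖ξ‖ ^ (m - 2) • ξ - ‖η‖ ^ (m - 2) • η) (ξ - η) := by
  have h1 : inner ℝ (‖ξ‖ ^ (m - 2) • ξ - ‖η‖ ^ (m - 2) • η) (ξ - η) =
      ‖ξ‖ ^ (m - 2) * ‖ξ‖ ^ 2 + ‖η‖ ^ (m - 2) * ‖η‖ ^ 2 -
      (‖ξ‖ ^ (m - 2) + ‖η‖ ^ (m - 2)) * inner ℝ ξ η := by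
    simp only [inner_sub_left, inner_sub_right, real_inner_smul_left, real_inner_self_eq_norm_sq,
      real_inner_comm ξ η]
    ring
  have hx : 0 ≤ ‖ξ‖ ^ (m - 2) := by positivity
  have hy : 0 ≤ ‖η‖ ^ (m - 2) := by positivity
  have h2 : (‖ξ‖ ^ (m - 2) + ‖η‖ ^ (m - 2)) * inner ℝ ξ η ≤
      (‖ξ‖ ^ (m - 2) + ‖η‖ ^ (m - 2)) * (‖ξ‖ * ‖η‖) :=
    mul_le_mul_of_nonneg_left (real_inner_le_norm ξ η) (by positivity)
  -- By Cauchy–Schwarz only the scalar case remains: `r ↦ r^(m-2) r` is nondecreasing on `[0, ∞)`.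
  have h3 : 0 ≤ (‖ξ‖ ^ (m - 2) * ‖ξ‖ - ‖η‖ ^ (m - 2) * ‖η‖) * (‖ξ‖ - ‖η‖) := by
    rcases le_total ‖ξ‖ ‖η‖ with h | h
    · refine mul_nonneg_of_nonpos_of_nonpos (sub_nonpos.2 ?_) (by linarith)
      exact mul_le_mul (Real.rpow_le_rpow (norm_nonneg _) h (by linarith)) h (norm_nonneg _) hy
    · refine mul_nonneg (sub_nonneg.2 ?_) (by linarith)
      exact mul_le_mul (Real.rpow_le_rpow (norm_nonneg _) h (by linarith)) h (norm_nonneg _) hx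
  rw [h1]
  nlinarith

lemma norm_flux {m : ℝ} (hm : 2 ≤ m) (ξ : E) : ‖‖ξ‖ ^ (m - 2) • ξ‖ = ‖ξ‖ ^ (m - 1) := by
  rw [norm_smul, Real.norm_of_nonneg (by positivity)]
  rcases eq_or_ne ‖ξ‖ 0 with h | h
  · rw [h, mul_zero, Real.zero_rpow (by linarith)]
  · rw [← Real.rpow_add_one h]; ring_nf

lemma memLp_flux {X : Type*} [MeasurableSpace X] {μ : Measure X} {m : ℝ} (hm : 2 ≤ m) {g : X → E}
    (hg : MemLp g (ENNReal.ofReal m) μ) :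
    MemLp (fun x => ‖g x‖ ^ (m - 2) • g x) (ENNReal.ofReal (m / (m - 1))) μ := by
  have h := hg.norm_rpow_div (ENNReal.ofReal (m - 1))
  rw [ENNReal.toReal_ofReal (by linarith), ← ENNReal.ofReal_div_of_pos (by linarith)] at h
  refine MemLp.mono h ?_ (ae_of_all _ fun x => ?_)
  · exact ((hg.1.norm.aemeasurable.pow_const _).aestronglyMeasurable).smul hg.1
  · rw [norm_flux hm, Real.norm_of_nonneg (by positivity)]

end Flux

/-! ### Pairings of conjugate Lebesgue spaces. -/

section Holder

variable {X E : Type*} [MeasurableSpace X] {μ : Measure X} [NormedAddCommGroup E]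
  [InnerProductSpace ℝ E] {p q : ℝ≥0∞}

lemma eLpNorm_inner_le [q.HolderConjugate p] {a g : X → E} (ha : AEStronglyMeasurable a μ)
    (hg : AEStronglyMeasurable g μ) :
    eLpNorm (fun x => inner ℝ (a x) (g x)) 1 μ ≤ eLpNorm a q μ * eLpNorm g p μ := by
  have := eLpNorm_le_eLpNorm_mul_eLpNorm_of_nnnorm (p := q) (q := p) (r := 1) ha hg
    (fun x y => inner ℝ x y) 1 (ae_of_all _ fun x => by
      rw [one_mul]; exact nnnorm_inner_le_nnnorm (𝕜 := ℝ) _ _)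
  simpa using this

lemma integrable_inner_of_memLp [q.HolderConjugate p] {a g : X → E} (ha : MemLp a q μ)
    (hg : MemLp g p μ) : Integrable (fun x => inner ℝ (a x) (g x)) μ := by
  rw [← memLp_one_iff_integrable]
  exact ⟨ha.1.inner hg.1, (eLpNorm_inner_le ha.1 hg.1).trans_lt (ENNReal.mul_lt_top ha.2 hg.2)⟩

lemma integrable_mul_of_memLp [q.HolderConjugate p] {a g : X → ℝ} (ha : MemLp a q μ)
    (hg : MemLp g p μ) : Integrable (fun x => a x * g x) μ := by
  simpa [mul_comm] using integrable_inner_of_memLp ha hg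

lemma tendsto_integral_inner [q.HolderConjugate p] {ι : Type*} {l : Filter ι} {a : ι → X → E}
    {a₀ g : X → E} (ha : ∀ i, MemLp (a i) q μ) (ha₀ : MemLp a₀ q μ) (hg : MemLp g p μ)
    (h : Tendsto (fun i => eLpNorm (fun x => a i x - a₀ x) q μ) l (𝓝 0)) :
    Tendsto (fun i => ∫ x, inner ℝ (a i x) (g x) ∂μ) l (𝓝 (∫ x, inner ℝ (a₀ x) (g x) ∂μ)) := by
  refine tendsto_integral_of_L1' _ (integrable_inner_of_memLp ha₀ hg).1
    (Eventually.of_forall fun i => integrable_inner_of_memLp (ha i) hg) ?_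
  have : Tendsto (fun i => eLpNorm (fun x => a i x - a₀ x) q μ * eLpNorm g p μ) l (𝓝 0) := by
    simpa using ENNReal.Tendsto.mul_const h (Or.inr hg.2.ne)
  refine tendsto_of_tendsto_of_tendsto_of_le_of_le tendsto_const_nhds this
    (fun i => zero_le) (fun i => ?_)
  refine le_trans (le_of_eq (eLpNorm_congr_ae (ae_of_all _ fun x => ?_)))
    (eLpNorm_inner_le (q := q) (p := p) ((ha i).1.sub ha₀.1) hg.1)
  simp [inner_sub_left]

lemma tendsto_integral_mul [q.HolderConjugate p] {ι : Type*} {l : Filter ι} {a : ι → X → ℝ}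
    {a₀ g : X → ℝ} (ha : ∀ i, MemLp (a i) q μ) (ha₀ : MemLp a₀ q μ) (hg : MemLp g p μ)
    (h : Tendsto (fun i => eLpNorm (fun x => a i x - a₀ x) q μ) l (𝓝 0)) :
    Tendsto (fun i => ∫ x, g x * a i x ∂μ) l (𝓝 (∫ x, g x * a₀ x ∂μ)) := by
  simpa using tendsto_integral_inner ha ha₀ hg h

lemma holderConjugate_ofReal {m : ℝ} (hm : 1 < m) :
    (ENNReal.ofReal (m / (m - 1))).HolderConjugate (ENNReal.ofReal m) :=
  (Real.HolderConjugate.conjExponent hm).symm.ennrealOfReal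

end Holder

/-! ### Time translations in `L^p`. -/

section Translation

/-- Translation in time. -/
def timeShift {Y : Type*} (σ : ℝ) (z : ℝ × Y) : ℝ × Y := (z.1 - σ, z.2)

lemma continuous_timeShift {Y : Type*} [TopologicalSpace Y] :
    Continuous fun q : ℝ × (ℝ × Y) => timeShift q.1 q.2 := by
  unfold timeShift
  fun_prop

variable {Y E : Type*} [NormedAddCommGroup Y] [InnerProductSpace ℝ Y] [FiniteDimensional ℝ Y]
  [MeasurableSpace Y] [BorelSpace Y] [NormedAddCommGroup E] {p : ℝ≥0∞}

lemma measurePreserving_timeShift (σ : ℝ) :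
    MeasurePreserving (timeShift σ) (volume : Measure (ℝ × Y)) volume :=
  (measurePreserving_sub_right volume σ).prod (MeasurePreserving.id volume)

/-- Continuity of time translations in `L^p`. -/
lemma tendsto_eLpNorm_timeShift (hp : 1 ≤ p) (hp' : p ≠ ⊤) {g : ℝ × Y → E}
    (hg : MemLp g p volume) (σ₀ : ℝ) :
    Tendsto (fun σ => eLpNorm (fun z => g (timeShift σ z) - g (timeShift σ₀ z)) p volume)
      (𝓝 σ₀) (𝓝 0) := by
  have : Fact (1 ≤ p) := ⟨hp⟩
  let F : C(ℝ, C(ℝ × Y, ℝ × Y)) :=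
    (ContinuousMap.mk (fun q : ℝ × (ℝ × Y) => timeShift q.1 q.2) continuous_timeShift).curry
  have hF : ∀ σ, MeasurePreserving (F σ) (volume : Measure (ℝ × Y)) volume :=
    fun σ => measurePreserving_timeShift σ
  have h1 := (continuous_const (y := hg.toLp g)).compMeasurePreservingLp F.continuous hF hp'
  have h2 := h1.tendsto σ₀
  rw [Lp.tendsto_Lp_iff_tendsto_eLpNorm'] at h2
  refine h2.congr fun σ => eLpNorm_congr_ae ?_
  have e : ∀ σ, Lp.compMeasurePreserving (F σ) (hF σ) (hg.toLp g) =ᵐ[volume]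
      fun z => g (timeShift σ z) := fun σ =>
    (Lp.coeFn_compMeasurePreserving _ (hF σ)).trans
      ((hF σ).quasiMeasurePreserving.ae_eq_comp hg.coeFn_toLp)
  filter_upwards [e σ, e σ₀] with z h3 h4
  rw [Pi.sub_apply, h3, h4]

/-- The shear `(σ, z) ↦ (σ, timeShift σ z)` preserves the product measure; this supplies the joint
integrability for Fubini in the shift and space-time variables. -/
lemma memLp_timeShift_uncurry {g : ℝ × Y → E} (hg : MemLp g p volume) (h : ℝ)
    (ν : Measure (ℝ × Y)) (hν : ν ≤ volume) :
    MemLp (fun q : ℝ × (ℝ × Y) => g (timeShift q.1 q.2)) p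
      ((volume.restrict (Ioc 0 h)).prod ν) := by
  have h1 : MeasurePreserving (fun q : ℝ × (ℝ × Y) => (q.1, timeShift q.1 q.2))
      ((volume.restrict (Ioc 0 h)).prod volume) ((volume.restrict (Ioc 0 h)).prod volume) :=
    (MeasurePreserving.id _).skew_product continuous_timeShift.measurable
      (ae_of_all _ fun σ => (measurePreserving_timeShift σ).map_eq)
  have h2 := (hg.comp_snd (volume.restrict (Ioc 0 h))).comp_measurePreserving h1
  exact h2.mono_measure (Measure.prod_mono le_rfl hν)

variable [InnerProductSpace ℝ E]

/-- Only one factor is translated, and it is taken on the whole space, so restricting to `ν` after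
translation costs nothing. In the entropy inequality the flux is taken at time `t - σ` and the test
function stays at time `t`. -/
lemma continuous_integral_inner_timeShift {q : ℝ≥0∞} [q.HolderConjugate p] (hq : 1 ≤ q)
    (hq' : q ≠ ⊤) {ν : Measure (ℝ × Y)} (hν : ν ≤ volume) {a g : ℝ × Y → E}
    (ha : MemLp a q volume) (hg : MemLp g p ν) :
    Continuous fun σ => ∫ z, inner ℝ (a (timeShift σ z)) (g z) ∂ν := by
  have ha' : ∀ σ, MemLp (fun z => a (timeShift σ z)) q ν := fun σ =>
    (ha.comp_measurePreserving (measurePreserving_timeShift σ)).mono_measure hν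
  refine continuous_iff_continuousAt.2 fun σ₀ => ?_
  refine tendsto_integral_inner ha' (ha' σ₀) hg ?_
  exact tendsto_of_tendsto_of_tendsto_of_le_of_le tendsto_const_nhds
    (tendsto_eLpNorm_timeShift hq hq' ha σ₀) (fun i => zero_le)
    (fun i => eLpNorm_mono_measure _ hν)

end Translation

lemma tendsto_average_of_continuous {K : ℝ → ℝ} (hK : Continuous K) :
    Tendsto (fun h => h⁻¹ * ∫ σ in Ioc 0 h, K σ) (𝓝[>] 0) (𝓝 (K 0)) := by
  have h1 := (intervalIntegral.integral_hasDerivAt_right (hK.intervalIntegrable 0 0)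
    (hK.stronglyMeasurableAtFilter _ _) hK.continuousAt).tendsto_slope_zero_right
  refine h1.congr' ?_
  filter_upwards [self_mem_nhdsWithin] with h hh
  rw [intervalIntegral.integral_same, sub_zero, zero_add, smul_eq_mul,
    intervalIntegral.integral_of_le (le_of_lt hh)]

/-! ### Separability of the space of test functions. -/

section Cylinder

variable {N : ℕ} {Ω : Set (EuclideanSpace ℝ (Fin N))} {M m : ℝ}

lemma cylMeasure_eq_restrict :
    cylMeasure Ω M = volume.restrict (Ioo 0 M ×ˢ Ω) := by
  rw [cylMeasure, Measure.prod_restrict]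
  rfl

instance isFiniteMeasure_cylMeasure [IsFiniteMeasure (volume.restrict Ω)] :
    IsFiniteMeasure (cylMeasure Ω M) := by
  unfold cylMeasure
  infer_instance

instance sFinite_cylMeasure : SFinite (cylMeasure Ω M) := by
  unfold cylMeasure
  infer_instance

/-- Bounded functions in `W₀^{1,m}` form a separable space. -/
lemma exists_seq_dense_isW0 (hm : 1 ≤ m) :
    ∃ (w : ℕ → EuclideanSpace ℝ (Fin N) → ℝ)
      (G : ℕ → EuclideanSpace ℝ (Fin N) → EuclideanSpace ℝ (Fin N)),
      (∀ n, IsW0 Ω m (w n) (G n) ∧ ∃ C, ∀ x, |w n x| ≤ C) ∧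
      ∀ w' G', IsW0 Ω m w' G' → (∃ C, ∀ x, |w' x| ≤ C) → ∃ k : ℕ → ℕ,
        Tendsto (fun j => eLpNorm (fun x => w (k j) x - w' x) (ENNReal.ofReal m)
          (volume.restrict Ω)) atTop (𝓝 0) ∧
        Tendsto (fun j => eLpNorm (fun x => G (k j) x - G' x) (ENNReal.ofReal m)
          (volume.restrict Ω)) atTop (𝓝 0) := by
  have : Fact (1 ≤ ENNReal.ofReal m) := ⟨by simpa using hm⟩
  have : Fact (ENNReal.ofReal m ≠ ⊤) := ⟨ENNReal.ofReal_ne_top⟩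
  let W := {q : (EuclideanSpace ℝ (Fin N) → ℝ) ×
    (EuclideanSpace ℝ (Fin N) → EuclideanSpace ℝ (Fin N)) //
      IsW0 Ω m q.1 q.2 ∧ ∃ C, ∀ x, |q.1 x| ≤ C}
  let ι : W → Lp ℝ (ENNReal.ofReal m) (volume.restrict Ω) ×
      Lp (EuclideanSpace ℝ (Fin N)) (ENNReal.ofReal m) (volume.restrict Ω) :=
    fun q => (q.2.1.memLp.toLp _, q.2.1.memLp_grad.toLp _)
  -- Topology of the graph norm, pulled back from `L^m × L^m`. Second countability passes to an
  -- induced topology even though `ι` identifies functions equal almost everywhere, and it gives a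
  -- dense sequence.
  let _ : TopologicalSpace W := TopologicalSpace.induced ι inferInstance
  have hι : IsInducing ι := ⟨rfl⟩
  have : SecondCountableTopology (Lp ℝ (ENNReal.ofReal m) (volume.restrict Ω)) := inferInstance
  have : SecondCountableTopology
    (Lp (EuclideanSpace ℝ (Fin N)) (ENNReal.ofReal m) (volume.restrict Ω)) := inferInstance
  have : SecondCountableTopology W := hι.secondCountableTopology
  have hne : Nonempty W := ⟨⟨(0, 0), by
    refine ⟨⟨MemLp.zero, MemLp.zero, fun _ => 0, fun _ => ⟨contDiff_const, HasCompactSupport.zero,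
      by simp [tsupport]⟩, by simp, ?_⟩, 0, by simp⟩
    simp [gradient]⟩⟩
  refine ⟨fun n => (TopologicalSpace.denseSeq W n).1.1, fun n => (TopologicalSpace.denseSeq W n).1.2,
    fun n => (TopologicalSpace.denseSeq W n).2, fun w' G' h hb => ?_⟩
  obtain ⟨x, hx, hlim⟩ := mem_closure_iff_seq_limit.1
    (TopologicalSpace.denseRange_denseSeq W ⟨(w', G'), h, hb⟩)
  choose k hk using hx
  have h1 := (hι.tendsto_nhds_iff).1 hlim
  rw [nhds_prod_eq] at h1
  have h2 := h1.fst
  have h3 := h1.snd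
  refine ⟨k, ?_, ?_⟩
  · refine ((Lp.tendsto_Lp_iff_tendsto_eLpNorm'' _ (fun n => (x n).2.1.memLp) _ h.memLp).1
      h2).congr fun n => ?_
    simp only [hk]
    rfl
  · refine ((Lp.tendsto_Lp_iff_tendsto_eLpNorm'' _ (fun n => (x n).2.1.memLp_grad) _
      h.memLp_grad).1 h3).congr fun n => ?_
    simp only [hk]
    rfl

end Cylinder

/-! ### Test functions of product form. -/

section Tensor

variable {N : ℕ} {Ω : Set (EuclideanSpace ℝ (Fin N))} {M m : ℝ}
  {w : EuclideanSpace ℝ (Fin N) → ℝ} {G : EuclideanSpace ℝ (Fin N) → EuclideanSpace ℝ (Fin N)}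

lemma isLmW0_tensor (h : IsW0 Ω m w G) {θ : ℝ → ℝ}
    (hθ : Continuous θ) :
    IsLmW0 Ω M m (fun z => θ z.1 * w z.2) (fun z => θ z.1 • G z.2) := by
  obtain ⟨C, hC⟩ := (isCompact_Icc (a := (0 : ℝ)) (b := M)).exists_bound_of_continuousOn
    hθ.continuousOn
  have hb : ∀ᵐ z ∂(cylMeasure Ω M), ‖θ z.1‖ ≤ C := by
    have : ∀ᵐ t ∂(volume.restrict (Ioo 0 M)), ‖θ t‖ ≤ C := by
      filter_upwards [ae_restrict_mem measurableSet_Ioo] with t ht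
      exact hC t (Ioo_subset_Icc_self ht)
    exact Measure.quasiMeasurePreserving_fst.ae this
  have hm : AEStronglyMeasurable (fun z : ℝ × EuclideanSpace ℝ (Fin N) => θ z.1)
      (cylMeasure Ω M) := (hθ.comp continuous_fst).aestronglyMeasurable
  exact ⟨memLp_smul_of_bound hm hb (h.memLp.comp_snd _),
    memLp_smul_of_bound hm hb (h.memLp_grad.comp_snd _),
    ae_of_all _ fun t => h.const_smul (θ t)⟩

/-- Fubini on the triangle `r < s`. It moves the time integral from the test function onto the
spatial residual `R`, turning the weak form into a balance over `(0, s)`. -/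
lemma integral_primitive_mul {g R : ℝ → ℝ} {C : ℝ} (hg : Measurable g) (hgC : ∀ t, |g t| ≤ C)
    (hR : Integrable R (volume.restrict (Ioo 0 M))) :
    ∫ r in Ioo 0 M, (∫ s in r..M, g s) * R r =
      ∫ s in Ioo 0 M, g s * ∫ r in Ioo 0 s, R r := by
  have hgi : Integrable g (volume.restrict (Ioo 0 M)) :=
    Integrable.of_bound hg.aestronglyMeasurable C (ae_of_all _ hgC)
  have hi : Integrable (Function.uncurry fun r s => if r < s then g s * R r else 0)
      ((volume.restrict (Ioo 0 M)).prod (volume.restrict (Ioo 0 M))) := by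
    have := (hR.mul_prod hgi).indicator (measurableSet_lt measurable_fst measurable_snd)
    refine this.congr (ae_of_all _ fun z => ?_)
    simp only [indicator, mem_ofPred_eq, Function.uncurry, mul_comm]
  have h := integral_integral_swap hi
  have e1 : ∫ r in Ioo 0 M, (∫ s in Ioo 0 M, if r < s then g s * R r else 0) =
      ∫ r in Ioo 0 M, (∫ s in r..M, g s) * R r := by
    refine setIntegral_congr_fun measurableSet_Ioo fun r hr => ?_
    rw [intervalIntegral.integral_of_le hr.2.le, integral_Ioc_eq_integral_Ioo,
      ← integral_mul_const]
    rw [← integral_indicator measurableSet_Ioo, ← integral_indicator measurableSet_Ioo]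
    congr 1 with s
    simp only [indicator, mem_Ioo]
    have := hr.1
    split_ifs <;> first | rfl | (exfalso; grind)
  have e2 : ∫ s in Ioo 0 M, (∫ r in Ioo 0 M, if r < s then g s * R r else 0) =
      ∫ s in Ioo 0 M, g s * ∫ r in Ioo 0 s, R r := by
    refine setIntegral_congr_fun measurableSet_Ioo fun s hs => ?_
    rw [← integral_const_mul]
    rw [← integral_indicator measurableSet_Ioo, ← integral_indicator measurableSet_Ioo]
    congr 1 with r
    simp only [indicator, mem_Ioo]
    have := hs.2
    split_ifs <;> first | rfl | (exfalso; grind)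
  rw [← e1, h, e2]

lemma integrable_primitive {R : ℝ → ℝ} (hR : Integrable R (volume.restrict (Ioo 0 M))) :
    Integrable (fun s => ∫ r in Ioo 0 s, R r) (volume.restrict (Ioo 0 M)) := by
  have hi : Integrable (fun z : ℝ × ℝ => if z.2 < z.1 then R z.2 else 0)
      ((volume.restrict (Ioo 0 M)).prod (volume.restrict (Ioo 0 M))) := by
    refine ((hR.comp_snd (volume.restrict (Ioo 0 M))).indicator
      (measurableSet_lt measurable_snd measurable_fst)).congr (ae_of_all _ fun z => ?_)
    simp only [indicator, mem_ofPred_eq]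
  refine hi.integral_prod_left.congr ?_
  filter_upwards [ae_restrict_mem measurableSet_Ioo] with s hs
  rw [← integral_indicator measurableSet_Ioo, ← integral_indicator measurableSet_Ioo]
  congr 1 with r
  simp only [indicator, mem_Ioo]
  have := hs.2
  split_ifs <;> first | rfl | (exfalso; grind)

end Tensor

/-! ### The balance law at almost every time. -/

section Evolution

variable {N : ℕ} {Ω : Set (EuclideanSpace ℝ (Fin N))} {M m : ℝ}

/-- Time-integrated form of `∂ₛ β = F + div a` tested with one spatial function. -/
lemma ae_integral_eq_of_forall_primitive [IsFiniteMeasure (volume.restrict Ω)] (hm : 1 < m)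
    {β F : ℝ × EuclideanSpace ℝ (Fin N) → ℝ}
    {a : ℝ × EuclideanSpace ℝ (Fin N) → EuclideanSpace ℝ (Fin N)}
    {w : EuclideanSpace ℝ (Fin N) → ℝ} {G : EuclideanSpace ℝ (Fin N) → EuclideanSpace ℝ (Fin N)}
    (hβ : MemLp β ∞ (cylMeasure Ω M)) (hF : MemLp F ∞ (cylMeasure Ω M))
    (ha : MemLp a (ENNReal.ofReal (m / (m - 1))) (cylMeasure Ω M)) (hw : IsW0 Ω m w G)
    (h : ∀ (g : ℝ → ℝ) (C : ℝ), Measurable g → (∀ t, |g t| ≤ C) →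
      ∫ z, β z * (g z.1 * w z.2) ∂(cylMeasure Ω M) =
        ∫ z, (∫ s in z.1..M, g s) * (F z * w z.2 - inner ℝ (a z) (G z.2)) ∂(cylMeasure Ω M)) :
    ∀ᵐ s ∂(volume.restrict (Ioo 0 M)), ∫ x in Ω, β (s, x) * w x =
      ∫ r in Ioo 0 s, ∫ x in Ω, (F (r, x) * w x - inner ℝ (a (r, x)) (G x)) := by
  have := holderConjugate_ofReal hm
  have hp : 1 ≤ ENNReal.ofReal m := by simpa using hm.le
  have hw' : Integrable (fun z : ℝ × EuclideanSpace ℝ (Fin N) => w z.2) (cylMeasure Ω M) :=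
    (hw.memLp.comp_snd (volume.restrict (Ioo 0 M))).integrable hp
  have hw1 := memLp_one_iff_integrable.2 hw'
  have hβw : Integrable (fun z => β z * w z.2) (cylMeasure Ω M) :=
    integrable_mul_of_memLp hβ hw1
  have hR : Integrable (fun z => F z * w z.2 - inner ℝ (a z) (G z.2)) (cylMeasure Ω M) :=
    (integrable_mul_of_memLp hF hw1).sub (integrable_inner_of_memLp ha
      (hw.memLp_grad.comp_snd (volume.restrict (Ioo 0 M))))
  have hRi := Integrable.integral_prod_left hR
  refine Integrable.ae_eq_of_forall_setIntegral_eq _ _ (Integrable.integral_prod_left hβw)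
    (integrable_primitive hRi) fun s hs _ => ?_
  -- Taking for `g` the indicators of measurable sets of times identifies the two sides almost
  -- everywhere. The corresponding time factor is a primitive of `g`, hence an admissible continuous
  -- function.
  set g : ℝ → ℝ := s.indicator 1 with hgdef
  have hg : Measurable g := measurable_one.indicator hs
  have hg1 : ∀ t, |g t| ≤ 1 := fun t => by
    by_cases ht : t ∈ s <;> simp [g, ht]
  have h1 := h g 1 hg hg1
  have e1 : ∫ z, β z * (g z.1 * w z.2) ∂(cylMeasure Ω M) =
      ∫ t in Ioo 0 M, g t * ∫ x in Ω, β (t, x) * w x := by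
    have hi : Integrable (fun z => β z * (g z.1 * w z.2)) (cylMeasure Ω M) := by
      refine (hβw.bdd_mul (c := 1) (hg.comp measurable_fst).aestronglyMeasurable
        (ae_of_all _ fun z => hg1 z.1)).congr (ae_of_all _ fun z => ?_)
      simp only [Function.comp]; ring
    rw [cylMeasure, integral_prod _ hi]
    refine integral_congr_ae (ae_of_all _ fun t => ?_)
    dsimp only
    rw [← integral_const_mul]
    congr 1 with x
    ring
  have e2 : ∫ z, (∫ s in z.1..M, g s) * (F z * w z.2 - inner ℝ (a z) (G z.2)) ∂(cylMeasure Ω M) =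
      ∫ t in Ioo 0 M, (∫ s in t..M, g s) *
        ∫ x in Ω, (F (t, x) * w x - inner ℝ (a (t, x)) (G x)) := by
    have hgi : ∀ a b, IntervalIntegrable g volume a b := fun a b =>
      (intervalIntegrable_const (c := (1 : ℝ))).mono_fun hg.aestronglyMeasurable
        (ae_of_all _ fun t => by simpa using hg1 t)
    have hc : Continuous fun t => ∫ s in t..M, g s := by
      have := (intervalIntegral.continuous_primitive hgi M).neg
      refine this.congr fun t => ?_
      rw [Pi.neg_apply, intervalIntegral.integral_symm, neg_neg]
    have hi : Integrable (fun z => (∫ s in z.1..M, g s) *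
        (F z * w z.2 - inner ℝ (a z) (G z.2))) (cylMeasure Ω M) := by
      have hb : ∀ᵐ t ∂(volume.restrict (Ioo 0 M)), ‖∫ s in t..M, g s‖ ≤ M := by
        filter_upwards [ae_restrict_mem measurableSet_Ioo] with t ht
        refine (intervalIntegral.norm_integral_le_of_norm_le_const (C := 1)
          fun x _ => hg1 x).trans ?_
        rw [one_mul, abs_of_nonneg (by linarith [ht.2])]
        linarith [ht.1]
      exact hR.bdd_mul (hc.comp continuous_fst).aestronglyMeasurable
        (Measure.quasiMeasurePreserving_fst.ae hb)
    rw [cylMeasure, integral_prod _ hi]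
    refine integral_congr_ae (ae_of_all _ fun t => ?_)
    dsimp only
    rw [← integral_const_mul]
  rw [e1, e2, integral_primitive_mul hg hg1 hRi] at h1
  have e3 : ∀ J : ℝ → ℝ, ∫ t in s, J t ∂(volume.restrict (Ioo 0 M)) =
      ∫ t in Ioo 0 M, g t * J t := fun J => by
    rw [← integral_indicator hs]
    congr 1 with t
    by_cases ht : t ∈ s <;> simp [g, ht]
  rw [e3, e3, h1]

end Evolution

lemma tendsto_eLpNorm_comp_snd {X Y F : Type*} [MeasurableSpace X] [MeasurableSpace Y]
    [NormedAddCommGroup F] {μ : Measure X} {ν : Measure Y} [IsFiniteMeasure μ] [SFinite ν]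
    {p : ℝ≥0∞} (hp : p ≠ ⊤) {g : ℕ → Y → F} (hg : ∀ n, AEStronglyMeasurable (g n) ν)
    (h : Tendsto (fun n => eLpNorm (g n) p ν) atTop (𝓝 0)) :
    Tendsto (fun n => eLpNorm (fun z : X × Y => g n z.2) p (μ.prod ν)) atTop (𝓝 0) := by
  have e : ∀ n, eLpNorm (fun z : X × Y => g n z.2) p (μ.prod ν) =
      μ univ ^ (1 / p).toReal * eLpNorm (g n) p ν := fun n => by
    rw [← smul_eq_mul, ← eLpNorm_smul_measure_of_ne_top hp, ← Measure.map_snd_prod,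
      eLpNorm_map_measure _ measurable_snd.aemeasurable]
    · rfl
    · rw [Measure.map_snd_prod]
      exact (hg n).smul_measure _
  simp_rw [e]
  have := ENNReal.Tendsto.const_mul (a := μ univ ^ (1 / p).toReal) h
    (Or.inr (ENNReal.rpow_ne_top_of_nonneg ENNReal.toReal_nonneg (measure_ne_top μ univ)))
  rwa [mul_zero] at this

section Evolution

variable {N : ℕ} {Ω : Set (EuclideanSpace ℝ (Fin N))} {M m : ℝ}

lemma cylMeasure_mono {s : ℝ} (hs : s ≤ M) : cylMeasure Ω s ≤ cylMeasure Ω M :=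
  Measure.prod_mono (Measure.restrict_mono (Ioo_subset_Ioo_right hs) le_rfl) le_rfl

/-- Exchange of quantifiers: the exceptional times for a countable dense family form one null set,
and both sides are continuous in `(w, G)` for the `L^m` norms. One may then insert at time `s` a
test function that depends on `s`. -/
lemma ae_forall_integral_eq [IsFiniteMeasure (volume.restrict Ω)] (hm : 1 < m)
    {β F : ℝ × EuclideanSpace ℝ (Fin N) → ℝ}
    {a : ℝ × EuclideanSpace ℝ (Fin N) → EuclideanSpace ℝ (Fin N)}
    (hβ : Measurable β) {Cβ : ℝ} (hβb : ∀ z, |β z| ≤ Cβ)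
    (hF : Measurable F) {CF : ℝ} (hFb : ∀ z, |F z| ≤ CF)
    (ha : MemLp a (ENNReal.ofReal (m / (m - 1))) (cylMeasure Ω M))
    (h : ∀ w G, IsW0 Ω m w G → (∃ C, ∀ x, |w x| ≤ C) →
      ∀ᵐ s ∂(volume.restrict (Ioo 0 M)), ∫ x in Ω, β (s, x) * w x =
        ∫ r in Ioo 0 s, ∫ x in Ω, (F (r, x) * w x - inner ℝ (a (r, x)) (G x))) :
    ∀ᵐ s ∂(volume.restrict (Ioo 0 M)), ∀ w G, IsW0 Ω m w G → (∃ C, ∀ x, |w x| ≤ C) →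
      ∫ x in Ω, β (s, x) * w x =
        ∫ r in Ioo 0 s, ∫ x in Ω, (F (r, x) * w x - inner ℝ (a (r, x)) (G x)) := by
  have hcj := holderConjugate_ofReal hm
  obtain ⟨w, G, hwG, hdense⟩ := exists_seq_dense_isW0 (Ω := Ω) hm.le
  have hall := ae_all_iff.2 fun n => h (w n) (G n) (hwG n).1 (hwG n).2
  filter_upwards [hall, ae_restrict_mem measurableSet_Ioo] with s hs hsM w' G' hw' hb'
  obtain ⟨k, hk1, hk2⟩ := hdense w' G' hw' hb'
  have ha' := ha.mono_measure (cylMeasure_mono (Ω := Ω) hsM.2.le)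
  have hβs : MemLp (fun x => β (s, x)) (ENNReal.ofReal (m / (m - 1))) (volume.restrict Ω) :=
    MemLp.of_bound (hβ.comp measurable_prodMk_left).aestronglyMeasurable Cβ
      (ae_of_all _ fun x => hβb (s, x))
  have hFs : MemLp F (ENNReal.ofReal (m / (m - 1))) (cylMeasure Ω s) :=
    MemLp.of_bound hF.aestronglyMeasurable CF (ae_of_all _ hFb)
  have hL : Tendsto (fun j => ∫ x in Ω, β (s, x) * w (k j) x) atTop
      (𝓝 (∫ x in Ω, β (s, x) * w' x)) :=
    tendsto_integral_mul (fun j => (hwG (k j)).1.memLp) hw'.memLp hβs hk1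
  have hprod : ∀ w G, IsW0 Ω m w G →
      ∫ r in Ioo 0 s, ∫ x in Ω, (F (r, x) * w x - inner ℝ (a (r, x)) (G x)) =
      ∫ z, F z * w z.2 ∂(cylMeasure Ω s) - ∫ z, inner ℝ (G z.2) (a z) ∂(cylMeasure Ω s) := by
    intro w G hw
    have i1 := integrable_mul_of_memLp hFs (hw.memLp.comp_snd (volume.restrict (Ioo 0 s)))
    have i2 := integrable_inner_of_memLp ha' (hw.memLp_grad.comp_snd (volume.restrict (Ioo 0 s)))
    simp_rw [real_inner_comm (a _)]
    rw [← integral_sub i1 i2]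
    exact (integral_prod _ (i1.sub i2)).symm
  have hR : Tendsto (fun j => ∫ r in Ioo 0 s, ∫ x in Ω,
      (F (r, x) * w (k j) x - inner ℝ (a (r, x)) (G (k j) x))) atTop
      (𝓝 (∫ r in Ioo 0 s, ∫ x in Ω, (F (r, x) * w' x - inner ℝ (a (r, x)) (G' x)))) := by
    simp_rw [fun j => hprod _ _ (hwG (k j)).1, hprod _ _ hw']
    have b1 : ∀ w G, IsW0 Ω m w G → MemLp (fun z : ℝ × EuclideanSpace ℝ (Fin N) => w z.2)
        (ENNReal.ofReal m) (cylMeasure Ω s) := fun w G hw => hw.memLp.comp_snd _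
    have b2 : ∀ w G, IsW0 Ω m w G → MemLp (fun z : ℝ × EuclideanSpace ℝ (Fin N) => G z.2)
        (ENNReal.ofReal m) (cylMeasure Ω s) := fun w G hw => hw.memLp_grad.comp_snd _
    have t1 := tendsto_eLpNorm_comp_snd (μ := volume.restrict (Ioo 0 s))
      (g := fun j x => w (k j) x - w' x) ENNReal.ofReal_ne_top
      (fun j => (hwG (k j)).1.memLp.1.sub hw'.memLp.1) hk1
    have t2 := tendsto_eLpNorm_comp_snd (μ := volume.restrict (Ioo 0 s))
      (g := fun j x => G (k j) x - G' x) ENNReal.ofReal_ne_top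
      (fun j => (hwG (k j)).1.memLp_grad.1.sub hw'.memLp_grad.1) hk2
    exact (tendsto_integral_mul (fun j => b1 _ _ (hwG (k j)).1) (b1 _ _ hw') hFs t1).sub
      (tendsto_integral_inner (fun j => b2 _ _ (hwG (k j)).1) (b2 _ _ hw') ha' t2)
  exact tendsto_nhds_unique hL (hR.congr fun j => (hs (k j)).symm)

/-- Time-integrated weak form of `∂ₛ α(v) = F + div a`, `v ∈ L^m(0, M; W₀^{1,m})`, with initial
datum `v₀`, for everywhere defined measurable representatives. -/
structure IsEvolution (Ω : Set (EuclideanSpace ℝ (Fin N))) (M m : ℝ) (α : ℝ → ℝ)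
    (v₀ : EuclideanSpace ℝ (Fin N) → ℝ) (v : ℝ × EuclideanSpace ℝ (Fin N) → ℝ)
    (Dv a : ℝ × EuclideanSpace ℝ (Fin N) → EuclideanSpace ℝ (Fin N))
    (F : ℝ × EuclideanSpace ℝ (Fin N) → ℝ) : Prop where
  measurable_initial : Measurable v₀
  measurable : Measurable v
  measurable_source : Measurable F
  bounded_initial : ∃ C, ∀ x, |v₀ x| ≤ C
  bounded : ∃ C, ∀ z, |v z| ≤ C
  bounded_source : ∃ C, ∀ z, |F z| ≤ C
  memLp_grad : MemLp Dv (ENNReal.ofReal m) (cylMeasure Ω M)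
  memLp_flux : MemLp a (ENNReal.ofReal (m / (m - 1))) (cylMeasure Ω M)
  slice : ∀ᵐ t ∂(volume.restrict (Ioo 0 M)), IsW0 Ω m (fun x => v (t, x)) (fun x => Dv (t, x))
  balance : ∀ᵐ s ∂(volume.restrict (Ioo 0 M)), ∀ w G, IsW0 Ω m w G → (∃ C, ∀ x, |w x| ≤ C) →
    ∫ x in Ω, (α (v (s, x)) - α (v₀ x)) * w x =
      ∫ r in Ioo 0 s, ∫ x in Ω, (F (r, x) * w x - inner ℝ (a (r, x)) (G x))

/-- An essentially bounded function has a bounded measurable representative. -/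
lemma exists_bounded_measurable {X : Type*} [MeasurableSpace X] {μ : Measure X} {g : X → ℝ}
    (hg : MemLp g ∞ μ) : ∃ g', Measurable g' ∧ (∃ C, ∀ x, |g' x| ≤ C) ∧ g =ᵐ[μ] g' := by
  set C := (eLpNorm g ∞ μ).toReal with hC
  have h1 : ∀ᵐ x ∂μ, |g x| ≤ C := by
    filter_upwards [ae_le_eLpNormEssSup (f := g) (μ := μ)] with x hx
    rw [hC, eLpNorm_exponent_top, ← Real.norm_eq_abs, ← toReal_enorm]
    exact ENNReal.toReal_mono (by simpa using hg.2.ne) hx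
  refine ⟨fun x => max (-C) (min C (hg.1.mk g x)), ?_, ⟨C, fun x => ?_⟩, ?_⟩
  · exact measurable_const.max (measurable_const.min hg.1.stronglyMeasurable_mk.measurable)
  · have : 0 ≤ C := ENNReal.toReal_nonneg
    rw [abs_le]
    exact ⟨le_max_left _ _, max_le (by linarith) (min_le_left _ _)⟩
  · filter_upwards [h1, hg.1.ae_eq_mk] with x h2 h3
    rw [← h3, min_eq_right (abs_le.1 h2).2, max_eq_right (abs_le.1 h2).1]

lemma abs_integral_le_of_bound {X : Type*} [MeasurableSpace X] {μ : Measure X} [IsFiniteMeasure μ]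
    {g : X → ℝ} {C : ℝ} (h : ∀ x, |g x| ≤ C) : |∫ x, g x ∂μ| ≤ C * μ.real univ :=
  norm_integral_le_of_norm_le_const (f := g) (ae_of_all _ h)

lemma measurable_nonlocalTerm {f : ℝ → ℝ} (hf : Continuous f)
    {v : ℝ × EuclideanSpace ℝ (Fin N) → ℝ} (hv : Measurable v) :
    Measurable (nonlocalTerm Ω f v) := by
  have hfv : Measurable fun z => f (v z) := hf.measurable.comp hv
  have : Measurable fun t => ∫ y in Ω, f (v (t, y)) :=
    (hfv.stronglyMeasurable.integral_prod_right (ν := volume.restrict Ω)).measurable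
  exact hfv.div ((this.comp measurable_fst).pow_const 2)

lemma le_integral_source [IsFiniteMeasure (volume.restrict Ω)] {f : ℝ → ℝ} (hf : Continuous f)
    {σ : ℝ} (hσ : ∀ s, σ ≤ f s) {g : EuclideanSpace ℝ (Fin N) → ℝ}
    (hg : Measurable g) {C : ℝ} (hC : ∀ x, |f (g x)| ≤ C) :
    σ * volume.real Ω ≤ ∫ x in Ω, f (g x) := by
  have h := integral_mono (μ := volume.restrict Ω) (integrable_const σ)
    (Integrable.of_bound (hf.measurable.comp hg).aestronglyMeasurable C
      (ae_of_all _ hC)) (fun x => hσ (g x))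
  simpa [mul_comm] using h

lemma exists_abs_comp_le {f : ℝ → ℝ} (hf : Continuous f) {X : Type*} {v : X → ℝ} {C : ℝ}
    (hv : ∀ x, |v x| ≤ C) : ∃ C', ∀ x, |f (v x)| ≤ C' := by
  obtain ⟨C', h⟩ := (isCompact_Icc (a := -C) (b := C)).exists_bound_of_continuousOn
    hf.continuousOn
  exact ⟨C', fun x => h _ (abs_le.1 (hv x))⟩

lemma exists_abs_nonlocalTerm_le [IsFiniteMeasure (volume.restrict Ω)] {f : ℝ → ℝ}
    (hf : Continuous f) {σ : ℝ} (hσ0 : 0 < σ) (hσ : ∀ s, σ ≤ f s)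
    {v : ℝ × EuclideanSpace ℝ (Fin N) → ℝ} (hv : Measurable v) {C : ℝ} (hC : ∀ z, |v z| ≤ C) :
    ∃ C', ∀ z, |nonlocalTerm Ω f v z| ≤ C' := by
  obtain ⟨Cf, hCf⟩ := exists_abs_comp_le hf hC
  -- On a null set the mean vanishes and division by zero makes the term 0; otherwise `∫ f ≥ σ|Ω| >
  -- 0` bounds the denominator below.
  rcases eq_or_ne (volume.real Ω) 0 with h0 | h0
  · refine ⟨0, fun z => ?_⟩
    have : ∫ y in Ω, f (v (z.1, y)) = 0 := by
      have := abs_integral_le_of_bound (μ := volume.restrict Ω) (g := fun y => f (v (z.1, y)))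
        (fun y => hCf (z.1, y))
      simpa [h0] using this
    simp [nonlocalTerm, this]
  · have hpos : 0 < σ * volume.real Ω :=
      mul_pos hσ0 (lt_of_le_of_ne measureReal_nonneg h0.symm)
    refine ⟨Cf / (σ * volume.real Ω) ^ 2, fun z => ?_⟩
    have hI := le_integral_source (Ω := Ω) hf hσ (hv.comp measurable_prodMk_left)
      (fun y => hCf (z.1, y))
    rw [nonlocalTerm, abs_div, abs_of_nonneg (sq_nonneg (∫ y in Ω, f (v (z.1, y))))]
    have := hCf z
    have h0' : 0 ≤ Cf := (abs_nonneg _).trans this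
    gcongr
    simpa using hI

end Evolution

/-! ### From weak solutions to the balance law. -/

section Representative

variable {N : ℕ} {Ω : Set (EuclideanSpace ℝ (Fin N))} {M m : ℝ}

lemma nonlocalTerm_congr_ae {f : ℝ → ℝ}
    {v v' : ℝ × EuclideanSpace ℝ (Fin N) → ℝ} (h : v =ᵐ[cylMeasure Ω M] v') :
    nonlocalTerm Ω f v =ᵐ[cylMeasure Ω M] nonlocalTerm Ω f v' := by
  have h1 : ∀ᵐ t ∂(volume.restrict (Ioo 0 M)),
      ∫ y in Ω, f (v (t, y)) = ∫ y in Ω, f (v' (t, y)) := by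
    filter_upwards [Measure.ae_ae_of_ae_prod h] with t ht
    refine integral_congr_ae ?_
    filter_upwards [ht] with x hx
    rw [hx]
  have h2 : ∀ᵐ z ∂(cylMeasure Ω M), ∫ y in Ω, f (v (z.1, y)) = ∫ y in Ω, f (v' (z.1, y)) :=
    Measure.quasiMeasurePreserving_fst.ae h1
  filter_upwards [h, h2] with z hz1 hz2
  rw [nonlocalTerm, nonlocalTerm, hz1, hz2]

lemma isW11EndZero_tensor {g : ℝ → ℝ} {C : ℝ}
    (hg : Measurable g) (hgC : ∀ t, |g t| ≤ C) {w : EuclideanSpace ℝ (Fin N) → ℝ}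
    (hw : Integrable w (volume.restrict Ω))
    (hu : Integrable (fun z : ℝ × EuclideanSpace ℝ (Fin N) => -(∫ s in z.1..M, g s) * w z.2)
      (cylMeasure Ω M)) :
    IsW11EndZero Ω M (fun z => -(∫ s in z.1..M, g s) * w z.2) (fun z => g z.1 * w z.2) := by
  refine ⟨hu, ?_, ae_of_all _ fun z => ?_⟩
  · exact (hw.comp_snd (volume.restrict (Ioo 0 M))).bdd_mul (c := C)
      (hg.comp measurable_fst).aestronglyMeasurable (ae_of_all _ fun z => hgC z.1)
  · dsimp only
    rw [intervalIntegral.integral_mul_const, neg_mul]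

lemma continuous_integral_left {g : ℝ → ℝ} {C : ℝ} (hg : Measurable g) (hgC : ∀ t, |g t| ≤ C) :
    Continuous fun t => ∫ s in t..M, g s := by
  have hgi : ∀ a b, IntervalIntegrable g volume a b := fun a b =>
    (intervalIntegrable_const (c := C)).mono_fun hg.aestronglyMeasurable
      (ae_of_all _ fun t => (hgC t).trans (le_abs_self C))
  refine (intervalIntegral.continuous_primitive hgi M).neg.congr fun t => ?_
  rw [Pi.neg_apply, intervalIntegral.integral_symm, neg_neg]

lemma memLp_top_tensor {θ : ℝ → ℝ} (hθ : Continuous θ) {w : EuclideanSpace ℝ (Fin N) → ℝ}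
    (hw : AEStronglyMeasurable w (volume.restrict Ω)) {C : ℝ} (hC : ∀ x, |w x| ≤ C) :
    MemLp (fun z : ℝ × EuclideanSpace ℝ (Fin N) => θ z.1 * w z.2) ∞ (cylMeasure Ω M) := by
  obtain ⟨Cθ, hCθ⟩ := (isCompact_Icc (a := (0 : ℝ)) (b := M)).exists_bound_of_continuousOn
    hθ.continuousOn
  have h1 : ∀ᵐ t ∂(volume.restrict (Ioo 0 M)), ‖θ t‖ ≤ Cθ := by
    filter_upwards [ae_restrict_mem measurableSet_Ioo] with t ht
    exact hCθ t (Ioo_subset_Icc_self ht)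
  have h2 : ∀ᵐ z ∂(cylMeasure Ω M), ‖θ z.1‖ ≤ Cθ := Measure.quasiMeasurePreserving_fst.ae h1
  have h3 : AEStronglyMeasurable (fun z : ℝ × EuclideanSpace ℝ (Fin N) => w z.2)
    (cylMeasure Ω M) := hw.comp_snd
  refine memLp_top_of_bound
    ((hθ.comp continuous_fst).aestronglyMeasurable.mul h3) (Cθ * C) ?_
  filter_upwards [h2] with z hz
  rw [norm_mul]
  exact mul_le_mul hz (hC z.2) (norm_nonneg _) ((norm_nonneg _).trans hz)

/-- The weak formulation with a test function `θ(t) w(x)`, `θ(t) = -∫_t^M g`. -/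
lemma integral_tensor_eq [IsFiniteMeasure (volume.restrict Ω)]
    (hm : 2 ≤ m) {κ : ℝ} {α f : ℝ → ℝ} {v₀ : EuclideanSpace ℝ (Fin N) → ℝ}
    {v : ℝ × EuclideanSpace ℝ (Fin N) → ℝ}
    {Dv : ℝ × EuclideanSpace ℝ (Fin N) → EuclideanSpace ℝ (Fin N)} {ζ : NegSobolev Ω M m}
    (hweak : ∀ u Du, IsLmW0 Ω M m u Du → MemLp u ∞ (cylMeasure Ω M) →
      ζ.pair u Du + ∫ z, inner ℝ (‖Dv z‖ ^ (m - 2) • Dv z) (Du z) ∂(cylMeasure Ω M) =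
        κ * ∫ z, nonlocalTerm Ω f v z * u z ∂(cylMeasure Ω M))
    (hibp : ∀ u Du g, IsLmW0 Ω M m u Du → IsW11EndZero Ω M u g →
      ζ.pair u Du = -∫ z, (α (v z) - α (v₀ z.2)) * g z ∂(cylMeasure Ω M))
    {w : EuclideanSpace ℝ (Fin N) → ℝ} {G : EuclideanSpace ℝ (Fin N) → EuclideanSpace ℝ (Fin N)}
    (hw : IsW0 Ω m w G) {Cw : ℝ} (hCw : ∀ x, |w x| ≤ Cw) {g : ℝ → ℝ} {C : ℝ}
    (hg : Measurable g) (hgC : ∀ t, |g t| ≤ C) :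
    ∫ z, (α (v z) - α (v₀ z.2)) * (g z.1 * w z.2) ∂(cylMeasure Ω M) =
      ∫ z, inner ℝ (‖Dv z‖ ^ (m - 2) • Dv z) (-(∫ s in z.1..M, g s) • G z.2) ∂(cylMeasure Ω M) -
        κ * ∫ z, nonlocalTerm Ω f v z * (-(∫ s in z.1..M, g s) * w z.2) ∂(cylMeasure Ω M) := by
  have hp : 1 ≤ ENNReal.ofReal m := by
    rw [ENNReal.one_le_ofReal]; linarith
  have hθ : Continuous fun t => -∫ s in t..M, g s := (continuous_integral_left hg hgC).neg
  have hu := isLmW0_tensor (M := M) hw hθ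
  have h1 := hweak _ _ hu (memLp_top_tensor hθ hw.memLp.1 hCw)
  have h2 := hibp _ _ _ hu (isW11EndZero_tensor hg hgC (hw.memLp.integrable hp)
    (hu.memLp.integrable hp))
  linarith

lemma integral_tensor_eq_of_ae_eq [IsFiniteMeasure (volume.restrict Ω)]
    (hm : 2 ≤ m) {κ : ℝ} {α : ℝ → ℝ} {v₀ v₀' : EuclideanSpace ℝ (Fin N) → ℝ}
    {v v' F F' : ℝ × EuclideanSpace ℝ (Fin N) → ℝ}
    {Dv Dv' : ℝ × EuclideanSpace ℝ (Fin N) → EuclideanSpace ℝ (Fin N)}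
    (he0 : v₀ =ᵐ[volume.restrict Ω] v₀') (he : v =ᵐ[cylMeasure Ω M] v')
    (heD : Dv =ᵐ[cylMeasure Ω M] Dv') (heF : F =ᵐ[cylMeasure Ω M] F')
    (hflux : MemLp (fun z => ‖Dv' z‖ ^ (m - 2) • Dv' z) (ENNReal.ofReal (m / (m - 1)))
      (cylMeasure Ω M))
    (hF' : MemLp F' ∞ (cylMeasure Ω M))
    {w : EuclideanSpace ℝ (Fin N) → ℝ} {G : EuclideanSpace ℝ (Fin N) → EuclideanSpace ℝ (Fin N)}
    (hw : IsW0 Ω m w G) {g : ℝ → ℝ} {C : ℝ}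
    (hg : Measurable g) (hgC : ∀ t, |g t| ≤ C)
    (h : ∫ z, (α (v z) - α (v₀ z.2)) * (g z.1 * w z.2) ∂(cylMeasure Ω M) =
      ∫ z, inner ℝ (‖Dv z‖ ^ (m - 2) • Dv z) (-(∫ s in z.1..M, g s) • G z.2) ∂(cylMeasure Ω M) -
        κ * ∫ z, F z * (-(∫ s in z.1..M, g s) * w z.2) ∂(cylMeasure Ω M)) :
    ∫ z, (α (v' z) - α (v₀' z.2)) * (g z.1 * w z.2) ∂(cylMeasure Ω M) =
      ∫ z, (∫ s in z.1..M, g s) * (κ * F' z * w z.2 -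
        inner ℝ (‖Dv' z‖ ^ (m - 2) • Dv' z) (G z.2)) ∂(cylMeasure Ω M) := by
  have hcj := holderConjugate_ofReal (m := m) (by linarith)
  have hp : 1 ≤ ENNReal.ofReal m := by
    rw [ENNReal.one_le_ofReal]; linarith
  have hθ : Continuous fun t => -∫ s in t..M, g s := (continuous_integral_left hg hgC).neg
  have hu := isLmW0_tensor (M := M) hw hθ
  have hui := hu.memLp.integrable hp
  have e0 : ∀ᵐ z ∂(cylMeasure Ω M), v₀ z.2 = v₀' z.2 :=
    Measure.quasiMeasurePreserving_snd.ae he0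
  have e1 : ∫ z, (α (v' z) - α (v₀' z.2)) * (g z.1 * w z.2) ∂(cylMeasure Ω M) =
      ∫ z, (α (v z) - α (v₀ z.2)) * (g z.1 * w z.2) ∂(cylMeasure Ω M) := by
    refine integral_congr_ae ?_
    filter_upwards [he, e0] with z hz hz0
    rw [hz, hz0]
  have e2 : ∫ z, inner ℝ (‖Dv z‖ ^ (m - 2) • Dv z) (-(∫ s in z.1..M, g s) • G z.2)
      ∂(cylMeasure Ω M) = ∫ z, inner ℝ (‖Dv' z‖ ^ (m - 2) • Dv' z)
        (-(∫ s in z.1..M, g s) • G z.2) ∂(cylMeasure Ω M) := by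
    refine integral_congr_ae ?_
    filter_upwards [heD] with z hz
    rw [hz]
  have e3 : ∫ z, F z * (-(∫ s in z.1..M, g s) * w z.2) ∂(cylMeasure Ω M) =
      ∫ z, F' z * (-(∫ s in z.1..M, g s) * w z.2) ∂(cylMeasure Ω M) := by
    refine integral_congr_ae ?_
    filter_upwards [heF] with z hz
    rw [hz]
  have i1 := integrable_inner_of_memLp hflux hu.memLp_grad
  have i2 := integrable_mul_of_memLp hF' (memLp_one_iff_integrable.2 hui)
  have e4 : ∫ z, (∫ s in z.1..M, g s) * (κ * F' z * w z.2 -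
      inner ℝ (‖Dv' z‖ ^ (m - 2) • Dv' z) (G z.2)) ∂(cylMeasure Ω M) =
      ∫ z, inner ℝ (‖Dv' z‖ ^ (m - 2) • Dv' z) (-(∫ s in z.1..M, g s) • G z.2)
        ∂(cylMeasure Ω M) - κ * ∫ z, F' z * (-(∫ s in z.1..M, g s) * w z.2)
        ∂(cylMeasure Ω M) := by
    rw [← integral_const_mul, ← integral_sub i1 (i2.const_mul κ)]
    refine integral_congr_ae (ae_of_all _ fun z => ?_)
    simp only [inner_smul_right]
    ring
  rw [e1, e4, h, e2, e3]

/-- Products `θ(t) w(x)` with `θ(M) = 0` are admissible both in the equation and in the integration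
by parts formula, so the dual element `ζ` drops out. Representatives bounded everywhere make every
time slice measurable and bounded, so later bounds on slices hold for all times. -/
lemma IsBoundedWeakSolution.exists_isEvolution [IsFiniteMeasure (volume.restrict Ω)]
    (hm : 2 ≤ m) {κ : ℝ} {α f : ℝ → ℝ} (hα : Continuous α) (hf : Continuous f) {σ : ℝ}
    (hσ0 : 0 < σ) (hσ : ∀ s, σ ≤ f s) {v₀ : EuclideanSpace ℝ (Fin N) → ℝ}
    (hv₀ : MemLp v₀ ∞ (volume.restrict Ω)) {v : ℝ × EuclideanSpace ℝ (Fin N) → ℝ}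
    (hv : IsBoundedWeakSolution Ω M m κ α f v₀ v) :
    ∃ v₀' v' Dv', v₀ =ᵐ[volume.restrict Ω] v₀' ∧ v =ᵐ[cylMeasure Ω M] v' ∧
      IsEvolution Ω M m α v₀' v' Dv' (fun z => ‖Dv' z‖ ^ (m - 2) • Dv' z)
        (fun z => κ * nonlocalTerm Ω f v' z) := by
  obtain ⟨hvb, Dv, hLm, -, ζ, hweak, hibp⟩ := hv
  obtain ⟨v₀', hm0, ⟨C₀, hC₀⟩, he0⟩ := exists_bounded_measurable hv₀
  obtain ⟨v', hmv, ⟨C, hC⟩, he⟩ := exists_bounded_measurable hvb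
  obtain ⟨Dv', -, heD⟩ := hLm.memLp_grad.1
  have hDLp := hLm.memLp_grad.ae_eq heD
  have hflux := memLp_flux hm hDLp
  obtain ⟨CF, hCF⟩ := exists_abs_nonlocalTerm_le (Ω := Ω) hf hσ0 hσ hmv hC
  have hmN := measurable_nonlocalTerm (Ω := Ω) hf hmv
  have hmF : Measurable fun z => κ * nonlocalTerm Ω f v' z := hmN.const_mul κ
  have hFb : ∀ z, |κ * nonlocalTerm Ω f v' z| ≤ |κ| * CF := fun z => by
    rw [abs_mul]; exact mul_le_mul_of_nonneg_left (hCF z) (abs_nonneg _)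
  obtain ⟨Cα, hCα⟩ := exists_abs_comp_le hα hC
  obtain ⟨Cα0, hCα0⟩ := exists_abs_comp_le hα hC₀
  have hβ : Measurable fun z : ℝ × EuclideanSpace ℝ (Fin N) => α (v' z) - α (v₀' z.2) :=
    (hα.measurable.comp hmv).sub (hα.measurable.comp (hm0.comp measurable_snd))
  have hβb : ∀ z : ℝ × EuclideanSpace ℝ (Fin N), |α (v' z) - α (v₀' z.2)| ≤ Cα + Cα0 := fun z =>
    (abs_sub _ _).trans (add_le_add (hCα z) (hCα0 z.2))
  have hslice : ∀ᵐ t ∂(volume.restrict (Ioo 0 M)),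
      IsW0 Ω m (fun x => v' (t, x)) (fun x => Dv' (t, x)) := by
    filter_upwards [hLm.slice, Measure.ae_ae_of_ae_prod he, Measure.ae_ae_of_ae_prod heD]
      with t h1 h2 h3 using h1.congr_ae h2 h3
  have hβt : MemLp (fun z : ℝ × EuclideanSpace ℝ (Fin N) => α (v' z) - α (v₀' z.2)) ∞
      (cylMeasure Ω M) := memLp_top_of_bound hβ.aestronglyMeasurable _ (ae_of_all _ hβb)
  have hFt : MemLp (fun z => κ * nonlocalTerm Ω f v' z) ∞ (cylMeasure Ω M) :=
    memLp_top_of_bound hmF.aestronglyMeasurable _ (ae_of_all _ hFb)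
  have hNt : MemLp (nonlocalTerm Ω f v') ∞ (cylMeasure Ω M) :=
    memLp_top_of_bound hmN.aestronglyMeasurable _ (ae_of_all _ hCF)
  have heF : nonlocalTerm Ω f v =ᵐ[cylMeasure Ω M] nonlocalTerm Ω f v' := nonlocalTerm_congr_ae he
  have htest : ∀ w G, IsW0 Ω m w G → (∃ C, ∀ x, |w x| ≤ C) →
      ∀ᵐ s ∂(volume.restrict (Ioo 0 M)), ∫ x in Ω, (α (v' (s, x)) - α (v₀' x)) * w x =
        ∫ r in Ioo 0 s, ∫ x in Ω, (κ * nonlocalTerm Ω f v' (r, x) * w x -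
          inner ℝ (‖Dv' (r, x)‖ ^ (m - 2) • Dv' (r, x)) (G x)) := by
    intro w G hw ⟨Cw, hCw⟩
    exact ae_integral_eq_of_forall_primitive
      (β := fun z : ℝ × EuclideanSpace ℝ (Fin N) => α (v' z) - α (v₀' z.2))
      (F := fun z => κ * nonlocalTerm Ω f v' z)
      (a := fun z => ‖Dv' z‖ ^ (m - 2) • Dv' z) (by linarith) hβt hFt hflux hw
      fun g Cg hg hgC => integral_tensor_eq_of_ae_eq hm he0 he heD heF hflux hNt hw hg hgC
        (integral_tensor_eq hm hweak hibp hw hCw hg hgC)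
  have hbal := ae_forall_integral_eq (Ω := Ω) (M := M) (m := m)
      (β := fun z : ℝ × EuclideanSpace ℝ (Fin N) => α (v' z) - α (v₀' z.2))
      (F := fun z => κ * nonlocalTerm Ω f v' z)
      (a := fun z => ‖Dv' z‖ ^ (m - 2) • Dv' z) (by linarith) hβ hβb hmF hFb hflux htest
  exact ⟨v₀', v', Dv', he0, he, ⟨hm0, hmv, hmF, ⟨C₀, hC₀⟩, ⟨C, hC⟩, ⟨_, hFb⟩, hDLp,
    hflux, hslice, hbal⟩⟩

end Representative

/-! ### Backward differences in one variable. -/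

section OneDim

variable {M : ℝ}

/-- Extension by zero treats `t - h ≤ 0` and `t - h > 0` alike: for `t < h` the window is cut at
time 0, where the datum takes over. -/
lemma integral_indicator_comp_sub {R : ℝ → ℝ} (hR : IntegrableOn R (Ioo 0 M)) {t h : ℝ}
    (ht : t ∈ Ioo 0 M) (hh : 0 < h) :
    ∫ σ in Ioc 0 h, (Ioo 0 M).indicator R (t - σ) =
      (∫ r in Ioo 0 t, R r) - ∫ r in Ioo 0 (t - h), R r := by
  have hi : Integrable ((Ioo 0 M).indicator R) := hR.integrable_indicator measurableSet_Ioo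
  have hlow : ∀ s ≤ 0, ∫ r in s..0, (Ioo 0 M).indicator R r = 0 := fun s hs => by
    rw [intervalIntegral.integral_of_le hs]
    refine setIntegral_eq_zero_of_forall_eq_zero fun r hr => ?_
    exact indicator_of_notMem (fun h => absurd h.1 (not_lt.2 hr.2)) _
  have hpos : ∀ s < M, ∫ r in Ioo 0 s, R r = ∫ r in (0 : ℝ)..(max s 0), (Ioo 0 M).indicator R r := by
    intro s hs
    rw [intervalIntegral.integral_of_le (le_max_right _ _), integral_Ioc_eq_integral_Ioo]
    have : Ioo 0 (max s 0) = Ioo 0 s := by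
      rcases le_total s 0 with h | h
      · rw [max_eq_right h, Ioo_self, Ioo_eq_empty (not_lt.2 h)]
      · rw [max_eq_left h]
    rw [this]
    refine setIntegral_congr_fun measurableSet_Ioo fun r hr => ?_
    exact (indicator_of_mem (show r ∈ Ioo 0 M from ⟨hr.1, hr.2.trans hs⟩) R).symm
  have e1 : ∫ σ in Ioc 0 h, (Ioo 0 M).indicator R (t - σ) =
      ∫ r in (t - h)..t, (Ioo 0 M).indicator R r := by
    rw [← intervalIntegral.integral_of_le hh.le,
      intervalIntegral.integral_comp_sub_left (fun r => (Ioo 0 M).indicator R r), sub_zero]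
  have e2 : ∫ r in (t - h)..(max (t - h) 0), (Ioo 0 M).indicator R r = 0 := by
    rcases le_total (t - h) 0 with hs | hs
    · rw [max_eq_right hs, hlow _ hs]
    · rw [max_eq_left hs, intervalIntegral.integral_same]
  have ii : ∀ a b, IntervalIntegrable ((Ioo 0 M).indicator R) volume a b :=
    fun a b => hi.intervalIntegrable
  rw [e1, hpos t ht.2, hpos (t - h) (by linarith [ht.2]), max_eq_left ht.1.le,
    ← intervalIntegral.integral_add_adjacent_intervals (ii (t - h) (max (t - h) 0)) (ii _ t), e2,
    zero_add, ← intervalIntegral.integral_add_adjacent_intervals (ii 0 (max (t - h) 0)) (ii _ t)]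
  ring

/-- Summation by parts for backward difference quotients. -/
lemma tendsto_backward_difference {D χ χ' : ℝ → ℝ} {C : ℝ} (hD : Measurable D)
    (hDC : ∀ t, |D t| ≤ C) (hD0 : ∀ t, t ∉ Ioo 0 M → D t = 0)
    (hχ : ∀ t, HasDerivAt χ (χ' t) t) (hχ' : Continuous χ') (hχM : ∀ t, M ≤ t → χ t = 0) :
    Tendsto (fun h => h⁻¹ * ∫ t in Ioo 0 M, χ t * (D t - D (t - h))) (𝓝[>] 0)
      (𝓝 (-∫ t in Ioo 0 M, χ' t * D t)) := by
  have hχc : Continuous χ := continuous_iff_continuousAt.2 fun t => (hχ t).continuousAt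
  have hDi : Integrable D := by
    have : IntegrableOn D (Ioo 0 M) :=
      Measure.integrableOn_of_bounded (M := C) measure_Ioo_lt_top.ne hD.aestronglyMeasurable
        (ae_of_all _ hDC)
    rw [← integrableOn_univ]
    exact this.of_forall_sdiff_eq_zero MeasurableSet.univ fun t ht => hD0 t ht.2
  obtain ⟨B, hB⟩ := (isCompact_Icc (a := (0 : ℝ)) (b := M + 1)).exists_bound_of_continuousOn
    hχ'.continuousOn
  obtain ⟨B0, hB0⟩ := (isCompact_Icc (a := (0 : ℝ)) (b := M + 1)).exists_bound_of_continuousOn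
    hχc.continuousOn
  -- Translating by `h` moves the difference onto `χ`. There is no boundary term since `D` vanishes
  -- for `t ≤ 0` and `χ` for `t ≥ M`; the restriction `h < 1` keeps `t + h` in `[0, M + 1]`, where
  -- the bounds on `χ` and `χ'` were taken.
  have e : ∀ h ∈ Ioo (0 : ℝ) 1, ∫ t in Ioo 0 M, χ t * (D t - D (t - h)) =
      -∫ t in Ioo 0 M, (χ (t + h) - χ t) * D t := by
    intro h hh
    have i0 : IntegrableOn (fun t => χ t * D t) (Ioo 0 M) :=
      hDi.integrableOn.bdd_mul (c := B0) hχc.aestronglyMeasurable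
        ((ae_restrict_mem measurableSet_Ioo).mono fun t ht =>
          hB0 t ⟨ht.1.le, by linarith [ht.2]⟩)
    have i1 : IntegrableOn (fun t => χ t * D (t - h)) (Ioo 0 M) :=
      (hDi.comp_sub_right h).integrableOn.bdd_mul (c := B0) hχc.aestronglyMeasurable
        ((ae_restrict_mem measurableSet_Ioo).mono fun t ht =>
          hB0 t ⟨ht.1.le, by linarith [ht.2]⟩)
    have i2 : IntegrableOn (fun t => χ (t + h) * D t) (Ioo 0 M) :=
      hDi.integrableOn.bdd_mul (c := B0)
        (hχc.comp (continuous_add_const h)).aestronglyMeasurable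
        ((ae_restrict_mem measurableSet_Ioo).mono fun t ht =>
          hB0 _ ⟨by linarith [ht.1, hh.1], by linarith [ht.2, hh.2]⟩)
    have s1 : ∫ t in Ioo 0 M, χ t * D (t - h) = ∫ t, χ t * D (t - h) := by
      refine setIntegral_eq_integral_of_forall_compl_eq_zero fun t ht => ?_
      rcases lt_or_ge t M with h1 | h1
      · have h0 : t ≤ 0 := not_lt.1 fun h0 => ht ⟨h0, h1⟩
        rw [hD0 (t - h) (fun h' => by linarith [h'.1, hh.1]), mul_zero]
      · rw [hχM t h1, zero_mul]
    have s2 : ∫ t in Ioo 0 M, χ (t + h) * D t = ∫ t, χ (t + h) * D t :=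
      setIntegral_eq_integral_of_forall_compl_eq_zero fun t ht => by rw [hD0 t ht, mul_zero]
    have s3 : ∫ t, χ t * D (t - h) = ∫ t, χ (t + h) * D t := by
      rw [← integral_add_right_eq_self (fun t => χ t * D (t - h)) h]
      simp
    simp_rw [mul_sub, sub_mul]
    rw [integral_sub i0 i1, integral_sub i2 i0, s1, s2, s3]
    ring
  have lim : Tendsto (fun h => ∫ t in Ioo 0 M, (h⁻¹ * (χ (t + h) - χ t)) * D t) (𝓝[>] 0)
      (𝓝 (∫ t in Ioo 0 M, χ' t * D t)) := by
    refine tendsto_integral_filter_of_dominated_convergence (fun _ => B * C) ?_ ?_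
      (integrable_const _) ?_
    · refine Eventually.of_forall fun h => ?_
      exact ((continuous_const.mul ((hχc.comp (continuous_add_const h)).sub
        hχc)).measurable.mul hD).aestronglyMeasurable
    · filter_upwards [Ioo_mem_nhdsGT (zero_lt_one' ℝ)] with h hh
      filter_upwards [ae_restrict_mem measurableSet_Ioo] with t ht
      have := Convex.norm_image_sub_le_of_norm_hasDerivWithin_le (f := χ) (f' := χ')
        (s := Icc 0 (M + 1)) (C := B) (x := t) (y := t + h)
        (fun x _ => (hχ x).hasDerivWithinAt) hB (convex_Icc _ _)
        ⟨ht.1.le, by linarith [ht.2]⟩ ⟨by linarith [ht.1, hh.1], by linarith [ht.2, hh.2]⟩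
      have hB0' : 0 ≤ B := (norm_nonneg _).trans (hB t ⟨ht.1.le, by linarith [ht.2]⟩)
      rw [norm_mul, norm_mul, norm_inv]
      have h2 : ‖h‖⁻¹ * ‖χ (t + h) - χ t‖ ≤ B := by
        rw [inv_mul_le_iff₀ (by simpa using hh.1.ne')]
        simpa [mul_comm] using this
      exact mul_le_mul h2 (hDC t) (norm_nonneg _) hB0'
    · refine ae_of_all _ fun t => ?_
      have := (hχ t).tendsto_slope_zero_right
      simp only [smul_eq_mul] at this
      exact this.mul_const _
  refine lim.neg.congr' ?_
  filter_upwards [Ioo_mem_nhdsGT (zero_lt_one' ℝ)] with h hh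
  rw [e h hh, mul_neg, ← integral_const_mul]
  simp_rw [mul_assoc]

end OneDim

/-- Fubini after reassociating the product: the shift `σ`, innermost in the differenced balance, has
to come outermost to be averaged. -/
lemma integral_integral_swap_triple {X Y Z : Type*} [MeasurableSpace X] [MeasurableSpace Y]
    [MeasurableSpace Z] {μ : Measure X} {ν : Measure Y} {ρ : Measure Z} [SFinite μ] [SFinite ν]
    [SFinite ρ] {I : X × (Y × Z) → ℝ} (hI : Integrable I (μ.prod (ν.prod ρ))) :
    ∫ y, ∫ x, ∫ z, I (x, y, z) ∂ρ ∂μ ∂ν = ∫ x, ∫ p, I (x, p) ∂(ν.prod ρ) ∂μ := by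
  have hmp := measurePreserving_prodAssoc μ ν ρ
  have hI' : Integrable (fun q : (X × Y) × Z => I (q.1.1, q.1.2, q.2)) ((μ.prod ν).prod ρ) :=
    hmp.integrable_comp_of_integrable hI
  have e1 : ∫ q, I (q.1.1, q.1.2, q.2) ∂((μ.prod ν).prod ρ) = ∫ x, ∫ p, I (x, p) ∂(ν.prod ρ) ∂μ := by
    rw [← integral_prod _ hI]
    exact hmp.integral_comp MeasurableEquiv.prodAssoc.measurableEmbedding I
  rw [← e1, integral_prod _ hI', integral_prod_symm _ hI'.integral_prod_left]

lemma integrable_integral_triple {X Y Z : Type*} [MeasurableSpace X] [MeasurableSpace Y]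
    [MeasurableSpace Z] {μ : Measure X} {ν : Measure Y} {ρ : Measure Z} [SFinite μ] [SFinite ν]
    [SFinite ρ] {I : X × (Y × Z) → ℝ} (hI : Integrable I (μ.prod (ν.prod ρ))) :
    Integrable (fun y => ∫ x, ∫ z, I (x, y, z) ∂ρ ∂μ) ν := by
  have hI' : Integrable (fun q : (X × Y) × Z => I (q.1.1, q.1.2, q.2)) ((μ.prod ν).prod ρ) :=
    (measurePreserving_prodAssoc μ ν ρ).integrable_comp_of_integrable hI
  exact hI'.integral_prod_left.integral_prod_right

/-! ### The entropy inequality against a fixed function. -/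

section EntropyInequality

variable {N : ℕ} {Ω : Set (EuclideanSpace ℝ (Fin N))} {M m : ℝ}

lemma integrable_test_integrand [IsFiniteMeasure (volume.restrict Ω)] (hm : 1 < m)
    {F : ℝ × EuclideanSpace ℝ (Fin N) → ℝ}
    {a : ℝ × EuclideanSpace ℝ (Fin N) → EuclideanSpace ℝ (Fin N)}
    {w : EuclideanSpace ℝ (Fin N) → ℝ} {G : EuclideanSpace ℝ (Fin N) → EuclideanSpace ℝ (Fin N)}
    (hFm : Measurable F) {C : ℝ} (hFC : ∀ z, |F z| ≤ C)
    (ha : MemLp a (ENNReal.ofReal (m / (m - 1))) (cylMeasure Ω M)) (hw : IsW0 Ω m w G) :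
    Integrable (fun z => F z * w z.2 - inner ℝ (a z) (G z.2)) (cylMeasure Ω M) := by
  have := holderConjugate_ofReal hm
  have hF : MemLp F (ENNReal.ofReal (m / (m - 1))) (cylMeasure Ω M) :=
    MemLp.of_bound hFm.aestronglyMeasurable C (ae_of_all _ hFC)
  exact (integrable_mul_of_memLp hF (hw.memLp.comp_snd (volume.restrict (Ioo 0 M)))).sub
    (integrable_inner_of_memLp ha (hw.memLp_grad.comp_snd (volume.restrict (Ioo 0 M))))

end EntropyInequality

section EntropyIntegral

variable {X : Type*} [MeasurableSpace X] {μ : Measure X} [IsFiniteMeasure μ] {S α : ℝ → ℝ}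

lemma abs_entropy_le (hS : SignLike S) (hα : Continuous α) (hmono : Monotone α) (a b : ℝ) :
    |entropy S α a b| ≤ |α a| + |α b| := by
  rw [abs_of_nonneg (entropy_nonneg hS hα hmono a b)]
  exact (entropy_le hS hα hmono a b).trans (abs_sub _ _)

lemma measurable_entropy_comp (hS : SignLike S) (hα : Continuous α) {p q : X → ℝ}
    (hp : Measurable p) (hq : Measurable q) : Measurable fun x => entropy S α (p x) (q x) :=
  (continuous_entropy hS hα).measurable.comp (hp.prodMk hq)

lemma exists_abs_entropy_le (hS : SignLike S) (hα : Continuous α) (hmono : Monotone α)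
    {C₁ C₂ : ℝ} : ∃ C, ∀ a b, |a| ≤ C₁ → |b| ≤ C₂ → |entropy S α a b| ≤ C := by
  obtain ⟨A, hA⟩ := exists_abs_comp_le hα (X := {a : ℝ // |a| ≤ C₁}) (v := Subtype.val)
    (fun a => a.2)
  obtain ⟨B, hB⟩ := exists_abs_comp_le hα (X := {a : ℝ // |a| ≤ C₂}) (v := Subtype.val)
    (fun a => a.2)
  exact ⟨A + B, fun a b ha hb => (abs_entropy_le hS hα hmono a b).trans
    (add_le_add (hA ⟨a, ha⟩) (hB ⟨b, hb⟩))⟩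

lemma integrable_entropy_comp (hS : SignLike S) (hα : Continuous α) (hmono : Monotone α)
    {p q : X → ℝ} (hp : Measurable p) (hq : Measurable q) {C₁ C₂ : ℝ} (hp' : ∀ x, |p x| ≤ C₁)
    (hq' : ∀ x, |q x| ≤ C₂) : Integrable (fun x => entropy S α (p x) (q x)) μ := by
  obtain ⟨C, hC⟩ := exists_abs_entropy_le hS hα hmono (C₁ := C₁) (C₂ := C₂)
  exact Integrable.of_bound (measurable_entropy_comp hS hα hp hq).aestronglyMeasurable C
    (ae_of_all _ fun x => hC _ _ (hp' x) (hq' x))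

lemma integral_entropy_sub_le (hS : SignLike S) (hα : Continuous α) (hmono : Monotone α)
    {p q z : X → ℝ} (hp : Measurable p) (hq : Measurable q) (hz : Measurable z) {C₁ C₂ C₃ : ℝ}
    (hp' : ∀ x, |p x| ≤ C₁) (hq' : ∀ x, |q x| ≤ C₂) (hz' : ∀ x, |z x| ≤ C₃) :
    ∫ x, entropy S α (p x) (z x) ∂μ - ∫ x, entropy S α (q x) (z x) ∂μ ≤
      ∫ x, (α (p x) - α (q x)) * S (p x - z x) ∂μ := by
  have i1 := integrable_entropy_comp (μ := μ) hS hα hmono hp hz hp' hz'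
  have i2 := integrable_entropy_comp (μ := μ) hS hα hmono hq hz hq' hz'
  obtain ⟨A, hA⟩ := exists_abs_comp_le hα hp'
  obtain ⟨B, hB⟩ := exists_abs_comp_le hα hq'
  rw [← integral_sub i1 i2]
  refine integral_mono (i1.sub i2) ?_ fun x => entropy_sub_le hS hα hmono _ _ _
  refine Integrable.of_bound (C := A + B) ?_ (ae_of_all _ fun x => ?_)
  · exact (((hα.measurable.comp hp).sub (hα.measurable.comp hq)).mul
      (hS.contDiff.continuous.measurable.comp (hp.sub hz))).aestronglyMeasurable
  · rw [norm_mul]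
    refine (mul_le_of_le_one_right (norm_nonneg _) (hS.abs_le _)).trans ?_
    exact (abs_sub _ _).trans (add_le_add (hA x) (hB x))

end EntropyIntegral

section EntropyInequality

variable {N : ℕ} {Ω : Set (EuclideanSpace ℝ (Fin N))} {M m : ℝ} {S α : ℝ → ℝ}
  {v₀ : EuclideanSpace ℝ (Fin N) → ℝ} {v : ℝ × EuclideanSpace ℝ (Fin N) → ℝ}
  {Dv a : ℝ × EuclideanSpace ℝ (Fin N) → EuclideanSpace ℝ (Fin N)}
  {F : ℝ × EuclideanSpace ℝ (Fin N) → ℝ} {z : EuclideanSpace ℝ (Fin N) → ℝ}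
  {Dz : EuclideanSpace ℝ (Fin N) → EuclideanSpace ℝ (Fin N)}

lemma IsEvolution.isW0_test (hm : 1 ≤ m) (h : IsEvolution Ω M m α v₀ v Dv a F) (hS : SignLike S)
    (hz : IsW0 Ω m z Dz) : ∀ᵐ t ∂(volume.restrict (Ioo 0 M)),
      IsW0 Ω m (fun x => S (v (t, x) - z x))
        (fun x => deriv S (v (t, x) - z x) • (Dv (t, x) - Dz x)) := by
  obtain ⟨L, hL⟩ := hS.deriv_le
  filter_upwards [h.slice] with t ht
  exact (ht.sub hm hz).comp hm hS.contDiff hS.zero hL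

/-- Entropy relative to `z`, minus its initial value, extended by zero outside `(0, M)`. -/
noncomputable def relEntropy (Ω : Set (EuclideanSpace ℝ (Fin N))) (M : ℝ) (S α : ℝ → ℝ)
    (v₀ : EuclideanSpace ℝ (Fin N) → ℝ) (v : ℝ × EuclideanSpace ℝ (Fin N) → ℝ)
    (z : EuclideanSpace ℝ (Fin N) → ℝ) : ℝ → ℝ :=
  (Ioo 0 M).indicator fun t =>
    (∫ x in Ω, entropy S α (v (t, x)) (z x)) - ∫ x in Ω, entropy S α (v₀ x) (z x)

lemma measurable_integral_entropy (hS : SignLike S) (hα : Continuous α) (hv : Measurable v)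
    (hz : Measurable z) : Measurable fun t => ∫ x in Ω, entropy S α (v (t, x)) (z x) :=
  ((measurable_entropy_comp hS hα hv (hz.comp measurable_snd)).stronglyMeasurable.integral_prod_right
    (ν := volume.restrict Ω)).measurable

/-- Subtract the balances at times `t` and `t - k`, both tested with `S(v(t, ·) - z)` frozen at time
`t`, and bound the left side below by `entropy_sub_le`. Freezing at the later endpoint gives the
convexity inequality the needed direction. -/
lemma IsEvolution.backward_entropy_le [IsFiniteMeasure (volume.restrict Ω)]
    (hΩ : MeasurableSet Ω) (hm : 1 < m)
    (h : IsEvolution Ω M m α v₀ v Dv a F) (hα : Continuous α) (hmono : Monotone α)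
    (hS : SignLike S) (hz : IsW0 Ω m z Dz) (hzm : Measurable z) {Cz : ℝ} (hzC : ∀ x, |z x| ≤ Cz)
    {k : ℝ} (hk : 0 < k) :
    ∀ᵐ t ∂(volume.restrict (Ioo 0 M)),
      relEntropy Ω M S α v₀ v z t - relEntropy Ω M S α v₀ v z (t - k) ≤
      ∫ σ in Ioc 0 k, ∫ x in Ω, ((Ioo 0 M ×ˢ Ω).indicator F (t - σ, x) * S (v (t, x) - z x) -
        inner ℝ ((Ioo 0 M ×ˢ Ω).indicator a (t - σ, x))
          (deriv S (v (t, x) - z x) • (Dv (t, x) - Dz x))) := by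
  obtain ⟨C₀, hC₀⟩ := h.bounded_initial
  obtain ⟨C, hC⟩ := h.bounded
  obtain ⟨CF, hCF⟩ := h.bounded_source
  have hbal := (ae_restrict_iff' measurableSet_Ioo).1 h.balance
  -- Translations preserve null sets, so for almost every `t` the balance also holds at `t - k`
  -- whenever that time is in `(0, M)`.
  have hbal' := (measurePreserving_sub_right volume k).quasiMeasurePreserving.ae hbal
  filter_upwards [h.balance, ae_restrict_of_ae hbal', h.isW0_test hm.le hS hz,
    ae_restrict_mem measurableSet_Ioo] with t h1 h2 h3 ht
  set w : EuclideanSpace ℝ (Fin N) → ℝ := fun x => S (v (t, x) - z x) with hw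
  set G : EuclideanSpace ℝ (Fin N) → EuclideanSpace ℝ (Fin N) :=
    fun x => deriv S (v (t, x) - z x) • (Dv (t, x) - Dz x) with hG
  have hwb : ∃ C, ∀ x, |w x| ≤ C := ⟨1, fun x => hS.abs_le _⟩
  have hmv : ∀ s, Measurable fun x => v (s, x) := fun s => h.measurable.comp measurable_prodMk_left
  set R : ℝ → ℝ := fun r => ∫ x in Ω, (F (r, x) * w x - inner ℝ (a (r, x)) (G x)) with hR
  have hRi : IntegrableOn R (Ioo 0 M) :=
    (integrable_test_integrand hm h.measurable_source hCF h.memLp_flux h3).integral_prod_left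
  have hRE : ∀ σ, ∫ x in Ω, ((Ioo 0 M ×ˢ Ω).indicator F (t - σ, x) * w x -
      inner ℝ ((Ioo 0 M ×ˢ Ω).indicator a (t - σ, x)) (G x)) =
      (Ioo 0 M).indicator R (t - σ) := by
    intro σ
    by_cases hσ : t - σ ∈ Ioo 0 M
    · rw [indicator_of_mem hσ]
      refine setIntegral_congr_fun hΩ fun x hx => ?_
      have : (t - σ, x) ∈ Ioo 0 M ×ˢ Ω := ⟨hσ, hx⟩
      simp only [indicator_of_mem this]
    · rw [indicator_of_notMem hσ]
      refine setIntegral_eq_zero_of_forall_eq_zero fun x hx => ?_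
      have : (t - σ, x) ∉ Ioo 0 M ×ˢ Ω := fun h' => hσ h'.1
      simp only [indicator_of_notMem this, zero_mul, inner_zero_left, sub_zero]
  refine le_trans ?_ (le_of_eq (integral_congr_ae (ae_of_all _ hRE)).symm)
  rw [integral_indicator_comp_sub hRi ht hk, ← h1 w G h3 hwb, relEntropy, indicator_of_mem ht]
  by_cases hs : t - k ∈ Ioo 0 M
  · rw [indicator_of_mem hs, ← h2 hs w G h3 hwb]
    have i : ∀ s, Integrable (fun x => (α (v (s, x)) - α (v₀ x)) * w x) (volume.restrict Ω) := by
      intro s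
      obtain ⟨A, hA⟩ := exists_abs_comp_le hα (fun x => hC (s, x))
      obtain ⟨B, hB⟩ := exists_abs_comp_le hα hC₀
      refine Integrable.of_bound (C := A + B) ?_ (ae_of_all _ fun x => ?_)
      · exact (((hα.measurable.comp (hmv s)).sub (hα.measurable.comp
          h.measurable_initial)).mul (hS.contDiff.continuous.measurable.comp
          ((hmv t).sub hzm))).aestronglyMeasurable
      · rw [norm_mul]
        refine (mul_le_of_le_one_right (norm_nonneg _) (hS.abs_le _)).trans ?_
        exact (abs_sub _ _).trans (add_le_add (hA x) (hB x))
    rw [← integral_sub (i t) (i (t - k))]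
    have := integral_entropy_sub_le (μ := volume.restrict Ω) hS hα hmono (hmv t) (hmv (t - k)) hzm
      (fun x => hC _) (fun x => hC _) hzC
    refine le_trans (le_of_eq (by ring)) (this.trans (le_of_eq ?_))
    congr 1 with x
    simp only [hw]; ring
  · rw [indicator_of_notMem hs, sub_zero]
    -- Before time 0 the extended relative entropy is zero and `v₀` plays the role of `v(t - k, ·)`.
    have h0 : t - k ≤ 0 := not_lt.1 fun h' => hs ⟨h', by linarith [ht.2]⟩
    rw [Ioo_eq_empty (not_lt.2 h0), Measure.restrict_empty, integral_zero_measure, sub_zero]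
    exact integral_entropy_sub_le (μ := volume.restrict Ω) hS hα hmono (hmv t)
      h.measurable_initial hzm (fun x => hC _) hC₀ hzC

end EntropyInequality

section EntropyInequality

variable {N : ℕ} {Ω : Set (EuclideanSpace ℝ (Fin N))} {M m : ℝ} {S α : ℝ → ℝ}
  {v₀ : EuclideanSpace ℝ (Fin N) → ℝ} {v : ℝ × EuclideanSpace ℝ (Fin N) → ℝ}
  {Dv a : ℝ × EuclideanSpace ℝ (Fin N) → EuclideanSpace ℝ (Fin N)}
  {F : ℝ × EuclideanSpace ℝ (Fin N) → ℝ} {z : EuclideanSpace ℝ (Fin N) → ℝ}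
  {Dz : EuclideanSpace ℝ (Fin N) → EuclideanSpace ℝ (Fin N)}

lemma cylMeasure_le_volume : cylMeasure Ω M ≤ volume := by
  rw [cylMeasure_eq_restrict]
  exact Measure.restrict_le_self

lemma memLp_indicator_cyl {E : Type*} [NormedAddCommGroup E] (hΩ : MeasurableSet Ω) {p : ℝ≥0∞}
    {g : ℝ × EuclideanSpace ℝ (Fin N) → E} (hg : MemLp g p (cylMeasure Ω M)) :
    MemLp ((Ioo 0 M ×ˢ Ω).indicator g) p volume := by
  rw [memLp_indicator_iff_restrict (measurableSet_Ioo.prod hΩ), ← cylMeasure_eq_restrict]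
  exact hg

lemma ae_mem_cyl (hΩ : MeasurableSet Ω) : ∀ᵐ p ∂(cylMeasure Ω M), p ∈ Ioo 0 M ×ˢ Ω := by
  rw [cylMeasure_eq_restrict]
  exact ae_restrict_mem (measurableSet_Ioo.prod hΩ)

lemma IsEvolution.memLp_sub_grad
    (h : IsEvolution Ω M m α v₀ v Dv a F) (hz : IsW0 Ω m z Dz) :
    MemLp (fun p : ℝ × EuclideanSpace ℝ (Fin N) => Dv p - Dz p.2) (ENNReal.ofReal m)
      (cylMeasure Ω M) :=
  h.memLp_grad.sub (hz.memLp_grad.comp_snd (volume.restrict (Ioo 0 M)))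

/-- Entropy inequality for a solution relative to a time-independent function. -/
lemma IsEvolution.entropy_inequality [IsFiniteMeasure (volume.restrict Ω)]
    (hΩ : MeasurableSet Ω) (hm : 1 < m)
    (h : IsEvolution Ω M m α v₀ v Dv a F) (hα : Continuous α) (hmono : Monotone α)
    (hS : SignLike S) (hz : IsW0 Ω m z Dz) (hzm : Measurable z) {Cz : ℝ} (hzC : ∀ x, |z x| ≤ Cz)
    {χ χ' : ℝ → ℝ} (hχ : ∀ t, HasDerivAt χ (χ' t) t) (hχ' : Continuous χ')
    (hχ0 : ∀ t, 0 ≤ χ t) (hχM : ∀ t, M ≤ t → χ t = 0) :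
    -∫ t in Ioo 0 M, χ' t *
        ((∫ x in Ω, entropy S α (v (t, x)) (z x)) -
          ∫ x in Ω, entropy S α (v₀ x) (z x)) ≤
      ∫ p, χ p.1 * (F p * S (v p - z p.2) -
        inner ℝ (a p) (deriv S (v p - z p.2) • (Dv p - Dz p.2))) ∂(cylMeasure Ω M) := by
  have hcj := holderConjugate_ofReal hm
  have hm' : 1 < m / (m - 1) := (Real.HolderConjugate.conjExponent hm).symm.lt
  obtain ⟨C₀, hC₀⟩ := h.bounded_initial
  obtain ⟨C, hC⟩ := h.bounded
  obtain ⟨CF, hCF⟩ := h.bounded_source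
  obtain ⟨L, hL⟩ := hS.deriv_le
  have hχc : Continuous χ := continuous_iff_continuousAt.2 fun t => (hχ t).continuousAt
  have hSc := hS.contDiff.continuous
  have hS'c := hS.continuous_deriv
  obtain ⟨B, hB⟩ := (isCompact_Icc (a := (0 : ℝ)) (b := M)).exists_bound_of_continuousOn
    hχc.continuousOn
  have hBT : ∀ᵐ t ∂(volume.restrict (Ioo 0 M)), ‖χ t‖ ≤ B := by
    filter_upwards [ae_restrict_mem measurableSet_Ioo] with t ht
    exact hB t (Ioo_subset_Icc_self ht)
  have hBQ : ∀ᵐ p ∂(cylMeasure Ω M), ‖χ p.1‖ ≤ B := Measure.quasiMeasurePreserving_fst.ae hBT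
  have hmvz : Measurable fun p : ℝ × EuclideanSpace ℝ (Fin N) => v p - z p.2 :=
    h.measurable.sub (hzm.comp measurable_snd)
  set FE := (Ioo 0 M ×ˢ Ω).indicator F with hFE
  set aE := (Ioo 0 M ×ˢ Ω).indicator a with haE
  set w : ℝ × EuclideanSpace ℝ (Fin N) → ℝ := fun p => χ p.1 * S (v p - z p.2) with hw
  set G : ℝ × EuclideanSpace ℝ (Fin N) → EuclideanSpace ℝ (Fin N) :=
    fun p => χ p.1 • deriv S (v p - z p.2) • (Dv p - Dz p.2) with hG
  have hwm : Measurable w :=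
    (hχc.measurable.comp measurable_fst).mul (hSc.measurable.comp hmvz)
  have hwLp : MemLp w (ENNReal.ofReal m) (cylMeasure Ω M) := by
    refine MemLp.of_bound hwm.aestronglyMeasurable B ?_
    filter_upwards [hBQ] with p hp
    rw [norm_mul]
    exact (mul_le_of_le_one_right (norm_nonneg _) (hS.abs_le _)).trans hp
  have hGLp : MemLp G (ENNReal.ofReal m) (cylMeasure Ω M) :=
    memLp_smul_of_bound (hχc.comp continuous_fst).aestronglyMeasurable hBQ
      (memLp_smul_of_bound (hS'c.measurable.comp hmvz).aestronglyMeasurable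
        (ae_of_all _ fun p => hL _) (h.memLp_sub_grad hz))
  have hFELp : MemLp FE (ENNReal.ofReal (m / (m - 1))) volume :=
    memLp_indicator_cyl hΩ (MemLp.of_bound h.measurable_source.aestronglyMeasurable CF
      (ae_of_all _ hCF))
  have haELp : MemLp aE (ENNReal.ofReal (m / (m - 1))) volume :=
    memLp_indicator_cyl hΩ h.memLp_flux
  have hq1 : 1 ≤ ENNReal.ofReal (m / (m - 1)) := by
    rw [ENNReal.one_le_ofReal]; exact hm'.le
  have hK1 := continuous_integral_inner_timeShift (p := ENNReal.ofReal m) hq1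
    ENNReal.ofReal_ne_top (cylMeasure_le_volume (Ω := Ω) (M := M)) hFELp hwLp
  have hK2 := continuous_integral_inner_timeShift (p := ENNReal.ofReal m) hq1
    ENNReal.ofReal_ne_top (cylMeasure_le_volume (Ω := Ω) (M := M)) haELp hGLp
  -- The right side divided by `k` is the average over `(0, k)` of a continuous function of the
  -- shift, so it tends to the value at `σ = 0`, where flux and test function sit at the same time.
  have hav := tendsto_average_of_continuous (hK1.sub hK2)
  have hfin : ∀ σ : ℝ, MemLp (fun p => FE (timeShift σ p)) (ENNReal.ofReal (m / (m - 1)))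
      (cylMeasure Ω M) := fun σ =>
    (hFELp.comp_measurePreserving (measurePreserving_timeShift σ)).mono_measure
      cylMeasure_le_volume
  have hain : ∀ σ : ℝ, MemLp (fun p => aE (timeShift σ p)) (ENNReal.ofReal (m / (m - 1)))
      (cylMeasure Ω M) := fun σ =>
    (haELp.comp_measurePreserving (measurePreserving_timeShift σ)).mono_measure
      cylMeasure_le_volume
  have hK : ∀ σ, (∫ p, inner ℝ (FE (timeShift σ p)) (w p) ∂(cylMeasure Ω M)) -
      ∫ p, inner ℝ (aE (timeShift σ p)) (G p) ∂(cylMeasure Ω M) =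
      ∫ p, (inner ℝ (FE (timeShift σ p)) (w p) - inner ℝ (aE (timeShift σ p)) (G p))
        ∂(cylMeasure Ω M) := fun σ =>
    (integral_sub (integrable_inner_of_memLp (hfin σ) hwLp)
      (integrable_inner_of_memLp (hain σ) hGLp)).symm
  have hI : ∀ k : ℝ, Integrable (fun q : ℝ × (ℝ × EuclideanSpace ℝ (Fin N)) =>
      inner ℝ (FE (timeShift q.1 q.2)) (w q.2) - inner ℝ (aE (timeShift q.1 q.2)) (G q.2))
      ((volume.restrict (Ioc 0 k)).prod (cylMeasure Ω M)) := fun k =>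
    (integrable_inner_of_memLp (memLp_timeShift_uncurry hFELp k _ cylMeasure_le_volume)
      (hwLp.comp_snd (volume.restrict (Ioc 0 k)))).sub
    (integrable_inner_of_memLp (memLp_timeShift_uncurry haELp k _ cylMeasure_le_volume)
      (hGLp.comp_snd (volume.restrict (Ioc 0 k))))
  set D := relEntropy Ω M S α v₀ v z with hDdef
  have hDm : Measurable D :=
    ((measurable_integral_entropy hS hα h.measurable hzm).sub_const _).indicator measurableSet_Ioo
  obtain ⟨CD, hCD⟩ : ∃ CD, ∀ t, |D t| ≤ CD := by
    obtain ⟨C₁, h₁⟩ := exists_abs_entropy_le hS hα hmono (C₁ := C) (C₂ := Cz)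
    obtain ⟨C₂, h₂⟩ := exists_abs_entropy_le hS hα hmono (C₁ := C₀) (C₂ := Cz)
    refine ⟨|C₁ * (volume.restrict Ω).real univ + C₂ * (volume.restrict Ω).real univ|,
      fun t => ?_⟩
    by_cases ht : t ∈ Ioo 0 M
    · rw [hDdef, relEntropy, indicator_of_mem ht]
      refine ((abs_sub _ _).trans (add_le_add ?_ ?_)).trans (le_abs_self _)
      · exact abs_integral_le_of_bound fun x => h₁ _ _ (hC _) (hzC x)
      · exact abs_integral_le_of_bound fun x => h₂ _ _ (hC₀ _) (hzC x)
    · rw [hDdef, relEntropy, indicator_of_notMem ht, abs_zero]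
      exact abs_nonneg _
  have hlim := tendsto_backward_difference hDm hCD
    (fun t ht => indicator_of_notMem ht _) hχ hχ' hχM
  have hle : ∀ k : ℝ, 0 < k → ∫ t in Ioo 0 M, χ t * (D t - D (t - k)) ≤
      ∫ σ in Ioc 0 k, ((∫ p, inner ℝ (FE (timeShift σ p)) (w p) ∂(cylMeasure Ω M)) -
        ∫ p, inner ℝ (aE (timeShift σ p)) (G p) ∂(cylMeasure Ω M)) := by
    intro k hk
    simp_rw [hK]
    rw [cylMeasure, ← integral_integral_swap_triple (hI k)]
    have hmL : Measurable fun t => χ t * (D t - D (t - k)) :=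
      hχc.measurable.mul (hDm.sub (hDm.comp (measurable_sub_const k)))
    refine integral_mono_ae ?_ (integrable_integral_triple (hI k)) ?_
    · refine Integrable.of_bound hmL.aestronglyMeasurable (B * (CD + CD)) ?_
      filter_upwards [hBT] with t ht
      rw [norm_mul]
      exact mul_le_mul ht ((abs_sub _ _).trans (add_le_add (hCD _) (hCD _))) (norm_nonneg _)
        ((norm_nonneg _).trans ht)
    · filter_upwards [h.backward_entropy_le hΩ hm hα hmono hS hz hzm hzC hk] with t ht
      refine (mul_le_mul_of_nonneg_left ht (hχ0 t)).trans (le_of_eq ?_)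
      simp_rw [← integral_const_mul]
      refine integral_congr_ae (ae_of_all _ fun σ => integral_congr_ae (ae_of_all _ fun x => ?_))
      simp only [hw, hG, timeShift, inner_smul_right, RCLike.inner_apply, conj_trivial]
      ring
  have hfinal := le_of_tendsto_of_tendsto hlim hav (by
    filter_upwards [self_mem_nhdsWithin] with k hk
    exact mul_le_mul_of_nonneg_left (hle k hk) (inv_nonneg.2 (le_of_lt hk)))
  have e1 : ∫ t in Ioo 0 M, χ' t * D t = ∫ t in Ioo 0 M, χ' t *
      ((∫ x in Ω, entropy S α (v (t, x)) (z x)) - ∫ x in Ω, entropy S α (v₀ x) (z x)) := by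
    refine setIntegral_congr_fun measurableSet_Ioo fun t ht => ?_
    simp only [hDdef, relEntropy, indicator_of_mem ht]
  rw [Pi.sub_apply, hK, e1] at hfinal
  refine hfinal.trans (le_of_eq (integral_congr_ae ?_))
  filter_upwards [ae_mem_cyl hΩ] with p hp
  have : timeShift 0 p = p := by simp [timeShift]
  simp only [this, hFE, haE, indicator_of_mem hp, hw, hG, inner_smul_right, RCLike.inner_apply,
    conj_trivial]
  ring

end EntropyInequality

/-! ### Smooth approximation of the initial datum. -/

section Density

variable {N : ℕ} {Ω : Set (EuclideanSpace ℝ (Fin N))}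

open scoped Manifold in
lemma exists_smooth_cutoff {K : Set (EuclideanSpace ℝ (Fin N))} (hK : IsCompact K)
    (hΩ : IsOpen Ω) (hKΩ : K ⊆ Ω) : ∃ θ : EuclideanSpace ℝ (Fin N) → ℝ, ContDiff ℝ ∞ θ ∧
      HasCompactSupport θ ∧ tsupport θ ⊆ Ω ∧ (∀ x, 0 ≤ θ x ∧ θ x ≤ 1) ∧ ∀ x ∈ K, θ x = 1 := by
  obtain ⟨δ, hδ, hδΩ⟩ := hK.exists_cthickening_subset_open hΩ hKΩ
  obtain ⟨θ, h1, h2, h3, h4⟩ := exists_contMDiff_support_eq_eq_one_iff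
    𝓘(ℝ, EuclideanSpace ℝ (Fin N)) (Metric.isOpen_thickening (δ := δ) (E := K)) hK.isClosed
    (Metric.self_subset_thickening hδ K)
  have hts : tsupport θ ⊆ Metric.cthickening δ K := by
    rw [tsupport, h3]
    exact Metric.closure_thickening_subset_cthickening δ K
  exact ⟨θ, h1.contDiff, hK.cthickening.of_isClosed_subset (isClosed_tsupport θ) hts,
    hts.trans hδΩ, fun x => h2 (mem_range_self x), fun x hx => (h4 x).1 hx⟩

/-- `C_c^∞(Ω)` is dense in `L^1(Ω)`, for bounded functions. -/
lemma exists_test_function_near (hΩ : IsOpen Ω) (hfin : volume Ω ≠ ⊤)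
    {g : EuclideanSpace ℝ (Fin N) → ℝ} (hg : Measurable g) {C : ℝ} (hC : ∀ x, |g x| ≤ C)
    {ε : ℝ} (hε : 0 < ε) : ∃ z : EuclideanSpace ℝ (Fin N) → ℝ, ContDiff ℝ ∞ z ∧
      HasCompactSupport z ∧ tsupport z ⊆ Ω ∧ ∫ x in Ω, |g x - z x| ≤ ε := by
  have : IsFiniteMeasure (volume.restrict Ω) := ⟨by simpa using hfin.lt_top⟩
  have hC0 : 0 ≤ C := (abs_nonneg _).trans (hC 0)
  obtain ⟨K, hKΩ, hK, hKlt⟩ := hΩ.measurableSet.exists_isCompact_sdiff_lt hfin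
    (ε := ENNReal.ofReal (ε / (2 * (C + 1)))) (by simpa using (by positivity))
  obtain ⟨θ, hθ, hθc, hθΩ, hθ01, hθK⟩ := exists_smooth_cutoff hK hΩ hKΩ
  have hgi : Integrable g (volume.restrict Ω) :=
    Integrable.of_bound hg.aestronglyMeasurable C (ae_of_all _ hC)
  obtain ⟨ψ, hψc, hψ, hψε⟩ := (memLp_one_iff_integrable.2 hgi).exist_eLpNorm_sub_le
    ENNReal.one_ne_top le_rfl (half_pos hε)
  have hψi : Integrable ψ (volume.restrict Ω) :=
    (hψ.continuous.integrable_of_hasCompactSupport hψc).restrict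
  have hz : ContDiff ℝ ∞ fun x => θ x * ψ x := hθ.mul hψ
  have hzc : HasCompactSupport fun x => θ x * ψ x := hθc.mul_right
  refine ⟨fun x => θ x * ψ x, hz, hzc,
    (closure_mono (Function.support_mul_subset_left θ ψ)).trans hθΩ, ?_⟩
  have h1 : ∫ x in Ω, |g x - ψ x| ≤ ε / 2 := by
    have e : eLpNorm (g - ψ) 1 (volume.restrict Ω) =
        ENNReal.ofReal (∫ x in Ω, ‖g x - ψ x‖) := by
      rw [eLpNorm_one_eq_lintegral_enorm]
      exact (ofReal_integral_norm_eq_lintegral_enorm (hgi.sub hψi)).symm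
    rw [e, ENNReal.ofReal_le_ofReal_iff (half_pos hε).le] at hψε
    exact hψε
  -- From `g - θψ = θ(g - ψ) + (1 - θ)g`, where the last term lives on `Ω \ K` and is at most `C`.
  have h2 : ∀ x ∈ Ω, |g x - θ x * ψ x| ≤ |g x - ψ x| + (Ω \ K).indicator (fun _ => C) x := by
    intro x hx
    by_cases hxK : x ∈ K
    · rw [hθK x hxK, one_mul]
      exact le_add_of_nonneg_right (indicator_nonneg (fun _ _ => hC0) x)
    · rw [indicator_of_mem (show x ∈ Ω \ K from ⟨hx, hxK⟩)]
      have e : g x - θ x * ψ x = θ x * (g x - ψ x) + (1 - θ x) * g x := by ring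
      rw [e]
      refine (abs_add_le _ _).trans (add_le_add ?_ ?_)
      · rw [abs_mul, abs_of_nonneg (hθ01 x).1]
        exact mul_le_of_le_one_left (abs_nonneg _) (hθ01 x).2
      · rw [abs_mul, abs_of_nonneg (sub_nonneg.2 (hθ01 x).2)]
        exact (mul_le_of_le_one_left (abs_nonneg _) (by linarith [(hθ01 x).1])).trans (hC x)
  have hmK : MeasurableSet (Ω \ K) := hΩ.measurableSet.diff hK.measurableSet
  have i3 : Integrable ((Ω \ K).indicator fun _ => C) (volume.restrict Ω) :=
    (integrable_const C).indicator hmK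
  have h3 : ∫ x in Ω, (Ω \ K).indicator (fun _ => C) x ≤ ε / 2 := by
    rw [integral_indicator hmK, Measure.restrict_restrict hmK,
      inter_eq_left.2 sdiff_subset, setIntegral_const, smul_eq_mul]
    have h4 : volume.real (Ω \ K) ≤ ε / (2 * (C + 1)) :=
      ENNReal.toReal_le_of_le_ofReal (by positivity) hKlt.le
    calc _ ≤ ε / (2 * (C + 1)) * C := mul_le_mul_of_nonneg_right h4 hC0
      _ ≤ ε / 2 := by
        rw [div_mul_eq_mul_div, div_le_div_iff₀ (by positivity) (by positivity)]
        nlinarith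
  have hzi : Integrable (fun x => θ x * ψ x) (volume.restrict Ω) :=
    (hz.continuous.integrable_of_hasCompactSupport hzc).restrict
  calc ∫ x in Ω, |g x - θ x * ψ x|
      ≤ ∫ x in Ω, (|g x - ψ x| + (Ω \ K).indicator (fun _ => C) x) :=
        setIntegral_mono_on (hgi.sub hzi).abs ((hgi.sub hψi).abs.add i3) hΩ.measurableSet h2
    _ = (∫ x in Ω, |g x - ψ x|) + ∫ x in Ω, (Ω \ K).indicator (fun _ => C) x :=
        integral_add (hgi.sub hψi).abs i3
    _ ≤ ε := by linarith

end Density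

/-! ### One-sided mollifiers in time. -/

section Mollifier

/-- A continuous probability density supported in `(0, δ)`. -/
structure IsMollifier (δ : ℝ) (ρ : ℝ → ℝ) : Prop where
  continuous : Continuous ρ
  nonneg : ∀ t, 0 ≤ ρ t
  eq_zero : ∀ t, t ∉ Ioo 0 δ → ρ t = 0
  integral_eq_one : ∫ t, ρ t = 1

variable {δ : ℝ} {ρ : ℝ → ℝ}

lemma IsMollifier.integrable (h : IsMollifier δ ρ) : Integrable ρ := by
  by_contra hn
  have := h.integral_eq_one
  rw [integral_undef hn] at this
  exact zero_ne_one this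

lemma IsMollifier.setIntegral_eq_one (h : IsMollifier δ ρ) {M : ℝ} (hM : δ ≤ M) :
    ∫ t in Ioo 0 M, ρ t = 1 := by
  have : ∀ t, t ∉ Ioo 0 M → ρ t = 0 := fun t ht =>
    h.eq_zero t fun h' => ht ⟨h'.1, h'.2.trans_le hM⟩
  rw [setIntegral_eq_integral_of_forall_compl_eq_zero this, h.integral_eq_one]

lemma exists_isMollifier_contDiff (hδ : 0 < δ) : ∃ ρ, IsMollifier δ ρ ∧ ContDiff ℝ ∞ ρ := by
  let b : ContDiffBump (δ / 2) := ⟨δ / 8, δ / 4, by linarith, by linarith⟩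
  refine ⟨b.normed volume, ⟨b.continuous_normed, b.nonneg_normed, fun t ht => ?_,
    b.integral_normed⟩, b.contDiff_normed⟩
  have : t ∉ Function.support (b.normed volume) := by
    rw [b.support_normed_eq, Real.ball_eq_Ioo]
    intro h
    have h1 : δ / 2 - δ / 4 < t := h.1
    have h2 : t < δ / 2 + δ / 4 := h.2
    exact ht ⟨by linarith, by linarith⟩
  simpa using this

end Mollifier

/-! ### Attainment of the initial datum. -/

section InitialContinuity

variable {N : ℕ} {Ω : Set (EuclideanSpace ℝ (Fin N))} {M m : ℝ} {α : ℝ → ℝ}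
  {v₀ : EuclideanSpace ℝ (Fin N) → ℝ} {v : ℝ × EuclideanSpace ℝ (Fin N) → ℝ}
  {Dv a : ℝ × EuclideanSpace ℝ (Fin N) → EuclideanSpace ℝ (Fin N)}
  {F : ℝ × EuclideanSpace ℝ (Fin N) → ℝ}

lemma tendsto_integral_initial_layer {I : ℝ × EuclideanSpace ℝ (Fin N) → ℝ}
    (hI : Integrable I (cylMeasure Ω M)) :
    Tendsto (fun δ : ℝ => ∫ p, {p : ℝ × EuclideanSpace ℝ (Fin N) | p.1 < δ}.indicator
      (fun p => |I p|) p ∂(cylMeasure Ω M)) (𝓝[>] 0) (𝓝 0) := by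
  have h0 : ∀ᵐ p ∂(cylMeasure Ω M), 0 < p.1 := by
    have : ∀ᵐ t ∂(volume.restrict (Ioo 0 M)), 0 < t :=
      (ae_restrict_mem measurableSet_Ioo).mono fun t ht => ht.1
    exact Measure.quasiMeasurePreserving_fst.ae this
  have hms : ∀ δ : ℝ, MeasurableSet {p : ℝ × EuclideanSpace ℝ (Fin N) | p.1 < δ} := fun δ =>
    measurableSet_lt measurable_fst measurable_const
  rw [show (0 : ℝ) = ∫ _, (0 : ℝ) ∂(cylMeasure Ω M) by simp]
  refine tendsto_integral_filter_of_dominated_convergence (fun p => |I p|) ?_ ?_ hI.abs ?_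
  · exact Eventually.of_forall fun δ => hI.abs.1.indicator (hms δ)
  · refine Eventually.of_forall fun δ => ae_of_all _ fun p => ?_
    exact (norm_indicator_le_norm_self (fun p => |I p|) p).trans (le_of_eq (abs_abs _))
  · filter_upwards [h0] with p hp
    refine tendsto_const_nhds.congr' ?_
    simp only [integral_zero]
    filter_upwards [Ioo_mem_nhdsGT hp] with δ hδ
    have hn : p ∉ {p : ℝ × EuclideanSpace ℝ (Fin N) | p.1 < δ} := fun h =>
      absurd hδ.2 (not_lt.2 (le_of_lt h))
    rw [indicator_of_notMem hn]

lemma integrable_abs_comp_sub {X : Type*} [MeasurableSpace X] {μ : Measure X} [IsFiniteMeasure μ]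
    (hα : Continuous α) {p q : X → ℝ} (hp : Measurable p) (hq : Measurable q) {C₁ C₂ : ℝ}
    (hp' : ∀ x, |p x| ≤ C₁) (hq' : ∀ x, |q x| ≤ C₂) :
    Integrable (fun x => |α (p x) - α (q x)|) μ := by
  obtain ⟨A, hA⟩ := exists_abs_comp_le hα hp'
  obtain ⟨B, hB⟩ := exists_abs_comp_le hα hq'
  refine Integrable.of_bound (C := A + B) ?_ (ae_of_all _ fun x => ?_)
  · exact ((hα.measurable.comp hp).sub (hα.measurable.comp hq)).abs.aestronglyMeasurable
  · rw [Real.norm_of_nonneg (abs_nonneg _)]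
    exact (abs_sub _ _).trans (add_le_add (hA x) (hB x))

/-- The initial datum is attained in `L^1`, on average. -/
lemma IsEvolution.initial_continuity [IsFiniteMeasure (volume.restrict Ω)]
    (hΩ : IsOpen Ω) (hm : 1 < m) (hM : 0 < M)
    (h : IsEvolution Ω M m α v₀ v Dv a F) {K : ℝ≥0} (hα : LipschitzWith K α)
    (hmono : Monotone α) {ε : ℝ} (hε : 0 < ε) :
    ∃ δ₀ > 0, ∀ δ ∈ Ioc 0 δ₀, ∀ ρ, IsMollifier δ ρ →
      ∫ t in Ioo 0 M, ρ t * ∫ x in Ω, |α (v (t, x)) - α (v₀ x)| ≤ ε := by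
  obtain ⟨C₀, hC₀⟩ := h.bounded_initial
  obtain ⟨C, hC⟩ := h.bounded
  obtain ⟨CF, hCF⟩ := h.bounded_source
  have hαc := hα.continuous
  set V := (volume.restrict Ω).real univ with hV
  have hV0 : 0 ≤ V := measureReal_nonneg
  -- Error budget: `2 K ε₁` for replacing `v₀` by `z` twice (in `L^1` and in the initial entropy),
  -- and `2 K ε₁ V` for replacing `|α(v) - α(z)|` by the entropy.
  obtain ⟨ε₁, hε₁, hε₁'⟩ : ∃ ε₁ > 0, 2 * K * ε₁ + 2 * K * ε₁ * V ≤ ε / 2 := by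
    refine ⟨ε / (2 * (2 * K + 2 * K * V + 1)), by positivity, ?_⟩
    have hc : (0 : ℝ) ≤ 2 * K + 2 * K * V := by positivity
    have e : 2 * K * (ε / (2 * (2 * K + 2 * K * V + 1))) +
        2 * K * (ε / (2 * (2 * K + 2 * K * V + 1))) * V =
        (2 * K + 2 * K * V) * ε / (2 * (2 * K + 2 * K * V + 1)) := by ring
    rw [e, div_le_div_iff₀ (by positivity) (by norm_num)]
    nlinarith
  have hΩfin : volume Ω ≠ ⊤ := by
    simpa using measure_ne_top (volume.restrict Ω) univ
  -- The datum is merely bounded, so it cannot serve as comparison function; a nearby test function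
  -- can.
  obtain ⟨z, hz, hzc, hzΩ, hzε⟩ := exists_test_function_near hΩ hΩfin h.measurable_initial hC₀ hε₁
  have hzW : IsW0 Ω m z (gradient z) := IsW0.of_contDiff hz hzc hzΩ
  obtain ⟨Cz, hCz⟩ := hz.continuous.bounded_above_of_compact_support hzc
  have hzm := hz.continuous.measurable
  have hS := signLike_softSign hε₁
  obtain ⟨L, hL⟩ := hS.deriv_le
  set I : ℝ × EuclideanSpace ℝ (Fin N) → ℝ := fun p => F p * softSign ε₁ (v p - z p.2) -
    inner ℝ (a p) (deriv (softSign ε₁) (v p - z p.2) • (Dv p - gradient z p.2)) with hI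
  have hcj := holderConjugate_ofReal hm
  have hmvz : Measurable fun p : ℝ × EuclideanSpace ℝ (Fin N) => v p - z p.2 :=
    h.measurable.sub (hzm.comp measurable_snd)
  have hIi : Integrable I (cylMeasure Ω M) := by
    refine Integrable.sub ?_ (integrable_inner_of_memLp h.memLp_flux
      (memLp_smul_of_bound (hS.continuous_deriv.measurable.comp hmvz).aestronglyMeasurable
        (ae_of_all _ fun p => hL _) (h.memLp_sub_grad hzW)))
    refine Integrable.of_bound (C := CF) (h.measurable_source.mul
      (hS.contDiff.continuous.measurable.comp hmvz)).aestronglyMeasurable (ae_of_all _ fun p => ?_)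
    rw [norm_mul]
    exact (mul_le_of_le_one_right (norm_nonneg _) (hS.abs_le _)).trans (hCF p)
  have htail := (tendsto_order.1 (tendsto_integral_initial_layer hIi)).2 (ε / 2) (half_pos hε)
  obtain ⟨δ₁, hδ₁, hδ₁'⟩ := mem_nhdsGT_iff_exists_Ioc_subset.1 htail
  refine ⟨min δ₁ M, lt_min hδ₁ hM, fun δ hδ ρ hρ => ?_⟩
  have hδM : δ ≤ M := hδ.2.trans (min_le_right _ _)
  have hδtail := hδ₁' ⟨hδ.1, hδ.2.trans (min_le_left _ _)⟩
  -- A cutoff with `χ' = -ρ`, at most 1 and zero from `δ` on: the entropy inequality then bounds the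
  -- `ρ`-average of the entropy growth by the integral of `|I|` over the layer `t < δ`.
  set χ : ℝ → ℝ := fun t => ∫ s in t..M, ρ s with hχdef
  have hχ : ∀ t, HasDerivAt χ (-ρ t) t := fun t =>
    intervalIntegral.integral_hasDerivAt_left (hρ.continuous.intervalIntegrable _ _)
      (hρ.continuous.stronglyMeasurableAtFilter _ _) hρ.continuous.continuousAt
  have hχz : ∀ t, δ ≤ t → χ t = 0 := fun t ht => by
    refine (intervalIntegral.integral_congr (g := fun _ => 0) fun s hs => ?_).trans (by simp)
    refine hρ.eq_zero s fun h' => ?_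
    rcases le_total t M with hc | hc
    · rw [uIcc_of_le hc] at hs; linarith [hs.1, h'.2]
    · rw [uIcc_of_ge hc] at hs; linarith [hs.1, h'.2]
  have hχ0 : ∀ t, 0 ≤ χ t := fun t => by
    rcases le_total t M with hc | hc
    · exact intervalIntegral.integral_nonneg hc fun s _ => hρ.nonneg s
    · rw [hχz t (hδM.trans hc)]
  have hχ1 : ∀ t, χ t ≤ 1 := fun t => by
    rcases le_total t M with hc | hc
    · rw [hχdef, ← hρ.integral_eq_one]
      simp only [intervalIntegral.integral_of_le hc]
      exact setIntegral_le_integral hρ.integrable (ae_of_all _ hρ.nonneg)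
    · rw [hχz t (hδM.trans hc)]; exact zero_le_one
  have hent := h.entropy_inequality hΩ.measurableSet hm hαc hmono hS hzW hzm hCz hχ
    hρ.continuous.neg hχ0 (fun t ht => hχz t (hδM.trans ht))
  have hχc : Continuous χ := continuous_iff_continuousAt.2 fun t => (hχ t).continuousAt
  have hrhs : ∫ p, χ p.1 * I p ∂(cylMeasure Ω M) ≤ ε / 2 := by
    refine le_trans (integral_mono (hIi.bdd_mul (c := 1)
      (hχc.comp continuous_fst).aestronglyMeasurable (ae_of_all _ fun p => ?_))
      (hIi.abs.indicator (measurableSet_lt measurable_fst (measurable_const (a := δ))))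
      fun p => ?_) (le_of_lt hδtail)
    · rw [Real.norm_of_nonneg (hχ0 _)]; exact hχ1 _
    · by_cases hp : p.1 < δ
      · rw [indicator_of_mem (show p ∈ {a : ℝ × EuclideanSpace ℝ (Fin N) | a.1 < δ} from hp)]
        refine (le_abs_self _).trans ?_
        rw [abs_mul, abs_of_nonneg (hχ0 _)]
        exact mul_le_of_le_one_left (abs_nonneg _) (hχ1 _)
      · rw [indicator_of_notMem (show p ∉ {a : ℝ × EuclideanSpace ℝ (Fin N) | a.1 < δ} from hp),
          hχz _ (not_lt.1 hp), zero_mul]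
  have hmv : ∀ t, Measurable fun x => v (t, x) := fun t => h.measurable.comp measurable_prodMk_left
  set P : ℝ → ℝ := fun t => (∫ x in Ω, entropy (softSign ε₁) α (v (t, x)) (z x)) -
    ∫ x in Ω, entropy (softSign ε₁) α (v₀ x) (z x) with hP
  have hKz : ∫ x in Ω, |α (v₀ x) - α (z x)| ≤ K * ε₁ := by
    have hi : Integrable (fun x => |v₀ x - z x|) (volume.restrict Ω) :=
      integrable_abs_comp_sub continuous_id h.measurable_initial hzm hC₀ hCz
    refine le_trans (integral_mono (integrable_abs_comp_sub hαc h.measurable_initial hzm hC₀ hCz)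
      (hi.const_mul (K : ℝ)) fun x => ?_) ?_
    · simpa [Real.dist_eq] using hα.dist_le_mul (v₀ x) (z x)
    · rw [integral_const_mul]
      exact mul_le_mul_of_nonneg_left hzε K.2
  have hY : ∀ t, ∫ x in Ω, |α (v (t, x)) - α (v₀ x)| ≤ P t + ε / 2 := by
    intro t
    have i1 : Integrable (fun x => |α (v (t, x)) - α (z x)|) (volume.restrict Ω) :=
      integrable_abs_comp_sub hαc (hmv t) hzm (fun x => hC _) hCz
    have i2 : Integrable (fun x => |α (v₀ x) - α (z x)|) (volume.restrict Ω) :=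
      integrable_abs_comp_sub hαc h.measurable_initial hzm hC₀ hCz
    have i3 : Integrable (fun x => |α (v (t, x)) - α (v₀ x)|) (volume.restrict Ω) :=
      integrable_abs_comp_sub hαc (hmv t) h.measurable_initial (fun x => hC _) hC₀
    have i4 : Integrable (fun x => entropy (softSign ε₁) α (v (t, x)) (z x)) (volume.restrict Ω) :=
      integrable_entropy_comp hS hαc hmono (hmv t) hzm (fun x => hC _) hCz
    have i5 : Integrable (fun x => entropy (softSign ε₁) α (v₀ x) (z x)) (volume.restrict Ω) :=
      integrable_entropy_comp hS hαc hmono h.measurable_initial hzm hC₀ hCz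
    have b1 : ∫ x in Ω, |α (v (t, x)) - α (v₀ x)| ≤
        (∫ x in Ω, |α (v (t, x)) - α (z x)|) + ∫ x in Ω, |α (v₀ x) - α (z x)| := by
      rw [← integral_add i1 i2]
      refine integral_mono i3 (i1.add i2) fun x => ?_
      rw [abs_sub_comm (α (v₀ x)) (α (z x))]
      exact abs_sub_le _ _ _
    have b2 : ∫ x in Ω, |α (v (t, x)) - α (z x)| ≤
        (∫ x in Ω, entropy (softSign ε₁) α (v (t, x)) (z x)) + 2 * K * ε₁ * V := by
      have : ∫ x in Ω, (entropy (softSign ε₁) α (v (t, x)) (z x) + 2 * K * ε₁) =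
          (∫ x in Ω, entropy (softSign ε₁) α (v (t, x)) (z x)) + 2 * K * ε₁ * V := by
        rw [integral_add i4 (integrable_const _), integral_const, smul_eq_mul, mul_comm V]
      rw [← this]
      refine integral_mono i1 (i4.add (integrable_const _)) fun x => ?_
      have := le_entropy_softSign hε₁ hα hmono (v (t, x)) (z x)
      linarith
    have b3 : ∫ x in Ω, entropy (softSign ε₁) α (v₀ x) (z x) ≤ ∫ x in Ω, |α (v₀ x) - α (z x)| :=
      integral_mono i5 i2 fun x => entropy_le hS hαc hmono _ _
    simp only [hP]
    linarith
  have hEi : Integrable (fun p : ℝ × EuclideanSpace ℝ (Fin N) =>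
      entropy (softSign ε₁) α (v p) (z p.2)) (cylMeasure Ω M) :=
    integrable_entropy_comp hS hαc hmono h.measurable (hzm.comp measurable_snd) hC
      fun p => hCz p.2
  have hPi : Integrable P (volume.restrict (Ioo 0 M)) :=
    (Integrable.integral_prod_left hEi).sub (integrable_const _)
  obtain ⟨B, hB⟩ := (isCompact_Icc (a := (0 : ℝ)) (b := M)).exists_bound_of_continuousOn
    hρ.continuous.continuousOn
  have hρB : ∀ᵐ t ∂(volume.restrict (Ioo 0 M)), ‖ρ t‖ ≤ B := by
    filter_upwards [ae_restrict_mem measurableSet_Ioo] with t ht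
    exact hB t (Ioo_subset_Icc_self ht)
  have j1 : Integrable (fun t => ρ t * P t) (volume.restrict (Ioo 0 M)) :=
    hPi.bdd_mul hρ.continuous.aestronglyMeasurable hρB
  have j2 : Integrable (fun t => ρ t * (ε / 2)) (volume.restrict (Ioo 0 M)) :=
    hρ.integrable.restrict.mul_const _
  have hfin : ∫ t in Ioo 0 M, ρ t * ∫ x in Ω, |α (v (t, x)) - α (v₀ x)| ≤
      ∫ t in Ioo 0 M, (ρ t * P t + ρ t * (ε / 2)) := by
    refine integral_mono_of_nonneg (ae_of_all _ fun t => mul_nonneg (hρ.nonneg t)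
      (integral_nonneg fun x => abs_nonneg _)) (j1.add j2) (ae_of_all _ fun t => ?_)
    simp only [← mul_add]
    exact mul_le_mul_of_nonneg_left (hY t) (hρ.nonneg t)
  rw [integral_add j1 j2, integral_mul_const, hρ.setIntegral_eq_one hδM] at hfin
  have hent' : ∫ t in Ioo 0 M, ρ t * P t ≤ ε / 2 := by
    refine le_trans (le_of_eq ?_) (hent.trans hrhs)
    rw [← integral_neg]
    congr 1 with t
    ring
  linarith

end InitialContinuity

/-! ### Doubling the time variable. -/

section Doubling

variable {N : ℕ} {Ω : Set (EuclideanSpace ℝ (Fin N))} {M m : ℝ} {S α : ℝ → ℝ}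

/-- The measure on `{(s, (t, x)) : s, t ∈ (0, M), x ∈ Ω}`. -/
noncomputable def doubleMeasure (Ω : Set (EuclideanSpace ℝ (Fin N))) (M : ℝ) :
    Measure (ℝ × (ℝ × EuclideanSpace ℝ (Fin N))) :=
  (volume.restrict (Ioo 0 M)).prod (cylMeasure Ω M)

instance isFiniteMeasure_doubleMeasure [IsFiniteMeasure (volume.restrict Ω)] :
    IsFiniteMeasure (doubleMeasure Ω M) := by
  unfold doubleMeasure
  infer_instance

/-- Exchange of the two time variables. -/
def swapTime {Y : Type*} [MeasurableSpace Y] : ℝ × (ℝ × Y) ≃ᵐ ℝ × (ℝ × Y) where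
  toFun q := (q.2.1, (q.1, q.2.2))
  invFun q := (q.2.1, (q.1, q.2.2))
  left_inv _ := rfl
  right_inv _ := rfl
  measurable_toFun := by dsimp; fun_prop
  measurable_invFun := by dsimp; fun_prop

lemma measurePreserving_swapTime :
    MeasurePreserving swapTime (doubleMeasure Ω M) (doubleMeasure Ω M) := by
  have h1 := measurePreserving_prodAssoc (volume.restrict (Ioo 0 M)) (volume.restrict (Ioo 0 M))
    (volume.restrict Ω)
  have h2 := (Measure.measurePreserving_swap (μ := volume.restrict (Ioo 0 M))
    (ν := volume.restrict (Ioo 0 M))).prod (MeasurePreserving.id (volume.restrict Ω))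
  exact h1.comp (h2.comp (h1.symm MeasurableEquiv.prodAssoc))

lemma ae_doubleMeasure_mem :
    ∀ᵐ q ∂(doubleMeasure Ω M), q.1 ∈ Ioo 0 M ∧ q.2.1 ∈ Ioo 0 M := by
  have h : ∀ᵐ t ∂(volume.restrict (Ioo 0 M)), t ∈ Ioo 0 M := ae_restrict_mem measurableSet_Ioo
  have h1 : ∀ᵐ q ∂(doubleMeasure Ω M), q.1 ∈ Ioo 0 M :=
    Measure.quasiMeasurePreserving_fst.ae h
  exact h1.and (measurePreserving_swapTime.quasiMeasurePreserving.ae h1)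

lemma integrable_kernel_mul {k : ℝ → ℝ → ℝ} (hk : Continuous fun q : ℝ × ℝ => k q.1 q.2)
    {g : ℝ × (ℝ × EuclideanSpace ℝ (Fin N)) → ℝ} (hg : Integrable g (doubleMeasure Ω M)) :
    Integrable (fun q => k q.1 q.2.1 * g q) (doubleMeasure Ω M) := by
  obtain ⟨B, hB⟩ := ((isCompact_Icc (a := (0 : ℝ)) (b := M)).prod
    (isCompact_Icc (a := (0 : ℝ)) (b := M))).exists_bound_of_continuousOn hk.continuousOn
  refine hg.bdd_mul (c := B) ?_ ?_
  · exact (hk.measurable.comp (measurable_fst.prodMk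
      (measurable_fst.comp measurable_snd))).aestronglyMeasurable
  · filter_upwards [ae_doubleMeasure_mem] with q hq
    exact hB (q.1, q.2.1) ⟨Ioo_subset_Icc_self hq.1, Ioo_subset_Icc_self hq.2⟩

variable {v₀ u₀ : EuclideanSpace ℝ (Fin N) → ℝ} {v u : ℝ × EuclideanSpace ℝ (Fin N) → ℝ}
  {Dv a Du b : ℝ × EuclideanSpace ℝ (Fin N) → EuclideanSpace ℝ (Fin N)}
  {F H : ℝ × EuclideanSpace ℝ (Fin N) → ℝ}

lemma measurable_comp_other_time {F : Type*} [MeasurableSpace F]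
    {u : ℝ × EuclideanSpace ℝ (Fin N) → F} (hu : Measurable u) :
    Measurable fun q : ℝ × (ℝ × EuclideanSpace ℝ (Fin N)) => u (q.1, q.2.2) :=
  hu.comp (measurable_fst.prodMk (measurable_snd.comp measurable_snd))

lemma memLp_comp_other_time {p : ℝ≥0∞}
    {G : ℝ × EuclideanSpace ℝ (Fin N) → EuclideanSpace ℝ (Fin N)}
    (hG : MemLp G p (cylMeasure Ω M)) :
    MemLp (fun q : ℝ × (ℝ × EuclideanSpace ℝ (Fin N)) => G (q.1, q.2.2)) p
      (doubleMeasure Ω M) :=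
  (hG.comp_snd (volume.restrict (Ioo 0 M))).comp_measurePreserving measurePreserving_swapTime

/-- The dissipation and source terms in the entropy inequality of `v` relative to the slices of
another function `u`. -/
noncomputable def entropyProduction (S : ℝ → ℝ) (v u : ℝ × EuclideanSpace ℝ (Fin N) → ℝ)
    (Dv Du a : ℝ × EuclideanSpace ℝ (Fin N) → EuclideanSpace ℝ (Fin N))
    (F : ℝ × EuclideanSpace ℝ (Fin N) → ℝ) (q : ℝ × (ℝ × EuclideanSpace ℝ (Fin N))) : ℝ :=
  F q.2 * S (v q.2 - u (q.1, q.2.2)) -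
    inner ℝ (a q.2) (deriv S (v q.2 - u (q.1, q.2.2)) • (Dv q.2 - Du (q.1, q.2.2)))

lemma IsEvolution.integrable_entropyProduction [IsFiniteMeasure (volume.restrict Ω)] (hm : 1 < m)
    (h : IsEvolution Ω M m α v₀ v Dv a F) (h' : IsEvolution Ω M m α u₀ u Du b H)
    (hS : SignLike S) :
    Integrable (entropyProduction S v u Dv Du a F) (doubleMeasure Ω M) := by
  obtain ⟨L, hL⟩ := hS.deriv_le
  obtain ⟨CF, hCF⟩ := h.bounded_source
  have hcj := holderConjugate_ofReal hm
  have hd : Measurable fun q : ℝ × (ℝ × EuclideanSpace ℝ (Fin N)) => v q.2 - u (q.1, q.2.2) :=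
    (h.measurable.comp measurable_snd).sub (measurable_comp_other_time h'.measurable)
  refine Integrable.sub ?_ (integrable_inner_of_memLp
    (h.memLp_flux.comp_snd (volume.restrict (Ioo 0 M)))
    (memLp_smul_of_bound (hS.continuous_deriv.measurable.comp hd).aestronglyMeasurable
      (ae_of_all _ fun q => hL _) ((h.memLp_grad.comp_snd (volume.restrict (Ioo 0 M))).sub
        (memLp_comp_other_time h'.memLp_grad))))
  refine Integrable.of_bound (C := CF) ((h.measurable_source.comp measurable_snd).mul
    (hS.contDiff.continuous.measurable.comp hd)).aestronglyMeasurable (ae_of_all _ fun q => ?_)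
  rw [norm_mul]
  exact (mul_le_of_le_one_right (norm_nonneg _) (hS.abs_le _)).trans (hCF _)

lemma IsEvolution.integrable_entropy_double [IsFiniteMeasure (volume.restrict Ω)]
    (h : IsEvolution Ω M m α v₀ v Dv a F) (h' : IsEvolution Ω M m α u₀ u Du b H)
    (hα : Continuous α) (hmono : Monotone α) (hS : SignLike S) :
    Integrable (fun q : ℝ × (ℝ × EuclideanSpace ℝ (Fin N)) =>
      entropy S α (v q.2) (u (q.1, q.2.2))) (doubleMeasure Ω M) := by
  obtain ⟨C, hC⟩ := h.bounded
  obtain ⟨C', hC'⟩ := h'.bounded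
  exact integrable_entropy_comp hS hα hmono (h.measurable.comp measurable_snd)
    (measurable_comp_other_time h'.measurable) (fun q => hC _) (fun q => hC' _)

/-- The entropy inequality of `v` relative to the slices of another solution, integrated over the
time variable of the latter. -/
lemma IsEvolution.entropy_inequality_double [IsFiniteMeasure (volume.restrict Ω)]
    (hΩ : MeasurableSet Ω) (hm : 1 < m) (hM : 0 < M)
    (h : IsEvolution Ω M m α v₀ v Dv a F) (h' : IsEvolution Ω M m α u₀ u Du b H)
    (hα : Continuous α) (hmono : Monotone α) (hS : SignLike S) {k k' : ℝ → ℝ → ℝ}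
    (hk : ∀ s t, HasDerivAt (k s) (k' s t) t) (hkc : Continuous fun q : ℝ × ℝ => k q.1 q.2)
    (hkc' : Continuous fun q : ℝ × ℝ => k' q.1 q.2) (hk0 : ∀ s t, 0 ≤ k s t)
    (hkM : ∀ s ∈ Ioo 0 M, ∀ t, M ≤ t → k s t = 0) :
    -∫ q, k' q.1 q.2.1 * entropy S α (v q.2) (u (q.1, q.2.2)) ∂(doubleMeasure Ω M) ≤
      (∫ s in Ioo 0 M, k s 0 * ∫ x in Ω, entropy S α (v₀ x) (u (s, x))) +
        ∫ q, k q.1 q.2.1 * entropyProduction S v u Dv Du a F q ∂(doubleMeasure Ω M) := by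
  obtain ⟨C₀, hC₀⟩ := h.bounded_initial
  obtain ⟨C, hC⟩ := h.bounded
  obtain ⟨C', hC'⟩ := h'.bounded
  have iE := integrable_kernel_mul hkc' (h.integrable_entropy_double h' hα hmono hS)
  have iP := integrable_kernel_mul hkc (h.integrable_entropyProduction hm h' hS)
  have hmu : ∀ s, Measurable fun x => u (s, x) := fun s => h'.measurable.comp measurable_prodMk_left
  have hmv : ∀ s, Measurable fun x => v (s, x) := fun s => h.measurable.comp measurable_prodMk_left
  have i0 : Integrable (fun s => k s 0 * ∫ x in Ω, entropy S α (v₀ x) (u (s, x)))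
      (volume.restrict (Ioo 0 M)) := by
    have hi : Integrable (fun p : ℝ × EuclideanSpace ℝ (Fin N) => entropy S α (v₀ p.2) (u p))
        (cylMeasure Ω M) := integrable_entropy_comp hS hα hmono
      (h.measurable_initial.comp measurable_snd) h'.measurable (fun _ => hC₀ _) hC'
    have hkc0 : Continuous fun s => k s 0 := hkc.comp (continuous_id.prodMk continuous_const)
    obtain ⟨B, hB⟩ := (isCompact_Icc (a := (0 : ℝ)) (b := M)).exists_bound_of_continuousOn
      hkc0.continuousOn
    refine (Integrable.integral_prod_left hi).bdd_mul (c := B) hkc0.aestronglyMeasurable ?_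
    exact (ae_restrict_mem measurableSet_Ioo).mono fun s hs => hB s (Ioo_subset_Icc_self hs)
  rw [doubleMeasure] at iE iP ⊢
  rw [integral_prod _ iE, integral_prod _ iP, ← integral_neg, ← integral_add i0 iP.integral_prod_left]
  refine integral_mono_ae iE.integral_prod_left.neg (i0.add iP.integral_prod_left) ?_
  filter_upwards [h'.slice, ae_restrict_mem measurableSet_Ioo, iE.prod_right_ae] with s hs hsM hsE
  have hk's : Continuous (k' s) := hkc'.comp (continuous_const.prodMk continuous_id)
  have key := h.entropy_inequality hΩ hm hα hmono hS hs (hmu s) (fun x => hC' _) (hk s) hk's (hk0 s)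
    (hkM s hsM)
  -- Since `k s` vanishes at `M`, subtracting the initial entropy in the fixed-`z` inequality
  -- produces exactly the boundary term at `t = 0`.
  have e1 : ∫ t in Ioo 0 M, k' s t = -k s 0 := by
    rw [← integral_Ioc_eq_integral_Ioo, ← intervalIntegral.integral_of_le hM.le,
      intervalIntegral.integral_eq_sub_of_hasDerivAt (fun t _ => hk s t)
        (hk's.intervalIntegrable _ _), hkM s hsM M le_rfl, zero_sub]
  have iK : IntegrableOn (k' s) (Ioo 0 M) := hk's.integrableOn_Icc.mono_set Ioo_subset_Icc_self
  have e2 : ∫ p, k' s p.1 * entropy S α (v p) (u (s, p.2)) ∂(cylMeasure Ω M) =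
      ∫ t in Ioo 0 M, k' s t * ∫ x in Ω, entropy S α (v (t, x)) (u (s, x)) := by
    refine (integral_prod _ hsE).trans (integral_congr_ae (ae_of_all _ fun t => ?_))
    simp only [integral_const_mul]
  have iE2 : IntegrableOn (fun t => k' s t * ∫ x in Ω, entropy S α (v (t, x)) (u (s, x)))
      (Ioo 0 M) := by
    refine (Integrable.integral_prod_left hsE).congr (ae_of_all _ fun t => ?_)
    simp only [integral_const_mul]
  have e3 : ∫ t in Ioo 0 M, k' s t * ((∫ x in Ω, entropy S α (v (t, x)) (u (s, x))) -
      ∫ x in Ω, entropy S α (v₀ x) (u (s, x))) =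
      (∫ p, k' s p.1 * entropy S α (v p) (u (s, p.2)) ∂(cylMeasure Ω M)) +
        k s 0 * ∫ x in Ω, entropy S α (v₀ x) (u (s, x)) := by
    simp_rw [mul_sub]
    rw [integral_sub iE2 (iK.mul_const _), integral_mul_const, e1, e2]
    ring
  rw [e3] at key
  change -(∫ p, k' s p.1 * entropy S α (v p) (u (s, p.2)) ∂(cylMeasure Ω M)) ≤
    k s 0 * (∫ x in Ω, entropy S α (v₀ x) (u (s, x))) +
      ∫ p, k s p.1 * (F p * S (v p - u (s, p.2)) -
        inner ℝ (a p) (deriv S (v p - u (s, p.2)) • (Dv p - Du (s, p.2)))) ∂(cylMeasure Ω M)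
  linarith

end Doubling

/-! ### Kato's inequality. -/

section Kato

variable {N : ℕ} {Ω : Set (EuclideanSpace ℝ (Fin N))} {M m : ℝ} {S α : ℝ → ℝ}
  {v₀ u₀ : EuclideanSpace ℝ (Fin N) → ℝ} {v u : ℝ × EuclideanSpace ℝ (Fin N) → ℝ}
  {Dv a Du b : ℝ × EuclideanSpace ℝ (Fin N) → EuclideanSpace ℝ (Fin N)}
  {F H : ℝ × EuclideanSpace ℝ (Fin N) → ℝ}

/-- With `S` odd and `S'` even, the two test functions are opposite and their gradients too. The sum
therefore contains the source difference times `S`, and minus the nonnegative factor `S'` times the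
monotonicity expression of the fluxes. -/
lemma entropyProduction_add_le (hS : SignLike S)
    (hab : ∀ p p', 0 ≤ inner ℝ (a p - b p') (Dv p - Du p'))
    (q : ℝ × (ℝ × EuclideanSpace ℝ (Fin N))) :
    entropyProduction S v u Dv Du a F q + entropyProduction S u v Du Dv b H (swapTime q) ≤
      |F q.2 - H (q.1, q.2.2)| := by
  set p' : ℝ × EuclideanSpace ℝ (Fin N) := (q.1, q.2.2) with hp'
  have e : entropyProduction S v u Dv Du a F q + entropyProduction S u v Du Dv b H (swapTime q) =
      (F q.2 - H p') * S (v q.2 - u p') -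
        deriv S (v q.2 - u p') * inner ℝ (a q.2 - b p') (Dv q.2 - Du p') := by
    change F q.2 * S (v q.2 - u p') - inner ℝ (a q.2) (deriv S (v q.2 - u p') • (Dv q.2 - Du p')) +
      (H p' * S (u p' - v q.2) - inner ℝ (b p') (deriv S (u p' - v q.2) • (Du p' - Dv q.2))) = _
    rw [← neg_sub (v q.2) (u p'), hS.odd, hS.deriv_even, ← neg_sub (Dv q.2) (Du p'), smul_neg,
      inner_neg_right, inner_smul_right, inner_smul_right, inner_sub_left]
    ring
  rw [e]
  have h1 := mul_nonneg (hS.deriv_nonneg (v q.2 - u p')) (hab q.2 p')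
  have h2 : (F q.2 - H p') * S (v q.2 - u p') ≤ |F q.2 - H p'| := by
    refine (le_abs_self _).trans ?_
    rw [abs_mul]
    exact mul_le_of_le_one_right (abs_nonneg _) (hS.abs_le _)
  linarith

variable [IsFiniteMeasure (volume.restrict Ω)] {δ : ℝ} {φ φ' ρ : ℝ → ℝ}

lemma IsEvolution.integrable_abs_source_sub (h : IsEvolution Ω M m α v₀ v Dv a F)
    (h' : IsEvolution Ω M m α u₀ u Du b H) :
    Integrable (fun q : ℝ × (ℝ × EuclideanSpace ℝ (Fin N)) => |F q.2 - H (q.1, q.2.2)|)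
      (doubleMeasure Ω M) := by
  obtain ⟨C, hC⟩ := h.bounded_source
  obtain ⟨C', hC'⟩ := h'.bounded_source
  exact integrable_abs_comp_sub continuous_id (h.measurable_source.comp measurable_snd)
    (measurable_comp_other_time h'.measurable_source) (fun q => hC _) (fun q => hC' _)

lemma IsEvolution.integrable_abs_sub_double (h : IsEvolution Ω M m α v₀ v Dv a F)
    (h' : IsEvolution Ω M m α u₀ u Du b H) (hα : Continuous α) :
    Integrable (fun q : ℝ × (ℝ × EuclideanSpace ℝ (Fin N)) => |α (v q.2) - α (u (q.1, q.2.2))|)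
      (doubleMeasure Ω M) := by
  obtain ⟨C, hC⟩ := h.bounded
  obtain ⟨C', hC'⟩ := h'.bounded
  exact integrable_abs_comp_sub hα (h.measurable.comp measurable_snd)
    (measurable_comp_other_time h'.measurable) (fun q => hC _) (fun q => hC' _)

/-- Sum of the inequalities for `v` in `t` and `u` in `s`, with common kernel `φ(t) ρ(t - s)`. The
terms with `ρ'` carry entropies with exchanged arguments; as the entropy is not symmetric, they
cannot cancel yet. -/
lemma IsEvolution.kato_entropy (hΩ : MeasurableSet Ω) (hm : 1 < m) (hM : 0 < M)
    (h : IsEvolution Ω M m α v₀ v Dv a F) (h' : IsEvolution Ω M m α u₀ u Du b H)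
    (hab : ∀ p p', 0 ≤ inner ℝ (a p - b p') (Dv p - Du p'))
    (hα : Continuous α) (hmono : Monotone α) (hS : SignLike S)
    (hφ : ∀ t, HasDerivAt φ (φ' t) t) (hφ' : Continuous φ') (hφ0 : ∀ t, 0 ≤ φ t)
    (hφM : ∀ t, M ≤ t → φ t = 0) (hρ : IsMollifier δ ρ) (hρc : ContDiff ℝ ∞ ρ) :
    -(∫ q, (φ' q.2.1 * ρ (q.2.1 - q.1) + φ q.2.1 * deriv ρ (q.2.1 - q.1)) *
          entropy S α (v q.2) (u (q.1, q.2.2)) ∂(doubleMeasure Ω M)) +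
      (∫ q, (φ q.2.1 * deriv ρ (q.2.1 - q.1)) *
          entropy S α (u (q.1, q.2.2)) (v q.2) ∂(doubleMeasure Ω M)) ≤
      (∫ s in Ioo 0 M, φ s * ρ s * ∫ x in Ω, entropy S α (u₀ x) (v (s, x))) +
        ∫ q, φ q.2.1 * ρ (q.2.1 - q.1) * |F q.2 - H (q.1, q.2.2)| ∂(doubleMeasure Ω M) := by
  have hφc : Continuous φ := continuous_iff_continuousAt.2 fun t => (hφ t).continuousAt
  have hρ' : Continuous (deriv ρ) := hρc.continuous_deriv (by simp)
  have hρd : ∀ t, HasDerivAt ρ (deriv ρ t) t := fun t =>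
    (hρc.differentiable (by simp) t).hasDerivAt
  have hρ0 := hρ.continuous
  have d1 := h.entropy_inequality_double hΩ hm hM h' hα hmono hS
    (k := fun s t => φ t * ρ (t - s)) (k' := fun s t => φ' t * ρ (t - s) + φ t * deriv ρ (t - s))
    (fun s t => (hφ t).mul ((hρd (t - s)).comp_sub_const t s))
    (by fun_prop) (by fun_prop) (fun s t => mul_nonneg (hφ0 t) (hρ.nonneg _))
    (fun s _ t ht => by simp [hφM t ht])
  have d2 := h'.entropy_inequality_double hΩ hm hM h hα hmono hS
    (k := fun t s => φ t * ρ (t - s)) (k' := fun t s => -(φ t * deriv ρ (t - s)))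
    (fun t s => by
      have := ((hρd (t - s)).comp s ((hasDerivAt_id s).const_sub t)).const_mul (φ t)
      simpa using this)
    (by fun_prop) (by fun_prop) (fun s t => mul_nonneg (hφ0 s) (hρ.nonneg _))
    (fun s hs t ht => by
      rw [hρ.eq_zero (s - t) (fun h' => by linarith [h'.1, hs.2]), mul_zero])
  -- For `v` the initial term contains `ρ(-s)` with `s > 0`, which is zero; only the initial term of
  -- `u`, with weight `φ(t) ρ(t)`, remains.
  have z1 : ∫ s in Ioo 0 M, φ 0 * ρ (0 - s) * ∫ x in Ω, entropy S α (v₀ x) (u (s, x)) = 0 := by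
    refine setIntegral_eq_zero_of_forall_eq_zero fun s hs => ?_
    rw [hρ.eq_zero (0 - s) (fun h' => by linarith [h'.1, hs.1]), mul_zero, zero_mul]
  rw [z1, zero_add] at d1
  have s1 := measurePreserving_swapTime (Ω := Ω) (M := M) |>.integral_comp' (fun q =>
    -(φ q.1 * deriv ρ (q.1 - q.2.1)) * entropy S α (u q.2) (v (q.1, q.2.2)))
  have s2 := measurePreserving_swapTime (Ω := Ω) (M := M) |>.integral_comp' (fun q =>
    (φ q.1 * ρ (q.1 - q.2.1)) * entropyProduction S u v Du Dv b H q)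
  rw [← s1, ← s2] at d2
  -- Exchanging the two times puts the inequality for `u` on the same variables as that for `v`.
  change -(∫ q, -(φ q.2.1 * deriv ρ (q.2.1 - q.1)) *
    entropy S α (u (q.1, q.2.2)) (v q.2) ∂(doubleMeasure Ω M)) ≤
    (∫ s in Ioo 0 M, φ s * ρ (s - 0) * ∫ x in Ω, entropy S α (u₀ x) (v (s, x))) +
    ∫ q, (φ q.2.1 * ρ (q.2.1 - q.1)) * entropyProduction S u v Du Dv b H (swapTime q)
      ∂(doubleMeasure Ω M) at d2
  simp only [neg_mul, integral_neg, neg_neg, sub_zero] at d2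
  have hkc : Continuous fun q : ℝ × ℝ => φ q.2 * ρ (q.2 - q.1) := by fun_prop
  have i1 := integrable_kernel_mul (k := fun s t => φ t * ρ (t - s)) hkc
    (h.integrable_entropyProduction hm h' hS)
  have i2 := integrable_kernel_mul (k := fun s t => φ t * ρ (t - s)) hkc
    (measurePreserving_swapTime.integrable_comp_of_integrable
      (h'.integrable_entropyProduction hm h hS))
  have i3 := integrable_kernel_mul (k := fun s t => φ t * ρ (t - s)) hkc
    (h.integrable_abs_source_sub h')
  have d3 : (∫ q, φ q.2.1 * ρ (q.2.1 - q.1) * entropyProduction S v u Dv Du a F q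
      ∂(doubleMeasure Ω M)) + (∫ q, φ q.2.1 * ρ (q.2.1 - q.1) *
        entropyProduction S u v Du Dv b H (swapTime q) ∂(doubleMeasure Ω M)) ≤
      ∫ q, φ q.2.1 * ρ (q.2.1 - q.1) * |F q.2 - H (q.1, q.2.2)| ∂(doubleMeasure Ω M) := by
    simp only [Function.comp_apply] at i2
    rw [← integral_add i1 i2]
    refine integral_mono (i1.add i2) i3 fun q => ?_
    simp only
    rw [← mul_add]
    exact mul_le_mul_of_nonneg_left (entropyProduction_add_le hS hab q)
      (mul_nonneg (hφ0 _) (hρ.nonneg _))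
  linarith

/-- Kato's inequality with doubled time variable. -/
lemma IsEvolution.kato (hΩ : MeasurableSet Ω) (hm : 1 < m) (hM : 0 < M)
    (h : IsEvolution Ω M m α v₀ v Dv a F) (h' : IsEvolution Ω M m α u₀ u Du b H)
    (hab : ∀ p p', 0 ≤ inner ℝ (a p - b p') (Dv p - Du p'))
    {K : ℝ≥0} (hα : LipschitzWith K α) (hmono : Monotone α)
    (hφ : ∀ t, HasDerivAt φ (φ' t) t) (hφ' : Continuous φ') (hφ0 : ∀ t, 0 ≤ φ t)
    (hφM : ∀ t, M ≤ t → φ t = 0) (hρ : IsMollifier δ ρ) (hρc : ContDiff ℝ ∞ ρ) :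
    -(∫ q, φ' q.2.1 * ρ (q.2.1 - q.1) * |α (v q.2) - α (u (q.1, q.2.2))| ∂(doubleMeasure Ω M)) ≤
      (∫ s in Ioo 0 M, φ s * ρ s * ∫ x in Ω, |α (v (s, x)) - α (u₀ x)|) +
        ∫ q, φ q.2.1 * ρ (q.2.1 - q.1) * |F q.2 - H (q.1, q.2.2)| ∂(doubleMeasure Ω M) := by
  have hφc : Continuous φ := continuous_iff_continuousAt.2 fun t => (hφ t).continuousAt
  have hρ' : Continuous (deriv ρ) := hρc.continuous_deriv (by simp)
  have hρ0 := hρ.continuous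
  have hαc := hα.continuous
  obtain ⟨C, hC⟩ := h.bounded
  obtain ⟨C₀, hC₀⟩ := h'.bounded_initial
  set A : ℝ → ℝ → ℝ := fun s t => φ' t * ρ (t - s) + φ t * deriv ρ (t - s) with hA
  set B : ℝ → ℝ → ℝ := fun s t => φ t * deriv ρ (t - s) with hB
  have hAc : Continuous fun q : ℝ × ℝ => A q.1 q.2 := by simp only [hA]; fun_prop
  have hBc : Continuous fun q : ℝ × ℝ => B q.1 q.2 := by simp only [hB]; fun_prop
  set d : ℝ × (ℝ × EuclideanSpace ℝ (Fin N)) → ℝ :=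
    fun q => |α (v q.2) - α (u (q.1, q.2.2))| with hd
  have hdi : Integrable d (doubleMeasure Ω M) := h.integrable_abs_sub_double h' hαc
  have iAd := integrable_kernel_mul hAc hdi
  have iBd := integrable_kernel_mul hBc hdi
  have iA := integrable_kernel_mul (k := fun s t => |A s t|) hAc.abs
    (integrable_const (μ := doubleMeasure Ω M) (1 : ℝ))
  have iB := integrable_kernel_mul (k := fun s t => |B s t|) hBc.abs
    (integrable_const (μ := doubleMeasure Ω M) (1 : ℝ))
  set J := (∫ q, |A q.1 q.2.1| * 1 ∂(doubleMeasure Ω M)) +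
    ∫ q, |B q.1 q.2.1| * 1 ∂(doubleMeasure Ω M) with hJ
  have hJ0 : 0 ≤ J := add_nonneg
    (integral_nonneg fun q => mul_nonneg (abs_nonneg _) zero_le_one)
    (integral_nonneg fun q => mul_nonneg (abs_nonneg _) zero_le_one)
  have hlhs : ∫ q, φ' q.2.1 * ρ (q.2.1 - q.1) * d q ∂(doubleMeasure Ω M) =
      (∫ q, A q.1 q.2.1 * d q ∂(doubleMeasure Ω M)) -
        ∫ q, B q.1 q.2.1 * d q ∂(doubleMeasure Ω M) := by
    rw [← integral_sub iAd iBd]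
    congr 1 with q
    simp only [hA, hB]
    ring
  have hinit : Integrable (fun p : ℝ × EuclideanSpace ℝ (Fin N) => |α (v p) - α (u₀ p.2)|)
      (cylMeasure Ω M) := integrable_abs_comp_sub hαc h.measurable
    (h'.measurable_initial.comp measurable_snd) hC (fun p => hC₀ _)
  rw [hlhs]
  refine le_of_forall_pos_le_add fun η hη => ?_
  -- The sign is sharpened at fixed `ρ`. The kernels `A` and `B` contain `ρ'`, but their integrals
  -- sum to a finite `J`, and each entropy is within `2 K ε` of `|α(v) - α(u)|`; in the limit only
  -- `A - B = φ' ρ` survives.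
  obtain ⟨ε, hε, hεη⟩ : ∃ ε > 0, 2 * K * ε * J ≤ η := by
    refine ⟨η / (2 * K * J + 1), by positivity, ?_⟩
    have hc : (0 : ℝ) ≤ 2 * K * J := by positivity
    have e : 2 * K * (η / (2 * K * J + 1)) * J = (2 * K * J) * η / (2 * K * J + 1) := by ring
    rw [e, div_le_iff₀ (by positivity)]
    nlinarith
  have hS := signLike_softSign hε
  have key := h.kato_entropy hΩ hm hM h' hab hαc hmono hS hφ hφ' hφ0 hφM hρ hρc
  have iE1 := h.integrable_entropy_double h' hαc hmono hS
  have iE2 := measurePreserving_swapTime.integrable_comp_of_integrable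
    (h'.integrable_entropy_double h hαc hmono hS)
  have b1 : -(∫ q, A q.1 q.2.1 * d q ∂(doubleMeasure Ω M)) -
      2 * K * ε * (∫ q, |A q.1 q.2.1| * 1 ∂(doubleMeasure Ω M)) ≤
      -(∫ q, A q.1 q.2.1 * entropy (softSign ε) α (v q.2) (u (q.1, q.2.2))
        ∂(doubleMeasure Ω M)) := by
    have iAd' : Integrable (fun q => -(A q.1 q.2.1 * d q)) (doubleMeasure Ω M) := iAd.neg
    rw [← integral_const_mul, ← integral_neg, ← integral_neg, ← integral_sub iAd' (iA.const_mul _)]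
    refine integral_mono (iAd'.sub (iA.const_mul _)) (integrable_kernel_mul hAc iE1).neg
      fun q => ?_
    have l1 := le_entropy_softSign hε hα hmono (v q.2) (u (q.1, q.2.2))
    have l2 := entropy_le hS hαc hmono (v q.2) (u (q.1, q.2.2))
    have l3 : |A q.1 q.2.1 * (d q - entropy (softSign ε) α (v q.2) (u (q.1, q.2.2)))| ≤
        |A q.1 q.2.1| * (2 * K * ε) := by
      rw [abs_mul]
      refine mul_le_mul_of_nonneg_left (abs_le.2 ⟨?_, ?_⟩) (abs_nonneg _) <;>
        simp only [hd] <;> nlinarith [K.2]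
    have l4 := (abs_le.1 l3).1
    change -(A q.1 q.2.1 * d q) - 2 * K * ε * (|A q.1 q.2.1| * 1) ≤
      -(A q.1 q.2.1 * entropy (softSign ε) α (v q.2) (u (q.1, q.2.2)))
    linarith
  have b2 : (∫ q, B q.1 q.2.1 * d q ∂(doubleMeasure Ω M)) -
      2 * K * ε * (∫ q, |B q.1 q.2.1| * 1 ∂(doubleMeasure Ω M)) ≤
      (∫ q, B q.1 q.2.1 * entropy (softSign ε) α (u (q.1, q.2.2)) (v q.2)
        ∂(doubleMeasure Ω M)) := by
    rw [← integral_const_mul, ← integral_sub iBd (iB.const_mul _)]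
    refine integral_mono (iBd.sub (iB.const_mul _)) (integrable_kernel_mul hBc iE2) fun q => ?_
    have l1 := le_entropy_softSign hε hα hmono (u (q.1, q.2.2)) (v q.2)
    have l2 := entropy_le hS hαc hmono (u (q.1, q.2.2)) (v q.2)
    rw [abs_sub_comm] at l1 l2
    have l3 : |B q.1 q.2.1 * (d q - entropy (softSign ε) α (u (q.1, q.2.2)) (v q.2))| ≤
        |B q.1 q.2.1| * (2 * K * ε) := by
      rw [abs_mul]
      refine mul_le_mul_of_nonneg_left (abs_le.2 ⟨?_, ?_⟩) (abs_nonneg _) <;>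
        simp only [hd] <;> nlinarith [K.2]
    have l4 := (abs_le.1 l3).2
    change B q.1 q.2.1 * d q - 2 * K * ε * (|B q.1 q.2.1| * 1) ≤
      B q.1 q.2.1 * entropy (softSign ε) α (u (q.1, q.2.2)) (v q.2)
    linarith
  have b3 : ∫ s in Ioo 0 M, φ s * ρ s * ∫ x in Ω, entropy (softSign ε) α (u₀ x) (v (s, x)) ≤
      ∫ s in Ioo 0 M, φ s * ρ s * ∫ x in Ω, |α (v (s, x)) - α (u₀ x)| := by
    have hmv : ∀ s, Measurable fun x => v (s, x) := fun s =>
      h.measurable.comp measurable_prodMk_left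
    have hmul : ∀ g : ℝ → ℝ, Integrable g (volume.restrict (Ioo 0 M)) →
        Integrable (fun s => φ s * ρ s * g s) (volume.restrict (Ioo 0 M)) := by
      intro g hg
      obtain ⟨B, hB⟩ := (isCompact_Icc (a := (0 : ℝ)) (b := M)).exists_bound_of_continuousOn
        (hφc.mul hρ0).continuousOn
      exact hg.bdd_mul (c := B) (hφc.mul hρ0).aestronglyMeasurable
        ((ae_restrict_mem measurableSet_Ioo).mono fun s hs => hB s (Ioo_subset_Icc_self hs))
    have hE : Integrable (fun p : ℝ × EuclideanSpace ℝ (Fin N) =>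
        entropy (softSign ε) α (u₀ p.2) (v p)) (cylMeasure Ω M) :=
      integrable_entropy_comp hS hαc hmono (h'.measurable_initial.comp measurable_snd) h.measurable
        (fun p => hC₀ _) hC
    refine integral_mono (hmul _ (Integrable.integral_prod_left hE))
      (hmul _ (Integrable.integral_prod_left hinit)) fun s => ?_
    refine mul_le_mul_of_nonneg_left ?_ (mul_nonneg (hφ0 s) (hρ.nonneg s))
    refine integral_mono (integrable_entropy_comp hS hαc hmono h'.measurable_initial (hmv s) hC₀
      (fun x => hC _)) (integrable_abs_comp_sub hαc (hmv s) h'.measurable_initial (fun x => hC _) hC₀)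
      fun x => ?_
    exact (entropy_le hS hαc hmono _ _).trans (le_of_eq (abs_sub_comm _ _))
  have e : 2 * K * ε * J = 2 * K * ε * (∫ q, |A q.1 q.2.1| * 1 ∂(doubleMeasure Ω M)) +
    2 * K * ε * ∫ q, |B q.1 q.2.1| * 1 ∂(doubleMeasure Ω M) := by rw [hJ]; ring
  simp only [hA, hB] at b1 b2 e ⊢
  linarith

end Kato

/-! ### The nonlocal source. -/

/-- The numerators differ by at most `L |α(g₁) - α(g₂)|`, hence so do the means in integrated form,
and both means are at least `σ μ(X)`. The two-time form of Kato's inequality calls for two unrelated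
slices `g₁` and `g₂`. -/
lemma integral_abs_nonlocal_sub_le {X : Type*} [MeasurableSpace X] {μ : Measure X}
    [IsFiniteMeasure μ] {α f : ℝ → ℝ} (hα : Continuous α) (hf : Continuous f) {σ L : ℝ}
    (hσ0 : 0 < σ) (hσ : ∀ s, σ ≤ f s) (hL : 0 ≤ L)
    (hfα : ∀ a b, |f a - f b| ≤ L * |α a - α b|) {g₁ g₂ : X → ℝ} (hg₁ : Measurable g₁)
    (hg₂ : Measurable g₂) {C₁ C₂ : ℝ} (hC₁ : ∀ x, |g₁ x| ≤ C₁) (hC₂ : ∀ x, |g₂ x| ≤ C₂) :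
    ∫ x, |f (g₁ x) / (∫ y, f (g₁ y) ∂μ) ^ 2 - f (g₂ x) / (∫ y, f (g₂ y) ∂μ) ^ 2| ∂μ ≤
      3 * L / (σ * μ.real univ) ^ 2 * ∫ x, |α (g₁ x) - α (g₂ x)| ∂μ := by
  rcases eq_or_ne μ 0 with rfl | hμ
  · simp
  have hV : 0 < μ.real univ := by
    rw [measureReal_def]
    exact ENNReal.toReal_pos (by simpa using hμ) (measure_ne_top _ _)
  have hi : ∀ g : X → ℝ, Measurable g → ∀ C, (∀ x, |g x| ≤ C) →
      Integrable (fun x => f (g x)) μ := fun g hg C hC => by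
    obtain ⟨C', hC'⟩ := exists_abs_comp_le hf hC
    exact Integrable.of_bound (hf.measurable.comp hg).aestronglyMeasurable C' (ae_of_all _ hC')
  have i₁ := hi g₁ hg₁ C₁ hC₁
  have i₂ := hi g₂ hg₂ C₂ hC₂
  have hlow : ∀ g : X → ℝ, Integrable (fun x => f (g x)) μ →
      σ * μ.real univ ≤ ∫ x, f (g x) ∂μ := fun g hg => by
    have := integral_mono (integrable_const σ) hg (fun x => hσ (g x))
    simpa [mul_comm] using this
  have l₁ := hlow g₁ i₁
  have l₂ := hlow g₂ i₂
  have hc : 0 < σ * μ.real univ := mul_pos hσ0 hV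
  set c := σ * μ.real univ with hcdef
  set I₁ := ∫ y, f (g₁ y) ∂μ with hI₁
  set I₂ := ∫ y, f (g₂ y) ∂μ with hI₂
  have p₁ : 0 < I₁ := hc.trans_le l₁
  have p₂ : 0 < I₂ := hc.trans_le l₂
  have iα : Integrable (fun x => |α (g₁ x) - α (g₂ x)|) μ :=
    integrable_abs_comp_sub hα hg₁ hg₂ hC₁ hC₂
  set D := ∫ x, |α (g₁ x) - α (g₂ x)| ∂μ with hD
  have hD0 : 0 ≤ D := integral_nonneg fun x => abs_nonneg _
  have hI : |I₂ - I₁| ≤ L * D := by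
    rw [hI₁, hI₂, ← integral_sub i₂ i₁, hD, ← integral_const_mul]
    refine (abs_integral_le_integral_abs).trans (integral_mono (i₂.sub i₁).abs (iα.const_mul L)
      fun x => ?_)
    simp only
    rw [abs_sub_comm]
    exact hfα _ _
  have hpt : ∀ x, |f (g₁ x) / I₁ ^ 2 - f (g₂ x) / I₂ ^ 2| ≤
      L / I₁ ^ 2 * |α (g₁ x) - α (g₂ x)| + |I₂ - I₁| * (I₁ + I₂) / (I₁ ^ 2 * I₂ ^ 2) * f (g₂ x) := by
    intro x
    have e : f (g₁ x) / I₁ ^ 2 - f (g₂ x) / I₂ ^ 2 = (f (g₁ x) - f (g₂ x)) / I₁ ^ 2 +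
        (I₂ - I₁) * (I₁ + I₂) / (I₁ ^ 2 * I₂ ^ 2) * f (g₂ x) := by
      field_simp
      ring
    rw [e]
    refine (abs_add_le _ _).trans (add_le_add ?_ (le_of_eq ?_))
    · rw [abs_div, abs_of_pos (by positivity : 0 < I₁ ^ 2), div_mul_eq_mul_div]
      exact div_le_div_of_nonneg_right (hfα _ _) (by positivity)
    · rw [abs_mul, abs_div, abs_mul, abs_of_pos (by positivity : 0 < I₁ + I₂),
        abs_of_pos (by positivity : 0 < I₁ ^ 2 * I₂ ^ 2),
        abs_of_pos (hσ0.trans_le (hσ (g₂ x)))]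
  have hint : ∫ x, |f (g₁ x) / I₁ ^ 2 - f (g₂ x) / I₂ ^ 2| ∂μ ≤
      L / I₁ ^ 2 * D + |I₂ - I₁| * (I₁ + I₂) / (I₁ ^ 2 * I₂ ^ 2) * I₂ := by
    rw [hD, hI₂, ← integral_const_mul, ← integral_const_mul,
      ← integral_add (iα.const_mul _) (i₂.const_mul _)]
    exact integral_mono ((i₁.div_const _).sub (i₂.div_const _)).abs
      ((iα.const_mul _).add (i₂.const_mul _)) hpt
  -- Changing the denominators costs two terms and the numerators one; each is at most `L D / c²`,
  -- whence the factor 3.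
  have e2 : |I₂ - I₁| * (I₁ + I₂) / (I₁ ^ 2 * I₂ ^ 2) * I₂ =
      |I₂ - I₁| / I₁ ^ 2 + |I₂ - I₁| / (I₁ * I₂) := by
    field_simp
    ring
  have hLD : 0 ≤ L * D := mul_nonneg hL hD0
  have q1 : L / I₁ ^ 2 * D ≤ L * D / c ^ 2 := by
    rw [div_mul_eq_mul_div]
    exact div_le_div_of_nonneg_left hLD (by positivity) (by gcongr)
  have q2 : |I₂ - I₁| / I₁ ^ 2 ≤ L * D / c ^ 2 :=
    div_le_div₀ hLD hI (by positivity) (by gcongr)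
  have q3 : |I₂ - I₁| / (I₁ * I₂) ≤ L * D / c ^ 2 :=
    div_le_div₀ hLD hI (by positivity) (by rw [sq]; gcongr)
  have e3 : 3 * L / c ^ 2 * D = 3 * (L * D / c ^ 2) := by ring
  rw [e3]
  linarith

/-! ### Mollified time increments. -/

section TimeContinuity

variable {N : ℕ} {Ω : Set (EuclideanSpace ℝ (Fin N))} {M m : ℝ} {δ : ℝ} {ρ : ℝ → ℝ}

lemma IsMollifier.setIntegral_comp_sub (hρ : IsMollifier δ ρ) {t : ℝ} (ht : δ ≤ t) (htM : t < M) :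
    ∫ s in Ioo 0 M, ρ (t - s) = 1 := by
  have : ∀ s, s ∉ Ioo 0 M → ρ (t - s) = 0 := fun s hs =>
    hρ.eq_zero _ fun h' => hs ⟨by linarith [h'.2], by linarith [h'.1]⟩
  rw [setIntegral_eq_integral_of_forall_compl_eq_zero this, integral_sub_left_eq_self ρ volume t,
    hρ.integral_eq_one]

lemma IsMollifier.lintegral_eq_one (hρ : IsMollifier δ ρ) : ∫⁻ t, ENNReal.ofReal (ρ t) = 1 := by
  rw [← ofReal_integral_eq_lintegral_ofReal hρ.integrable (ae_of_all _ hρ.nonneg),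
    hρ.integral_eq_one, ENNReal.ofReal_one]

/-- Substitute `σ = t - s` and apply Tonelli: the left side is a `ρ`-weighted average of translation
increments, with shifts in `(0, δ)` only. -/
lemma IsMollifier.lintegral_time_increment_le (hρ : IsMollifier δ ρ)
    {g : ℝ × EuclideanSpace ℝ (Fin N) → ℝ} (hg : Measurable g) {η : ℝ≥0∞}
    (hη : ∀ σ ∈ Ioo 0 δ, eLpNorm (fun z => g (timeShift σ z) - g z) 1 volume ≤ η) :
    ∫⁻ z, ∫⁻ s, ENNReal.ofReal (ρ (z.1 - s)) * ‖g (s, z.2) - g z‖ₑ ≤ η := by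
  have e1 : ∀ z : ℝ × EuclideanSpace ℝ (Fin N),
      ∫⁻ s, ENNReal.ofReal (ρ (z.1 - s)) * ‖g (s, z.2) - g z‖ₑ =
      ∫⁻ σ, ENNReal.ofReal (ρ σ) * ‖g (timeShift σ z) - g z‖ₑ := fun z => by
    rw [← lintegral_sub_left_eq_self (μ := (volume : Measure ℝ))
      (fun σ => ENNReal.ofReal (ρ σ) * ‖g (timeShift σ z) - g z‖ₑ) z.1]
    simp only [timeShift, sub_sub_cancel]
  simp_rw [e1]
  have hρm := hρ.continuous.measurable
  rw [lintegral_lintegral_swap]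
  · have e2 : ∀ σ, ∫⁻ z, ENNReal.ofReal (ρ σ) * ‖g (timeShift σ z) - g z‖ₑ ≤
        ENNReal.ofReal (ρ σ) * η := fun σ => by
      by_cases hσ : σ ∈ Ioo 0 δ
      · rw [lintegral_const_mul']
        · rw [← eLpNorm_one_eq_lintegral_enorm]
          exact mul_le_mul_right (hη σ hσ) _
        · exact ENNReal.ofReal_ne_top
      · simp [hρ.eq_zero σ hσ]
    refine (lintegral_mono e2).trans ?_
    rw [lintegral_mul_const _ hρm.ennreal_ofReal, hρ.lintegral_eq_one, one_mul]
  · refine Measurable.aemeasurable ?_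
    have h1 : Measurable fun q : (ℝ × EuclideanSpace ℝ (Fin N)) × ℝ => timeShift q.2 q.1 := by
      unfold timeShift; fun_prop
    exact (hρm.comp measurable_snd).ennreal_ofReal.mul
      ((hg.comp h1).sub (hg.comp measurable_fst)).enorm

end TimeContinuity

/-! ### Contraction with a controlled source. -/

section Contraction

variable {N : ℕ} {Ω : Set (EuclideanSpace ℝ (Fin N))} {M m : ℝ} {α : ℝ → ℝ}
  {v₀ u₀ : EuclideanSpace ℝ (Fin N) → ℝ} {v u : ℝ × EuclideanSpace ℝ (Fin N) → ℝ}
  {Dv a Du b : ℝ × EuclideanSpace ℝ (Fin N) → EuclideanSpace ℝ (Fin N)}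
  {F H : ℝ × EuclideanSpace ℝ (Fin N) → ℝ}

lemma integrable_integral_double {g : ℝ × (ℝ × EuclideanSpace ℝ (Fin N)) → ℝ}
    (hg : Integrable g (doubleMeasure Ω M)) :
    Integrable (fun p : ℝ × ℝ => ∫ x in Ω, g (p.1, (p.2, x)))
      ((volume.restrict (Ioo 0 M)).prod (volume.restrict (Ioo 0 M))) ∧
    ∫ q, g q ∂(doubleMeasure Ω M) = ∫ p : ℝ × ℝ, (∫ x in Ω, g (p.1, (p.2, x)))
      ∂((volume.restrict (Ioo 0 M)).prod (volume.restrict (Ioo 0 M))) := by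
  have hmp := measurePreserving_prodAssoc (volume.restrict (Ioo 0 M)) (volume.restrict (Ioo 0 M))
    (volume.restrict Ω)
  have hg' := hmp.integrable_comp_of_integrable hg
  exact ⟨hg'.integral_prod_left, (hmp.integral_comp
    MeasurableEquiv.prodAssoc.measurableEmbedding g).symm.trans (integral_prod _ hg')⟩

/-- A nonlocal source is controlled only after integration in `x`; a kernel depending on the times
alone lets that comparison pass through. -/
lemma integral_kernel_mul_mono {k : ℝ → ℝ → ℝ} (hk : Continuous fun q : ℝ × ℝ => k q.1 q.2)
    (hk0 : ∀ s t, 0 ≤ k s t) {g₁ g₂ : ℝ × (ℝ × EuclideanSpace ℝ (Fin N)) → ℝ}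
    (h₁ : Integrable g₁ (doubleMeasure Ω M)) (h₂ : Integrable g₂ (doubleMeasure Ω M))
    (h : ∀ s t, ∫ x in Ω, g₁ (s, (t, x)) ≤ ∫ x in Ω, g₂ (s, (t, x))) :
    ∫ q, k q.1 q.2.1 * g₁ q ∂(doubleMeasure Ω M) ≤
      ∫ q, k q.1 q.2.1 * g₂ q ∂(doubleMeasure Ω M) := by
  obtain ⟨i₁, e₁⟩ := integrable_integral_double (integrable_kernel_mul hk h₁)
  obtain ⟨i₂, e₂⟩ := integrable_integral_double (integrable_kernel_mul hk h₂)
  rw [e₁, e₂]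
  refine integral_mono i₁ i₂ fun p => ?_
  simp only [integral_const_mul]
  exact mul_le_mul_of_nonneg_left (h _ _) (hk0 _ _)

/-- Continuity of translations in time, averaged. -/
lemma exists_time_increment_le [IsFiniteMeasure (volume.restrict Ω)] (hΩ : MeasurableSet Ω)
    {g : ℝ × EuclideanSpace ℝ (Fin N) → ℝ} (hg : Measurable g) {C : ℝ} (hC : ∀ z, |g z| ≤ C)
    {η : ℝ} (hη : 0 < η) :
    ∃ δ₀ > 0, ∀ δ ∈ Ioc 0 δ₀, ∀ ρ, IsMollifier δ ρ →
      ∫ q, ρ (q.2.1 - q.1) * |g (q.1, q.2.2) - g q.2| ∂(doubleMeasure Ω M) ≤ η := by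
  set G := (Ioo 0 M ×ˢ Ω).indicator g with hG
  have hGm : Measurable G := hg.indicator (measurableSet_Ioo.prod hΩ)
  have hGL : MemLp G 1 volume := memLp_indicator_cyl hΩ
    (MemLp.of_bound hg.aestronglyMeasurable C (ae_of_all _ hC))
  have ht := tendsto_eLpNorm_timeShift le_rfl ENNReal.one_ne_top hGL 0
  have ht' := (tendsto_order.1 ht).2 (ENNReal.ofReal η) (by simpa using hη)
  obtain ⟨δ₀, hδ₀, hball⟩ := Metric.eventually_nhds_iff.1 ht'
  refine ⟨δ₀, hδ₀, fun δ hδ ρ hρ => ?_⟩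
  have key := hρ.lintegral_time_increment_le hGm (η := ENNReal.ofReal η) fun σ hσ => by
    have := hball (y := σ) (by
      rw [Real.dist_eq, sub_zero, abs_of_pos hσ.1]; exact hσ.2.trans_le hδ.2)
    simpa [timeShift] using this.le
  have hρm := hρ.continuous.measurable
  have hm1 : Measurable fun q : ℝ × (ℝ × EuclideanSpace ℝ (Fin N)) =>
      |g (q.1, q.2.2) - g q.2| :=
    ((measurable_comp_other_time hg).sub (hg.comp measurable_snd)).abs
  have hm2 : Measurable fun q : ℝ × (ℝ × EuclideanSpace ℝ (Fin N)) => ρ (q.2.1 - q.1) := by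
    fun_prop
  have hm3 : Measurable fun q : ℝ × (ℝ × EuclideanSpace ℝ (Fin N)) =>
      ENNReal.ofReal (ρ (q.2.1 - q.1) * |g (q.1, q.2.2) - g q.2|) := (hm2.mul hm1).ennreal_ofReal
  rw [integral_eq_lintegral_of_nonneg_ae
    (ae_of_all _ fun q => mul_nonneg (hρ.nonneg _) (abs_nonneg _))
    (hm2.mul hm1).aestronglyMeasurable]
  refine ENNReal.toReal_le_of_le_ofReal hη.le (le_trans ?_ key)
  rw [doubleMeasure, lintegral_prod_symm' _ hm3]
  refine le_trans (lintegral_mono_ae ?_) (lintegral_mono' (cylMeasure_le_volume (Ω := Ω) (M := M))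
    le_rfl)
  filter_upwards [ae_mem_cyl (Ω := Ω) (M := M) hΩ] with z hz
  refine le_trans (lintegral_mono_ae ?_) (lintegral_mono' Measure.restrict_le_self le_rfl)
  filter_upwards [ae_restrict_mem measurableSet_Ioo] with s hs
  rw [ENNReal.ofReal_mul (hρ.nonneg _), hG, indicator_of_mem hz,
    indicator_of_mem (show (s, z.2) ∈ Ioo 0 M ×ˢ Ω from ⟨hs, hz.2⟩), Real.enorm_eq_ofReal_abs]

/-- For `t ≥ δ` the mollifier has full mass in `s` over `(0, M)`. For `t < δ` part of it may fall
before time 0, so this layer is discarded. -/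
lemma le_integral_kernel_mul (hΩ : MeasurableSet Ω) {k : ℝ → ℝ} (hk : Continuous k)
    (hk0 : ∀ t, 0 ≤ k t) {d : ℝ × EuclideanSpace ℝ (Fin N) → ℝ}
    (hd : Integrable d (cylMeasure Ω M)) (hd0 : ∀ z, 0 ≤ d z) {δ : ℝ} {ρ : ℝ → ℝ}
    (hρ : IsMollifier δ ρ) :
    ∫ z, k z.1 * d z ∂(cylMeasure Ω M) -
      ∫ z, {z : ℝ × EuclideanSpace ℝ (Fin N) | z.1 < δ}.indicator (fun z => |k z.1 * d z|) z
        ∂(cylMeasure Ω M) ≤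
      ∫ q, k q.2.1 * ρ (q.2.1 - q.1) * d q.2 ∂(doubleMeasure Ω M) := by
  have hρ0 := hρ.continuous
  have i1 := integrable_kernel_mul (Ω := Ω) (M := M) (k := fun s t => k t * ρ (t - s)) (by fun_prop)
    (hd.comp_snd (volume.restrict (Ioo 0 M)))
  obtain ⟨B, hB⟩ := (isCompact_Icc (a := (0 : ℝ)) (b := M)).exists_bound_of_continuousOn
    hk.continuousOn
  have i2 : Integrable (fun z => k z.1 * d z) (cylMeasure Ω M) :=
    hd.bdd_mul (c := B) (hk.comp continuous_fst).aestronglyMeasurable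
      ((ae_mem_cyl hΩ).mono fun z hz => hB _ (Ioo_subset_Icc_self hz.1))
  have i3 := i2.abs.indicator (measurableSet_lt measurable_fst (measurable_const (a := δ)))
  rw [doubleMeasure] at i1 ⊢
  rw [integral_prod_symm _ i1, ← integral_sub i2 i3]
  refine integral_mono_ae (i2.sub i3) i1.integral_prod_right ?_
  filter_upwards [ae_mem_cyl hΩ] with z hz
  change k z.1 * d z - {z : ℝ × EuclideanSpace ℝ (Fin N) | z.1 < δ}.indicator
    (fun z => |k z.1 * d z|) z ≤ ∫ s in Ioo 0 M, k z.1 * ρ (z.1 - s) * d z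
  have e : ∫ s in Ioo 0 M, k z.1 * ρ (z.1 - s) * d z =
      k z.1 * (∫ s in Ioo 0 M, ρ (z.1 - s)) * d z := by
    rw [integral_mul_const, integral_const_mul]
  rw [e]
  by_cases hz' : z.1 < δ
  · rw [indicator_of_mem (show z ∈ {z : ℝ × EuclideanSpace ℝ (Fin N) | z.1 < δ} from hz')]
    have h1 := le_abs_self (k z.1 * d z)
    have h2 : 0 ≤ k z.1 * (∫ s in Ioo 0 M, ρ (z.1 - s)) * d z :=
      mul_nonneg (mul_nonneg (hk0 _) (integral_nonneg fun s => hρ.nonneg _)) (hd0 z)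
    linarith
  · rw [indicator_of_notMem (show z ∉ {z : ℝ × EuclideanSpace ℝ (Fin N) | z.1 < δ} from hz'),
      hρ.setIntegral_comp_sub (not_lt.1 hz') hz.1.2, mul_one, sub_zero]

variable [IsFiniteMeasure (volume.restrict Ω)] {φ φ' : ℝ → ℝ} {c : ℝ}

/-- Kato's inequality when the difference of the sources is controlled in `L^1`. -/
lemma IsEvolution.kato_of_source_le (hΩ : MeasurableSet Ω) (hm : 1 < m) (hM : 0 < M)
    (h : IsEvolution Ω M m α v₀ v Dv a F) (h' : IsEvolution Ω M m α u₀ u Du b H)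
    (hab : ∀ p p', 0 ≤ inner ℝ (a p - b p') (Dv p - Du p'))
    (hFH : ∀ t s, ∫ x in Ω, |F (t, x) - H (s, x)| ≤
      c * ∫ x in Ω, |α (v (t, x)) - α (u (s, x))|)
    {K : ℝ≥0} (hα : LipschitzWith K α) (hmono : Monotone α)
    (hφ : ∀ t, HasDerivAt φ (φ' t) t) (hφ' : Continuous φ') (hφ0 : ∀ t, 0 ≤ φ t)
    (hφM : ∀ t, M ≤ t → φ t = 0) {δ : ℝ} {ρ : ℝ → ℝ} (hρ : IsMollifier δ ρ)
    (hρc : ContDiff ℝ ∞ ρ) :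
    (∫ q, -(φ' q.2.1 + c * φ q.2.1) * ρ (q.2.1 - q.1) * |α (v q.2) - α (u (q.1, q.2.2))|
      ∂(doubleMeasure Ω M)) ≤
      ∫ s in Ioo 0 M, φ s * ρ s * ∫ x in Ω, |α (v (s, x)) - α (u₀ x)| := by
  have key := h.kato hΩ hm hM h' hab hα hmono hφ hφ' hφ0 hφM hρ hρc
  have hφc : Continuous φ := continuous_iff_continuousAt.2 fun t => (hφ t).continuousAt
  have hρ0 := hρ.continuous
  have hd := h.integrable_abs_sub_double h' hα.continuous
  have hs := integral_kernel_mul_mono (k := fun s t => φ t * ρ (t - s)) (by fun_prop)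
    (fun s t => mul_nonneg (hφ0 t) (hρ.nonneg _)) (h.integrable_abs_source_sub h')
    (hd.const_mul c) (fun s t => by simpa only [integral_const_mul] using hFH t s)
  have i1 := integrable_kernel_mul (k := fun s t => φ' t * ρ (t - s)) (by fun_prop) hd
  have i2 := integrable_kernel_mul (k := fun s t => φ t * ρ (t - s)) (by fun_prop)
    (hd.const_mul c)
  have e : (∫ q, -(φ' q.2.1 + c * φ q.2.1) * ρ (q.2.1 - q.1) * |α (v q.2) - α (u (q.1, q.2.2))|
      ∂(doubleMeasure Ω M)) =
      -(∫ q, φ' q.2.1 * ρ (q.2.1 - q.1) * |α (v q.2) - α (u (q.1, q.2.2))| ∂(doubleMeasure Ω M)) -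
      ∫ q, φ q.2.1 * ρ (q.2.1 - q.1) * (c * |α (v q.2) - α (u (q.1, q.2.2))|)
        ∂(doubleMeasure Ω M) := by
    have i1' : Integrable (fun q : ℝ × (ℝ × EuclideanSpace ℝ (Fin N)) =>
        -(φ' q.2.1 * ρ (q.2.1 - q.1) * |α (v q.2) - α (u (q.1, q.2.2))|)) (doubleMeasure Ω M) :=
      i1.neg
    rw [← integral_neg, ← integral_sub i1' i2]
    congr 1 with q
    ring
  rw [e]
  linarith

end Contraction

lemma hasDerivAt_max_sub_sq (M t : ℝ) :
    HasDerivAt (fun t => (max (M - t) 0) ^ 2) (-(2 * max (M - t) 0)) t := by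
  rcases lt_trichotomy t M with h | rfl | h
  · have h1 : HasDerivAt (fun t => (M - t) ^ 2) (2 * (M - t) * (-1)) t :=
      (((hasDerivAt_id t).const_sub M).pow 2).congr_deriv (by simp)
    rw [max_eq_left (sub_pos.2 h).le]
    refine (h1.congr_of_eventuallyEq ?_).congr_deriv (by ring)
    filter_upwards [Iio_mem_nhds h] with s hs
    rw [max_eq_left (sub_pos.2 hs).le]
  · have h1 : HasDerivAt (fun s : ℝ => (t - s) ^ 2) (2 * (t - t) * (-1)) t :=
      (((hasDerivAt_id t).const_sub t).pow 2).congr_deriv (by simp)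
    rw [hasDerivAt_iff_isLittleO] at h1 ⊢
    -- At the kink the function is dominated by the full square, whose derivative there is zero.
    refine Asymptotics.IsBigO.trans_isLittleO (Asymptotics.IsBigO.of_norm_le fun s => ?_) h1
    have h2 : 0 ≤ max (t - s) 0 := le_max_right _ _
    have h3 : max (t - s) 0 ≤ |t - s| := max_le (le_abs_self _) (abs_nonneg _)
    simp only [sub_self, max_self, mul_zero, neg_zero, zero_mul, smul_zero, sub_zero, ne_eq,
      OfNat.ofNat_ne_zero, not_false_eq_true, zero_pow]
    rw [Real.norm_of_nonneg (sq_nonneg _), ← sq_abs (t - s)]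
    exact pow_le_pow_left₀ h2 h3 2
  · rw [max_eq_right (sub_neg.2 h).le]
    refine ((hasDerivAt_const t (0 : ℝ)).congr_of_eventuallyEq ?_).congr_deriv (by simp)
    filter_upwards [Ioi_mem_nhds h] with s hs
    rw [max_eq_right (sub_neg.2 hs).le]
    simp

/-! ### Uniqueness for the balance law. -/

section Uniqueness

variable {N : ℕ} {Ω : Set (EuclideanSpace ℝ (Fin N))} {M m : ℝ} {α : ℝ → ℝ}
  {v₀ u₀ : EuclideanSpace ℝ (Fin N) → ℝ} {v u : ℝ × EuclideanSpace ℝ (Fin N) → ℝ}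
  {Dv a Du b : ℝ × EuclideanSpace ℝ (Fin N) → EuclideanSpace ℝ (Fin N)}
  {F H : ℝ × EuclideanSpace ℝ (Fin N) → ℝ}

/-- Uniqueness for monotone fluxes and sources that are Lipschitz in `L^1` along `α`. -/
lemma IsEvolution.ae_eq [IsFiniteMeasure (volume.restrict Ω)] (hΩ : IsOpen Ω) (hm : 1 < m)
    (hM : 0 < M) (h : IsEvolution Ω M m α v₀ v Dv a F) (h' : IsEvolution Ω M m α u₀ u Du b H)
    (h₀ : v₀ =ᵐ[volume.restrict Ω] u₀)
    (hab : ∀ p p', 0 ≤ inner ℝ (a p - b p') (Dv p - Du p')) {c : ℝ} (hc : 0 ≤ c)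
    (hFH : ∀ t s, ∫ x in Ω, |F (t, x) - H (s, x)| ≤
      c * ∫ x in Ω, |α (v (t, x)) - α (u (s, x))|)
    {K : ℝ≥0} (hα : LipschitzWith K α) (hmono : StrictMono α) :
    v =ᵐ[cylMeasure Ω M] u := by
  obtain ⟨C, hC⟩ := h.bounded
  obtain ⟨C', hC'⟩ := h'.bounded
  have hαc := hα.continuous
  -- Gronwall is built into the weight: `-(φ' + c φ) = k`, which is positive on `(0, M)`. The square
  -- makes `φ` continuously differentiable at `M`.
  set φ : ℝ → ℝ := fun t => Real.exp (-(c * t)) * (max (M - t) 0) ^ 2 with hφdef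
  set k : ℝ → ℝ := fun t => Real.exp (-(c * t)) * (2 * max (M - t) 0) with hkdef
  set φ' : ℝ → ℝ := fun t => -(c * φ t) - k t with hφ'def
  have hφ : ∀ t, HasDerivAt φ (φ' t) t := fun t => by
    have h1 : HasDerivAt (fun t => Real.exp (-(c * t))) (Real.exp (-(c * t)) * (-(c * 1))) t :=
      (((hasDerivAt_id t).const_mul c).neg).exp
    refine (h1.mul (hasDerivAt_max_sub_sq M t)).congr_deriv ?_
    simp only [hφ'def, hφdef, hkdef]
    ring
  have hφ0 : ∀ t, 0 ≤ φ t := fun t => by positivity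
  have hmax : ∀ t, 0 ≤ max (M - t) 0 := fun t => le_max_right _ _
  have hk0 : ∀ t, 0 ≤ k t := fun t => mul_nonneg (Real.exp_pos _).le (by linarith [hmax t])
  have hφc : Continuous φ := by simp only [hφdef]; fun_prop
  have hkc : Continuous k := by simp only [hkdef]; fun_prop
  have hφ'c : Continuous φ' := (hφc.const_mul c).neg.sub hkc
  have hφM : ∀ t, M ≤ t → φ t = 0 := fun t ht => by
    simp only [hφdef]
    rw [max_eq_right (by linarith)]
    simp
  have hexp : ∀ t ∈ Ioo 0 M, Real.exp (-(c * t)) ≤ 1 := fun t ht =>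
    Real.exp_le_one_iff.2 (neg_nonpos.2 (mul_nonneg hc ht.1.le))
  have hmaxM : ∀ t ∈ Ioo 0 M, max (M - t) 0 ≤ M := fun t ht =>
    max_le (by linarith [ht.1]) hM.le
  have hφle : ∀ t ∈ Ioo 0 M, φ t ≤ M ^ 2 := fun t ht =>
    (mul_le_of_le_one_left (sq_nonneg _) (hexp t ht)).trans
      (pow_le_pow_left₀ (hmax t) (hmaxM t ht) 2)
  have hkle : ∀ t ∈ Ioo 0 M, k t ≤ 2 * M := fun t ht =>
    (mul_le_of_le_one_left (by linarith [hmax t]) (hexp t ht)).trans (by linarith [hmaxM t ht])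
  set d : ℝ × EuclideanSpace ℝ (Fin N) → ℝ := fun z => |α (v z) - α (u z)| with hd
  have hdi : Integrable d (cylMeasure Ω M) :=
    integrable_abs_comp_sub hαc h.measurable h'.measurable hC hC'
  have hd0 : ∀ z, 0 ≤ d z := fun z => abs_nonneg _
  have hkdi : Integrable (fun z => k z.1 * d z) (cylMeasure Ω M) :=
    hdi.bdd_mul (c := 2 * M) (hkc.comp continuous_fst).aestronglyMeasurable
      ((ae_mem_cyl hΩ.measurableSet).mono fun z hz => by
        rw [Real.norm_of_nonneg (hk0 _)]; exact hkle _ hz.1)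
  obtain ⟨Cα, hCα⟩ := exists_abs_comp_le hαc hC'
  have hzero : ∫ z, k z.1 * d z ∂(cylMeasure Ω M) ≤ 0 := by
    refine le_of_forall_pos_le_add fun η hη => ?_
    -- Three errors: the initial layer (1), moving `u` from time `s` to `t` (`2 M ≥ k`), and the
    -- initial term (`M² ≥ φ`).
    obtain ⟨ε, hε, hεη⟩ : ∃ ε > 0, ε * (1 + 2 * M + M ^ 2) ≤ η :=
      ⟨η / (1 + 2 * M + M ^ 2), by positivity, le_of_eq (by field_simp)⟩
    obtain ⟨δ₁, hδ₁, h1⟩ := h.initial_continuity hΩ hm hM hα hmono.monotone hε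
    obtain ⟨δ₂, hδ₂, h2⟩ := exists_time_increment_le (Ω := Ω) (M := M) hΩ.measurableSet
      (hαc.measurable.comp h'.measurable) hCα hε
    have h3 := (tendsto_order.1 (tendsto_integral_initial_layer hkdi)).2 ε hε
    obtain ⟨δ₃, hδ₃, h3'⟩ := mem_nhdsGT_iff_exists_Ioc_subset.1 h3
    set δ := min δ₁ (min δ₂ δ₃) with hδ
    have hδ0 : 0 < δ := lt_min hδ₁ (lt_min hδ₂ hδ₃)
    obtain ⟨ρ, hρ, hρc⟩ := exists_isMollifier_contDiff hδ0
    have g1 := h1 δ ⟨hδ0, min_le_left _ _⟩ ρ hρ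
    have g2 := h2 δ ⟨hδ0, (min_le_right _ _).trans (min_le_left _ _)⟩ ρ hρ
    have g3 := h3' ⟨hδ0, (min_le_right _ _).trans (min_le_right _ _)⟩
    have hρ0 := hρ.continuous
    have g4 := le_integral_kernel_mul hΩ.measurableSet hkc hk0 hdi hd0 hρ
    have g5 := h.kato_of_source_le hΩ.measurableSet hm hM h' hab hFH hα hmono.monotone hφ hφ'c hφ0
      hφM hρ hρc
    have e5 : ∀ t, -(φ' t + c * φ t) = k t := fun t => by simp only [hφ'def]; ring
    simp only [e5] at g5
    have i0 := h.integrable_abs_sub_double h' hαc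
    have i1 := integrable_kernel_mul (k := fun s t => k t * ρ (t - s)) (by fun_prop) i0
    have iinc : Integrable (fun q : ℝ × (ℝ × EuclideanSpace ℝ (Fin N)) =>
        |α (u (q.1, q.2.2)) - α (u q.2)|) (doubleMeasure Ω M) :=
      integrable_abs_comp_sub hαc (measurable_comp_other_time h'.measurable)
        (h'.measurable.comp measurable_snd) (fun q => hC' _) (fun q => hC' _)
    have i2 := integrable_kernel_mul (k := fun s t => ρ (t - s)) (by fun_prop) iinc
    have i3 := integrable_kernel_mul (Ω := Ω) (M := M) (k := fun s t => k t * ρ (t - s))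
      (by fun_prop) (hdi.comp_snd (volume.restrict (Ioo 0 M)))
    have g6 : ∫ q, k q.2.1 * ρ (q.2.1 - q.1) * d q.2 ∂(doubleMeasure Ω M) ≤
        (∫ q, k q.2.1 * ρ (q.2.1 - q.1) * |α (v q.2) - α (u (q.1, q.2.2))| ∂(doubleMeasure Ω M)) +
        2 * M * ∫ q, ρ (q.2.1 - q.1) * |α (u (q.1, q.2.2)) - α (u q.2)| ∂(doubleMeasure Ω M) := by
      rw [← integral_const_mul, ← integral_add i1 (i2.const_mul _)]
      refine integral_mono_ae i3 (i1.add (i2.const_mul _)) ?_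
      filter_upwards [ae_doubleMeasure_mem] with q hq
      change k q.2.1 * ρ (q.2.1 - q.1) * |α (v q.2) - α (u q.2)| ≤
        k q.2.1 * ρ (q.2.1 - q.1) * |α (v q.2) - α (u (q.1, q.2.2))| +
        2 * M * (ρ (q.2.1 - q.1) * |α (u (q.1, q.2.2)) - α (u q.2)|)
      have t1 := abs_sub_le (α (v q.2)) (α (u (q.1, q.2.2))) (α (u q.2))
      have t2 := mul_le_mul_of_nonneg_left t1 (mul_nonneg (hk0 q.2.1) (hρ.nonneg (q.2.1 - q.1)))
      have t3 := mul_le_mul_of_nonneg_right (hkle _ hq.2) (mul_nonneg (hρ.nonneg (q.2.1 - q.1))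
        (abs_nonneg (α (u (q.1, q.2.2)) - α (u q.2))))
      linarith
    have g7 : ∫ s in Ioo 0 M, φ s * ρ s * ∫ x in Ω, |α (v (s, x)) - α (u₀ x)| ≤ M ^ 2 * ε := by
      -- Equality of the data enters here: the surviving initial term compares `v` with `u₀`, while
      -- initial continuity compares it with `v₀`.
      have e7 : ∀ s, ∫ x in Ω, |α (v (s, x)) - α (u₀ x)| = ∫ x in Ω, |α (v (s, x)) - α (v₀ x)| :=
        fun s => integral_congr_ae (h₀.mono fun x hx => by simp only [hx])
      obtain ⟨C₀, hC₀⟩ := h.bounded_initial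
      have iY : Integrable (fun s => ∫ x in Ω, |α (v (s, x)) - α (v₀ x)|)
          (volume.restrict (Ioo 0 M)) :=
        Integrable.integral_prod_left (integrable_abs_comp_sub (μ := cylMeasure Ω M) hαc h.measurable
          (h.measurable_initial.comp measurable_snd) hC (fun p => hC₀ _))
      have hmul : ∀ ψ : ℝ → ℝ, Continuous ψ → Integrable
          (fun s => ψ s * ∫ x in Ω, |α (v (s, x)) - α (v₀ x)|) (volume.restrict (Ioo 0 M)) := by
        intro ψ hψ
        obtain ⟨B, hB⟩ := (isCompact_Icc (a := (0 : ℝ)) (b := M)).exists_bound_of_continuousOn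
          hψ.continuousOn
        exact iY.bdd_mul (c := B) hψ.aestronglyMeasurable
          ((ae_restrict_mem measurableSet_Ioo).mono fun s hs => hB s (Ioo_subset_Icc_self hs))
      simp_rw [e7]
      refine le_trans ?_ (mul_le_mul_of_nonneg_left g1 (sq_nonneg M))
      rw [← integral_const_mul]
      refine integral_mono_ae (hmul _ (hφc.mul hρ0)) ((hmul _ hρ0).const_mul _) ?_
      filter_upwards [ae_restrict_mem measurableSet_Ioo] with s hs
      have hY : 0 ≤ ∫ x in Ω, |α (v (s, x)) - α (v₀ x)| := integral_nonneg fun x => abs_nonneg _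
      change φ s * ρ s * (∫ x in Ω, |α (v (s, x)) - α (v₀ x)|) ≤
        M ^ 2 * (ρ s * ∫ x in Ω, |α (v (s, x)) - α (v₀ x)|)
      rw [mul_assoc]
      exact mul_le_mul_of_nonneg_right (hφle s hs) (mul_nonneg (hρ.nonneg s) hY)
    have g8 := mul_le_mul_of_nonneg_left g2 (by linarith : (0 : ℝ) ≤ 2 * M)
    simp only [mem_ofPred_eq, Function.comp_apply] at g3 g8
    linarith
  have hnn : 0 ≤ᵐ[cylMeasure Ω M] fun z => k z.1 * d z :=
    ae_of_all _ fun z => mul_nonneg (hk0 _) (hd0 _)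
  have hae := (integral_eq_zero_iff_of_nonneg_ae hnn hkdi).1 (le_antisymm hzero
    (integral_nonneg_of_ae hnn))
  filter_upwards [hae, ae_mem_cyl hΩ.measurableSet] with z hz hzm
  have hkpos : 0 < k z.1 := mul_pos (Real.exp_pos _)
    (mul_pos two_pos (lt_max_of_lt_left (sub_pos.2 hzm.1.2)))
  have hdz : d z = 0 := (mul_eq_zero.1 hz).resolve_left hkpos.ne'
  exact hmono.injective (sub_eq_zero.1 (abs_eq_zero.1 hdz))

end Uniqueness

end Thermistor

/-! ### The theorem. -/

theorem mainTheorem4 (N : ℕ) (hN : 1 ≤ N)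
    (Ω : Set (EuclideanSpace ℝ (Fin N))) (hΩ_open : IsOpen Ω)
    (hΩ_bdd : Bornology.IsBounded Ω)
    (M m κ : ℝ) (hM : 0 < M) (hm : 2 ≤ m) (hκ : 0 ≤ κ)
    (α : ℝ → ℝ) (hα_lip : ∃ K : ℝ≥0, LipschitzWith K α) (hα_mono : StrictMono α)
    (hα_zero : α 0 = 0)
    (hα_deriv : ∃ lam : ℝ, 0 < lam ∧ ∀ᵐ s : ℝ, lam ≤ deriv α s)
    (f : ℝ → ℝ) (hf_lip : ∃ K : ℝ≥0, LipschitzWith K f)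
    (hf_pos : ∃ σ : ℝ, 0 < σ ∧ ∀ s, σ ≤ f s)
    (hfα : ∃ L₂ : ℝ, 0 < L₂ ∧ ∀ a b, |f a - f b| ≤ L₂ * |α a - α b|)
    (v₀ u₀ : EuclideanSpace ℝ (Fin N) → ℝ)
    (hv₀ : MemLp v₀ ∞ (volume.restrict Ω)) (hu₀ : MemLp u₀ ∞ (volume.restrict Ω))
    (h₀ : v₀ =ᵐ[volume.restrict Ω] u₀)
    (v u : ℝ × EuclideanSpace ℝ (Fin N) → ℝ)
    (hv : Thermistor.IsBoundedWeakSolution Ω M m κ α f v₀ v)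
    (hu : Thermistor.IsBoundedWeakSolution Ω M m κ α f u₀ u) :
    v =ᵐ[Thermistor.cylMeasure Ω M] u := by
  obtain ⟨K, hK⟩ := hα_lip
  obtain ⟨Kf, hKf⟩ := hf_lip
  obtain ⟨σ, hσ0, hσ⟩ := hf_pos
  obtain ⟨L, hL0, hL⟩ := hfα
  have hfin : IsFiniteMeasure (volume.restrict Ω) :=
    ⟨by rw [Measure.restrict_apply_univ]; exact hΩ_bdd.measure_lt_top⟩
  obtain ⟨v₀', v', Dv', hv₀', hv', ev⟩ :=
    hv.exists_isEvolution hm hK.continuous hKf.continuous hσ0 hσ hv₀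
  obtain ⟨u₀', u', Du', hu₀', hu', eu⟩ :=
    hu.exists_isEvolution hm hK.continuous hKf.continuous hσ0 hσ hu₀
  obtain ⟨C, hC⟩ := ev.bounded
  obtain ⟨C', hC'⟩ := eu.bounded
  have hm1 : 1 < m := one_lt_two.trans_le hm
  refine hv'.trans (Filter.EventuallyEq.trans ?_ hu'.symm)
  -- The constant is `κ` times the `L^1` Lipschitz constant of the nonlocal term along `α`.
  refine ev.ae_eq hΩ_open hm1 hM eu (hv₀'.symm.trans (h₀.trans hu₀'))
    (fun p p' => Thermistor.inner_flux_sub_nonneg hm _ _)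
    (c := κ * (3 * L / (σ * (volume.restrict Ω).real univ) ^ 2)) (by positivity) (fun t s => ?_)
    hK hα_mono
  have key := Thermistor.integral_abs_nonlocal_sub_le (μ := volume.restrict Ω) hK.continuous
    hKf.continuous hσ0 hσ hL0.le hL (ev.measurable.comp (measurable_prodMk_left (x := t)))
    (eu.measurable.comp (measurable_prodMk_left (x := s))) (fun x => hC _) (fun x => hC' _)
  simp only [← mul_sub, abs_mul, abs_of_nonneg hκ, integral_const_mul]
  rw [mul_assoc]
  exact mul_le_mul_of_nonneg_left key hκ
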